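/- Fix $\lambda_P>0$ and put $\theta=\lambda_P^2$. On $L^2(\mathbb R)$ let $(\mathfrak q\psi)(x)=x\psi(x)$, $\mathfrak p=-i\theta\,\partial_x$, and let $|m\rangle$ ($m\ge 0$) be the normalized eigenfunctions of $\tfrac12(\mathfrak q^2+\mathfrak p^2)$. The Moyal product on the plane is $$(f\star g)(x)=\frac1{(\pi\theta)^2}\int\!\!\int f(x+u)\,g(x+v)\,e^{-\frac{2i}{\theta}(u_2v_1-u_1v_2)}\,dv\,du,$$ $\mathcal L(f)\psi=f\star\psi$ on $L^2(\mathbb R^2)$ with core the Schwartz space $S(\mathbb R^2)$, $z=(x_1+ix_2)/\sqrt2$, $z^*=\bar z$, and $a=(q_1+iq_2)/\sqrt2$ is represented by $\mathcal L(z)$, so that $[a,a^*]=\lambda_P^2$. A multiplier is a function $l$ of temperate growth (smooth, all derivatives polynomially bounded) such that $l\star\psi$ and $\psi\star l$ are Schwartz for all Schwartz $\psi$; the product of multipliers is given by composition of left multiplications. The eigenstates are $\omega_m(f)=\langle m|\pi_S(f)|m\rangle$, with $\pi_S$ the Schrödinger (Weyl) representation; on operators $T$ of $L^2(\mathbb R^2)$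 defined on $S(\mathbb R^2)$, $\omega_m(T)=\langle h_{m0},Th_{m0}\rangle$, where $h_{m0}$ is the normalized Wigner transition function, which corresponds to $|m\rangle\otimes|0\rangle$ under the unitary equivalence $\mathcal L\simeq\pi_S\otimes\mathbb I$. With $D=-i\sqrt2\begin{pmatrix}0&\bar\partial\\ \partial&0\end{pmatrix}$ on $L^2(\mathbb R^2)\otimes\mathbb C^2$, the spectral distance is $$d_D(\varphi,\tilde\varphi)=\sup\{|\varphi(f)-\tilde\varphi(f)| : f\in S(\mathbb R^2),\ \|[D,\mathcal L(f)]\|\le1\}.$$ An operator $T$ is an optimal element between $\omega_m$ and $\omega_n$ if $|\omega_m(T)-\omega_n(T)|=d_D(\omega_m,\omega_n)$ and $\|[D,T]\|=1$. It is regularized by an optimal sequence if there are $f_k\in S(\mathbb R^2)$ with $\|[D,\mathcal L(f_k)]\|\le1$, $\mathcal L(f_k)\psi\to T\psi$ for all $\psi\in S(\mathbb R^2)$ and $|\omega_m(f_k)-\omega_n(f_k)|\to d_D(\omega_m,\omega_n)$. For a pair of operators $b,b^*$ put $$l_1(b)=\sqrt{bb^*+b^*b},\qquad l_2(b)=\sqrt{2(bb^*-\lambda_P^2)},\qquad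 l_3(b)=\sqrt{2(b^*b+\lambda_P^2)},$$ the square root being the positive selfadjoint square root of the closure of the operator on Schwartz functions. 1. With $dq_\mu=q_\mu\otimes1-1\otimes q_\mu$ and $da=(dq_1+i\,dq_2)/\sqrt2$, acting on $L^2(\mathbb R)\otimes L^2(\mathbb R)$ in the Schrödinger representation, the length operator $L=\sqrt{(dq_1)^2+(dq_2)^2}$ is well defined and $L=l_1(da)=l_2(da)=l_3(da)$. 2. There is a multiplier $l_0$ which is a solution of $$(\partial_zl_0\star z)\star(\partial_zl_0\star z)^*=\tfrac12\,z^*\star z$$ such that $\mathcal L(l_0)$ is, up to regularization, an optimal element between any two eigenstates: for all $m,n$ it is an optimal element between $\omega_m$ and $\omega_n$ and is regularized by an optimal sequence. Moreover, every multiplier $l$ such that $\mathcal L(l)$ is an optimal element between any two eigenstates is a solution of this equation. 3. The positive selfadjoint operators $l_1(a),l_2(a),l_3(a)$ exist and are unique, and for all $m\ne n$ none of them is an optimal element between $\omega_m$ and $\omega_n$, nor is it regularized by an optimal sequence. -/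

import Mathlib

noncomputable section

namespace Moyal

open MeasureTheory Filter Topology
open scoped ENNReal ComplexConjugate LineDeriv InnerProductSpace

/-- Schwartz functions on the plane. -/
abbrev Sch : Type := SchwartzMap (ℝ × ℝ) ℂ

/-- The Hilbert space `L²(ℝ²)`. -/
abbrev L2 : Type := Lp ℂ 2 (volume : Measure (ℝ × ℝ))

/-- The inclusion of the Schwartz functions in `L²(ℝ²)`. -/
def emb (ψ : Sch) : L2 := ψ.toLp 2 volume

open scoped Classical in
/-- The Schwartz function whose underlying function is `F` (and `0` if `F` is not Schwartz). -/
def toSch (F : ℝ × ℝ → ℂ) : Sch :=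
  if h : ∃ g : Sch, (g : ℝ × ℝ → ℂ) = F then h.choose else 0

/-! ### Positive square roots of operators given on the Schwartz core -/

/-- `A = √P`: the operator `A` is selfadjoint and positive, and `A²` (on its natural domain) is
the closure of the operator `P`, given on the core of Schwartz functions. -/
structure IsPosSqrt (P : Sch → Sch) (A : L2 →ₗ.[ℂ] L2) : Prop where
  selfAdjoint : IsSelfAdjoint A
  nonneg : ∀ x : A.domain, 0 ≤ (⟪(x : L2), A x⟫_ℂ).re
  sq_eq : ∀ x y : L2, (∃ w : L2, (x, w) ∈ A.graph ∧ (w, y) ∈ A.graph) ↔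
    (x, y) ∈ closure (Set.range fun ψ : Sch => (emb ψ, emb (P ψ)))

/-- The squares of the three functions
`l₁ = √(b b* + b* b)`, `l₂ = √(2 (b b* - λ²))`, `l₃ = √(2 (b* b + λ²))`
of a pair of noncommuting operators `b`, `bs = b*`. -/
def lSq (lam : ℝ) (i : Fin 3) (b bs : Sch → Sch) : Sch → Sch := fun ψ =>
  match i with
  | 0 => b (bs ψ) + bs (b ψ)
  | 1 => (2 : ℂ) • (b (bs ψ) - ((lam ^ 2 : ℝ) : ℂ) • ψ)
  | 2 => (2 : ℂ) • (bs (b ψ) + ((lam ^ 2 : ℝ) : ℂ) • ψ)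

/-! ### The length operator

`L²(ℝ) ⊗ L²(ℝ)` is identified with `L²(ℝ²)`; in the Schrödinger representation `q₁ ⊗ 1` and
`1 ⊗ q₁` are the multiplications by the coordinates `x.1` and `x.2`, while `q₂ ⊗ 1` and `1 ⊗ q₂`
are `-iθ` times the corresponding partial derivatives, with `θ = λ²`. -/

/-- `dq₁ = q₁ ⊗ 1 - 1 ⊗ q₁`. -/
def dq₁ (ψ : Sch) : Sch :=
  SchwartzMap.smulLeftCLM ℂ (fun x : ℝ × ℝ => (x.1 : ℂ)) ψ
    - SchwartzMap.smulLeftCLM ℂ (fun x : ℝ × ℝ => (x.2 : ℂ)) ψ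

/-- `dq₂ = q₂ ⊗ 1 - 1 ⊗ q₂`. -/
def dq₂ (lam : ℝ) (ψ : Sch) : Sch :=
  (-Complex.I * ((lam ^ 2 : ℝ) : ℂ)) • ∂_{((1, 0) : ℝ × ℝ)} ψ
    - (-Complex.I * ((lam ^ 2 : ℝ) : ℂ)) • ∂_{((0, 1) : ℝ × ℝ)} ψ

/-- `(dq₁)² + (dq₂)²`, whose square root is the length operator. -/
def lengthSq (lam : ℝ) (ψ : Sch) : Sch := dq₁ (dq₁ ψ) + dq₂ lam (dq₂ lam ψ)

/-- `da = (dq₁ + i dq₂) / √2`. -/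
def da (lam : ℝ) (ψ : Sch) : Sch :=
  ((1 / Real.sqrt 2 : ℝ) : ℂ) • (dq₁ ψ + Complex.I • dq₂ lam ψ)

/-- `da* = (dq₁ - i dq₂) / √2`. -/
def daStar (lam : ℝ) (ψ : Sch) : Sch :=
  ((1 / Real.sqrt 2 : ℝ) : ℂ) • (dq₁ ψ - Complex.I • dq₂ lam ψ)

/-! ### The Moyal product -/

/-- The Moyal product
`(f ⋆ g)(x) = (πθ)⁻² ∫∫ f(x+u) g(x+v) exp(-(2i/θ) u·Θ₀⁻¹v) du dv`, with `θ = λ²` and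
`u·Θ₀⁻¹v = u₂v₁ - u₁v₂`. Integrating over `v` first, the formula makes sense for `g` Schwartz and
every `f` of temperate growth. -/
def moyal (lam : ℝ) (f g : ℝ × ℝ → ℂ) (x : ℝ × ℝ) : ℂ :=
  ((1 / (Real.pi * lam ^ 2) ^ 2 : ℝ) : ℂ) *
    ∫ u : ℝ × ℝ, f (x + u) * ∫ v : ℝ × ℝ, g (x + v) *
      Complex.exp (-(2 * Complex.I / ((lam ^ 2 : ℝ) : ℂ)) * ((u.2 * v.1 - u.1 * v.2 : ℝ) : ℂ))

/-- The left regular action `𝓛(f)ψ = f ⋆ ψ` on the Schwartz core. -/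
def leftMul (lam : ℝ) (f : ℝ × ℝ → ℂ) (ψ : Sch) : Sch := toSch (moyal lam f ψ)

/-- `𝓛(f)` as an operator in `L²(ℝ²)` with domain the Schwartz functions. -/
def leftOp (lam : ℝ) (f : ℝ × ℝ → ℂ) (ψ : Sch) : L2 := emb (leftMul lam f ψ)

/-- Functions of temperate growth in the Moyal multiplier algebra: `f ⋆ ψ` and `ψ ⋆ f` are
Schwartz for every Schwartz `ψ`. Since `ψ ⋆ f` is the conjugate of `conj f ⋆ conj ψ`, the second
condition is stated for `conj f`. -/
structure IsMultiplier (lam : ℝ) (f : ℝ × ℝ → ℂ) : Prop where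
  temperate : f.HasTemperateGrowth
  left : ∀ ψ : Sch, ∃ g : Sch, (g : ℝ × ℝ → ℂ) = moyal lam f ψ
  right : ∀ ψ : Sch, ∃ g : Sch, (g : ℝ × ℝ → ℂ) = moyal lam (fun x => conj (f x)) ψ

/-- `h = f ⋆ g` in the multiplier algebra, whose product is the composition of the
left multiplications. -/
structure IsProd (lam : ℝ) (f g h : ℝ × ℝ → ℂ) : Prop where
  left : IsMultiplier lam f
  right : IsMultiplier lam g
  prod : IsMultiplier lam h
  eq : ∀ ψ : Sch, leftMul lam h ψ = leftMul lam f (leftMul lam g ψ)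

/-- The complex coordinate `z = (x₁ + i x₂) / √2`. -/
def z (x : ℝ × ℝ) : ℂ := ((x.1 : ℂ) + Complex.I * (x.2 : ℂ)) / ((Real.sqrt 2 : ℝ) : ℂ)

/-- The complex conjugate coordinate. -/
def zbar (x : ℝ × ℝ) : ℂ := conj (z x)

/-- `∂_z f = (∂₁ f - i ∂₂ f) / √2`. -/
def dz (f : ℝ × ℝ → ℂ) (x : ℝ × ℝ) : ℂ :=
  (fderiv ℝ f x (1, 0) - Complex.I * fderiv ℝ f x (0, 1)) / ((Real.sqrt 2 : ℝ) : ℂ)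

/-- The equation `(∂_z l ⋆ z) ⋆ (∂_z l ⋆ z)* = ½ z* ⋆ z` in the multiplier algebra. -/
def IsSolution (lam : ℝ) (l : ℝ × ℝ → ℂ) : Prop :=
  ∃ P R : ℝ × ℝ → ℂ,
    IsProd lam (dz l) z P ∧
    IsProd lam P (fun x => conj (P x)) R ∧
    IsProd lam (fun x => (1 / 2 : ℂ) * zbar x) z R

/-! ### The spectral triple of the Moyal plane -/

/-- `∂ = (∂₁ - i ∂₂) / √2` on Schwartz functions. -/
def dS (ψ : Sch) : Sch :=
  ((1 / Real.sqrt 2 : ℝ) : ℂ) •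
    (∂_{((1, 0) : ℝ × ℝ)} ψ - Complex.I • ∂_{((0, 1) : ℝ × ℝ)} ψ)

/-- `∂̄ = (∂₁ + i ∂₂) / √2` on Schwartz functions. -/
def dbarS (ψ : Sch) : Sch :=
  ((1 / Real.sqrt 2 : ℝ) : ℂ) •
    (∂_{((1, 0) : ℝ × ℝ)} ψ + Complex.I • ∂_{((0, 1) : ℝ × ℝ)} ψ)

/-- The Dirac operator `D = -i√2 ((0, ∂̄), (∂, 0))` of the plane, on Schwartz spinors. -/
def dirac (ψ : Sch × Sch) : Sch × Sch :=
  ((-Complex.I * ((Real.sqrt 2 : ℝ) : ℂ)) • dbarS ψ.2,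
   (-Complex.I * ((Real.sqrt 2 : ℝ) : ℂ)) • dS ψ.1)

/-- The matrix element `⟨φ, [D, T] ψ⟩ = ⟨D φ, T ψ⟩ - ⟨φ, T D ψ⟩` between Schwartz spinors, where
`T`, an operator in `L²(ℝ²)` defined on Schwartz functions, acts diagonally on spinors. -/
def commForm (T : Sch → L2) (φ ψ : Sch × Sch) : ℂ :=
  (⟪emb (dirac φ).1, T ψ.1⟫_ℂ + ⟪emb (dirac φ).2, T ψ.2⟫_ℂ)
    - (⟪emb φ.1, T (dirac ψ).1⟫_ℂ + ⟪emb φ.2, T (dirac ψ).2⟫_ℂ)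

/-- The operator norm `‖[D, T]‖ ∈ [0, ∞]` on `L²(ℝ²) ⊗ ℂ²`. -/
def commNorm (T : Sch → L2) : ℝ≥0∞ :=
  ⨆ (φ : Sch × Sch) (ψ : Sch × Sch)
    (_ : ‖emb φ.1‖ ^ 2 + ‖emb φ.2‖ ^ 2 ≤ 1) (_ : ‖emb ψ.1‖ ^ 2 + ‖emb ψ.2‖ ^ 2 ≤ 1),
    ‖commForm T φ ψ‖ₑ

/-- The spectral distance between two linear forms on the Moyal algebra of Schwartz functions. -/
def spectralDist (lam : ℝ) (ω₁ ω₂ : Sch → ℂ) : ℝ≥0∞ :=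
  ⨆ (a : Sch) (_ : commNorm (leftOp lam a) ≤ 1), ‖ω₁ a - ω₂ a‖ₑ

/-! ### Eigenstates of the harmonic oscillator -/

/-- The normalized eigenfunction `|m⟩` of the Hamiltonian `½ (q² + p²)`, `p = -iθ d/dx`, `θ = λ²`:
`(m! λ √π)^(-1/2) Heₘ(√2 x / λ) exp(-x² / (2θ))`, with the Hermite polynomial `Heₘ` orthogonal
for the weight `exp(-t²/2)`. -/
def eigenfun (lam : ℝ) (m : ℕ) (x : ℝ) : ℂ :=
  (((Polynomial.aeval (Real.sqrt 2 * x / lam) (Polynomial.hermite m) : ℝ) *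
    Real.exp (-x ^ 2 / (2 * lam ^ 2)) /
      Real.sqrt ((m.factorial : ℝ) * lam * Real.sqrt Real.pi) : ℝ) : ℂ)

/-- `f̂`, normalized by `f(x) = ∫ f̂(k) exp((i/θ) k·x) dk`. -/
def fhat (lam : ℝ) (f : ℝ × ℝ → ℂ) (k : ℝ × ℝ) : ℂ :=
  ((1 / (2 * Real.pi * lam ^ 2) ^ 2 : ℝ) : ℂ) *
    ∫ x : ℝ × ℝ, f x * Complex.exp
      (-(Complex.I / ((lam ^ 2 : ℝ) : ℂ)) * ((k.1 * x.1 + k.2 * x.2 : ℝ) : ℂ))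

/-- The Schrödinger representation `π_S(f)ψ = ∫ f̂(k) exp((i/θ)(q k₁ + p k₂)) ψ dk`, where
`exp((i/θ)(q k₁ + p k₂)) ψ (x) = exp((i/θ) k₁ (x + k₂/2)) ψ(x + k₂)`. -/
def schrodinger (lam : ℝ) (f : ℝ × ℝ → ℂ) (ψ : ℝ → ℂ) (x : ℝ) : ℂ :=
  ∫ k : ℝ × ℝ, fhat lam f k *
    (Complex.exp ((Complex.I / ((lam ^ 2 : ℝ) : ℂ)) * ((k.1 * (x + k.2 / 2) : ℝ) : ℂ)) *
      ψ (x + k.2))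

/-- The eigenstate `ω_m(f) = ⟨m| π_S(f) |m⟩` on the Moyal algebra. -/
def omega (lam : ℝ) (m : ℕ) (f : Sch) : ℂ :=
  ∫ x : ℝ, conj (eigenfun lam m x) * schrodinger lam f (eigenfun lam m) x

/-- The Wigner transition function
`h_{m0} = (2/(πθ))^(1/2) 2^m (θ^m m!)^(-1/2) z̄^m exp(-2 z z̄ / θ)`. Under the unitary
`W h_{mn} = |m⟩ ⊗ |n⟩`, which turns `𝓛(f)` into `π_S(f) ⊗ 1`, it corresponds to `|m⟩ ⊗ |0⟩`. -/
def wigner (lam : ℝ) (m : ℕ) : Sch := toSch fun x =>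
  ((Real.sqrt (2 / (Real.pi * lam ^ 2)) * 2 ^ m /
      Real.sqrt ((lam ^ 2) ^ m * (m.factorial : ℝ)) : ℝ) : ℂ) *
    zbar x ^ m * ((Real.exp (-(x.1 ^ 2 + x.2 ^ 2) / lam ^ 2) : ℝ) : ℂ)

/-- The value `ω_m(T) = ⟨h_{m0}, T h_{m0}⟩` of the eigenstate `ω_m` on a possibly unbounded operator
`T` in `L²(ℝ²)` defined on Schwartz functions; for `T = 𝓛(f)` it is `⟨m| π_S(f) |m⟩`. -/
def omegaOp (lam : ℝ) (m : ℕ) (T : Sch → L2) : ℂ := ⟪emb (wigner lam m), T (wigner lam m)⟫_ℂ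

/-! ### Optimal elements -/

/-- `T`, not necessarily in the algebra, realizes the spectral distance between `ω_m` and `ω_n`:
`|ω_m(T) - ω_n(T)| = d_D(ω_m, ω_n)` and `‖[D, T]‖ = 1`. -/
structure IsOptimal (lam : ℝ) (T : Sch → L2) (m n : ℕ) : Prop where
  value : ‖omegaOp lam m T - omegaOp lam n T‖ₑ = spectralDist lam (omega lam m) (omega lam n)
  norm_eq : commNorm T = 1

/-- `T` is regularized by an optimal sequence for the pair `ω_m`, `ω_n`: there are elements `aₖ` of
the Moyal algebra in the unit ball of `‖[D, ·]‖`, tending to `T` strongly on Schwartz functions,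
such that `|ω_m(aₖ) - ω_n(aₖ)|` tends to `d_D(ω_m, ω_n)`. -/
def HasRegularization (lam : ℝ) (T : Sch → L2) (m n : ℕ) : Prop :=
  ∃ a : ℕ → Sch,
    (∀ k, commNorm (leftOp lam (a k)) ≤ 1) ∧
    (∀ ψ : Sch, Tendsto (fun k => leftOp lam (a k) ψ) atTop (𝓝 (T ψ))) ∧
    Tendsto (fun k => ‖omega lam m (a k) - omega lam n (a k)‖ₑ) atTop
      (𝓝 (spectralDist lam (omega lam m) (omega lam n)))

end Moyal

end

/-!
Throughout `θ = λ²`.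

*Ladder operators and square roots.* The multiplications by `z / λ` and `z̄ / λ` for the Moyal
product, from the left and from the right, are two commuting pairs of annihilation and creation
operators on the Schwartz space. With a Gaussian vacuum they generate joint eigenvectors `h m n` of
the two number operators; these are the Wigner transition functions, and they form a Hilbert basis
because their span contains all polynomials times the Gaussian (`Ladder`, `Ladder.basis`). The
relative and the total coordinate of the tensor square of the Schrödinger representation have the
same structure. A symmetric operator on Schwartz functions that is diagonal in such a basis has
exactly one positive square root of its closure, the diagonal operator of the square roots of the
eigenvalues (`isPosSqrt_iff`). This settles the existence and uniqueness of the operators `lᵢ`, and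
`L² = lᵢ(da)²` is a computation with `[da, da*] = 2θ` (`existsUnique_length`).

*The distance.* `[D, 𝓛(f)]` is, up to `-i√2`, the left multiplication by the derivatives of `f`
(`commForm_leftOp`), and `[z̄, f] = -θ ∂f`. Therefore the difference of the expectation values of `f`
in consecutive states `h_{m0}` is `λ / √(m + 1)` times a matrix element of `𝓛(∂f)`, hence at most
`λ / √(2 (m + 1))` if `‖[D, 𝓛(f)]‖ ≤ 1` (`inner_h_sub`, `norm_inner_h_sub_le`). Conversely, if `𝓛(f)`
is diagonal with increments of the eigenvalues bounded in this way, `𝓛(∂f)` is a weighted shift of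
norm at most `1/√2`, and `‖[D, 𝓛(f)]‖ ≤ 1` (`IsDiag.commNorm_le_one`). Diagonal Schwartz elements
are obtained from the matrix units `h m m`: reflecting the extremal eigenvalues at a large index and
truncating them at `0` keeps the increments bounded and leaves finitely many of them
(`exists_optSeq`), so that the bound is attained (`spectralDist_omega`). That
`ω_m(f) = ⟨h_{m0}, f ⋆ h_{m0}⟩` follows by induction on `m`, raising both states, from the Gaussian
integral for `m = 0` (`omega_eq`).

*The optimal element.* What is needed is a multiplier whose left multiplication is diagonal with
increments exactly `λ / √(2 (m + 1))`. The symbol `(1 + s) exp(-s |x|² / θ)` has the eigenvalues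
`((1 - s) / (1 + s))ᵐ` (`leftMul_gsym_h`), which are `exp(-m t)` for `s = tanh (t/2)`, and
`k^(-1/2) = π^(-1/2) ∫ t^(-1/2) exp(-k t) dt`. Hence a superposition of Gaussian symbols over `t` has
the required eigenvalues (`optSym`, `isDiag_optSym`, `optVal_succ_sub`). All of its derivatives grow
at most quadratically (`isSymbol_mixSym`), and such functions are multipliers
(`IsSymbol.isMultiplier`). The Schwartz elements with reflected and truncated eigenvalues form an
optimal sequence for it (`hasRegularization_optSym`).

*The equation.* If a multiplier `l` is optimal between all eigenstates, the matrix elements of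
`𝓛(∂l)` between `h_{m0}` and `h_{m+1,0}` have modulus `1/√2`, which is also a bound of its norm. So
`𝓛(∂l)` maps each `h_{mn}` to a multiple of `h_{m+1,n}` of modulus `1/√2` (`dz_h_of_saturated`), and
both sides of the equation multiply `h_{mn}` by `θ m / 2` (`isSolution_of_shift`).

*The operators `lᵢ(a)`.* Their values in the eigenstates are `√(2θ (m + c))` with `c = 1/2, 0, 1`.
The increments differ from `λ / √(2 (m + 1))`, with a sign that does not depend on `m`; so the
differences of the values are never the distances (`lRatio_step`, `enorm_sqrt_sub_ne`), which rules
out optimality. Strong convergence on Schwartz functions preserves the values in the eigenstates,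
so it rules out regularization by an optimal sequence as well (`HasRegularization.enorm_sub_eq`).
-/

noncomputable section

namespace Moyal

open MeasureTheory Filter Topology
open scoped ENNReal ComplexConjugate LineDeriv InnerProductSpace ContDiff


/-! ### Multiplications and derivatives on the Schwartz space of the plane -/

lemma hasTemperateGrowth_ofReal_fst :
    (fun x : ℝ × ℝ => (x.1 : ℂ)).HasTemperateGrowth :=
  (Complex.ofRealCLM.comp (ContinuousLinearMap.fst ℝ ℝ ℝ)).hasTemperateGrowth

lemma hasTemperateGrowth_ofReal_snd :
    (fun x : ℝ × ℝ => (x.2 : ℂ)).HasTemperateGrowth :=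
  (Complex.ofRealCLM.comp (ContinuousLinearMap.snd ℝ ℝ ℝ)).hasTemperateGrowth

/-- Multiplication by the first coordinate. -/
def X1 : Sch →ₗ[ℂ] Sch :=
  (SchwartzMap.smulLeftCLM ℂ (fun x : ℝ × ℝ => (x.1 : ℂ))).toLinearMap

/-- Multiplication by the second coordinate. -/
def X2 : Sch →ₗ[ℂ] Sch :=
  (SchwartzMap.smulLeftCLM ℂ (fun x : ℝ × ℝ => (x.2 : ℂ))).toLinearMap

/-- The partial derivative in the first coordinate. -/
def D1 : Sch →ₗ[ℂ] Sch :=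
  (LineDeriv.lineDerivOpCLM ℂ Sch ((1, 0) : ℝ × ℝ)).toLinearMap

/-- The partial derivative in the second coordinate. -/
def D2 : Sch →ₗ[ℂ] Sch :=
  (LineDeriv.lineDerivOpCLM ℂ Sch ((0, 1) : ℝ × ℝ)).toLinearMap

lemma X1_apply (ψ : Sch) (x : ℝ × ℝ) : X1 ψ x = (x.1 : ℂ) * ψ x := by
  simp [X1, SchwartzMap.smulLeftCLM_apply_apply hasTemperateGrowth_ofReal_fst]

lemma X2_apply (ψ : Sch) (x : ℝ × ℝ) : X2 ψ x = (x.2 : ℂ) * ψ x := by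
  simp [X2, SchwartzMap.smulLeftCLM_apply_apply hasTemperateGrowth_ofReal_snd]

lemma D1_apply (ψ : Sch) (x : ℝ × ℝ) : D1 ψ x = fderiv ℝ ψ x (1, 0) := rfl

lemma D2_apply (ψ : Sch) (x : ℝ × ℝ) : D2 ψ x = fderiv ℝ ψ x (0, 1) := rfl

/-- The real-linear form `v ↦ v.1 a + v.2 b` on the plane, with complex coefficients. -/
def pd (a b : ℂ) : ℝ × ℝ →L[ℝ] ℂ :=
  (ContinuousLinearMap.fst ℝ ℝ ℝ).smulRight a + (ContinuousLinearMap.snd ℝ ℝ ℝ).smulRight b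

@[simp] lemma pd_apply (a b : ℂ) (v : ℝ × ℝ) : pd a b v = v.1 * a + v.2 * b := by
  simp [pd]

lemma pd_ext {L : ℝ × ℝ →L[ℝ] ℂ} {a b : ℂ} (h1 : L (1, 0) = a) (h2 : L (0, 1) = b) :
    L = pd a b := by
  ext <;> simp [h1, h2]

lemma fderiv_eq_pd (f : ℝ × ℝ → ℂ) (x : ℝ × ℝ) :
    fderiv ℝ f x = pd (fderiv ℝ f x (1, 0)) (fderiv ℝ f x (0, 1)) :=
  pd_ext rfl rfl

lemma norm_pd_le (a b : ℂ) : ‖pd a b‖ ≤ ‖a‖ + ‖b‖ := by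
  refine ContinuousLinearMap.opNorm_le_bound _ (by positivity) fun v => ?_
  rw [pd_apply, add_mul]
  refine (norm_add_le _ _).trans (add_le_add ?_ ?_)
  · rw [norm_mul, Complex.norm_real, mul_comm]
    exact mul_le_mul_of_nonneg_left (norm_fst_le v) (norm_nonneg _)
  · rw [norm_mul, Complex.norm_real, mul_comm]
    exact mul_le_mul_of_nonneg_left (norm_snd_le v) (norm_nonneg _)

lemma hasFDerivAt_sch (ψ : Sch) (x : ℝ × ℝ) : HasFDerivAt ψ (pd (D1 ψ x) (D2 ψ x)) x := by
  have h := ψ.hasFDerivAt x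
  rwa [fderiv_eq_pd] at h

lemma D1_eq_of_hasFDerivAt {ψ : Sch} {x : ℝ × ℝ} {a b : ℂ} (h : HasFDerivAt ψ (pd a b) x) :
    D1 ψ x = a := by
  rw [D1_apply, h.fderiv]; simp

lemma D2_eq_of_hasFDerivAt {ψ : Sch} {x : ℝ × ℝ} {a b : ℂ} (h : HasFDerivAt ψ (pd a b) x) :
    D2 ψ x = b := by
  rw [D2_apply, h.fderiv]; simp

lemma pd_add (a b c d : ℂ) : pd a b + pd c d = pd (a + c) (b + d) := by
  ext <;> simp

lemma smul_pd (c a b : ℂ) : c • pd a b = pd (c * a) (c * b) := by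
  ext <;> simp

lemma _root_.HasFDerivAt.pd_congr {f : ℝ × ℝ → ℂ} {x : ℝ × ℝ} {a b a' b' : ℂ}
    (h : HasFDerivAt f (pd a b) x) (ha : a = a') (hb : b = b') : HasFDerivAt f (pd a' b') x := by
  subst ha hb; exact h

lemma _root_.HasFDerivAt.pd_mul {f g : ℝ × ℝ → ℂ} {x : ℝ × ℝ} {a b c d : ℂ}
    (hf : HasFDerivAt f (pd a b) x) (hg : HasFDerivAt g (pd c d) x) :
    HasFDerivAt (fun y => f y * g y) (pd (a * g x + f x * c) (b * g x + f x * d)) x := by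
  refine (hf.mul hg).congr_fderiv ?_
  rw [smul_pd, smul_pd, pd_add]; congr 1 <;> ring

lemma _root_.HasFDerivAt.pd_add {f g : ℝ × ℝ → ℂ} {x : ℝ × ℝ} {a b c d : ℂ}
    (hf : HasFDerivAt f (pd a b) x) (hg : HasFDerivAt g (pd c d) x) :
    HasFDerivAt (fun y => f y + g y) (pd (a + c) (b + d)) x :=
  (hf.add hg).congr_fderiv (Moyal.pd_add _ _ _ _)

lemma _root_.HasFDerivAt.pd_const_mul {f : ℝ × ℝ → ℂ} {x : ℝ × ℝ} {a b : ℂ} (c : ℂ)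
    (hf : HasFDerivAt f (pd a b) x) :
    HasFDerivAt (fun y => c * f y) (pd (c * a) (c * b)) x :=
  (hf.const_mul c).congr_fderiv (smul_pd _ _ _)

lemma hasFDerivAt_pd_const (c : ℂ) (x : ℝ × ℝ) :
    HasFDerivAt (fun _ : ℝ × ℝ => c) (pd 0 0) x :=
  (hasFDerivAt_const c x).congr_fderiv (by ext <;> simp)

lemma _root_.HasFDerivAt.pd_conj {f : ℝ × ℝ → ℂ} {x : ℝ × ℝ} {a b : ℂ}
    (h : HasFDerivAt f (pd a b) x) :
    HasFDerivAt (fun y => conj (f y)) (pd (conj a) (conj b)) x := by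
  refine (Complex.conjCLE.toContinuousLinearMap.hasFDerivAt.comp x h).congr_fderiv ?_
  ext <;> simp

lemma hasFDerivAt_ofReal_fst (x : ℝ × ℝ) :
    HasFDerivAt (fun x : ℝ × ℝ => (x.1 : ℂ)) (pd 1 0) x := by
  refine (Complex.ofRealCLM.comp (ContinuousLinearMap.fst ℝ ℝ ℝ)).hasFDerivAt.congr_fderiv ?_
  ext <;> simp

lemma hasFDerivAt_ofReal_snd (x : ℝ × ℝ) :
    HasFDerivAt (fun x : ℝ × ℝ => (x.2 : ℂ)) (pd 0 1) x := by
  refine (Complex.ofRealCLM.comp (ContinuousLinearMap.snd ℝ ℝ ℝ)).hasFDerivAt.congr_fderiv ?_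
  ext <;> simp

lemma hasFDerivAt_X1 (ψ : Sch) (x : ℝ × ℝ) :
    HasFDerivAt (X1 ψ) (pd (ψ x + x.1 * D1 ψ x) (x.1 * D2 ψ x)) x := by
  rw [show (X1 ψ : ℝ × ℝ → ℂ) = fun y => (y.1 : ℂ) * ψ y from funext (X1_apply ψ)]
  exact ((hasFDerivAt_ofReal_fst x).pd_mul (hasFDerivAt_sch ψ x)).pd_congr (by ring) (by ring)

lemma hasFDerivAt_X2 (ψ : Sch) (x : ℝ × ℝ) :
    HasFDerivAt (X2 ψ) (pd (x.2 * D1 ψ x) (ψ x + x.2 * D2 ψ x)) x := by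
  rw [show (X2 ψ : ℝ × ℝ → ℂ) = fun y => (y.2 : ℂ) * ψ y from funext (X2_apply ψ)]
  exact ((hasFDerivAt_ofReal_snd x).pd_mul (hasFDerivAt_sch ψ x)).pd_congr (by ring) (by ring)

lemma X1_X2 (ψ : Sch) : X1 (X2 ψ) = X2 (X1 ψ) := by
  ext x; simp only [X1_apply, X2_apply]; ring

lemma D1_X1 (ψ : Sch) : D1 (X1 ψ) = X1 (D1 ψ) + ψ := by
  ext x
  rw [D1_eq_of_hasFDerivAt (hasFDerivAt_X1 ψ x), add_apply, X1_apply]; ring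

lemma D2_X1 (ψ : Sch) : D2 (X1 ψ) = X1 (D2 ψ) := by
  ext x
  rw [D2_eq_of_hasFDerivAt (hasFDerivAt_X1 ψ x), X1_apply]

lemma D1_X2 (ψ : Sch) : D1 (X2 ψ) = X2 (D1 ψ) := by
  ext x
  rw [D1_eq_of_hasFDerivAt (hasFDerivAt_X2 ψ x), X2_apply]

lemma D2_X2 (ψ : Sch) : D2 (X2 ψ) = X2 (D2 ψ) + ψ := by
  ext x
  rw [D2_eq_of_hasFDerivAt (hasFDerivAt_X2 ψ x), add_apply, X2_apply]; ring

lemma D2_D1 (ψ : Sch) : D2 (D1 ψ) = D1 (D2 ψ) := by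
  ext x
  have hs : IsSymmSndFDerivAt ℝ (ψ : ℝ × ℝ → ℂ) x :=
    ((ψ.smooth 2).contDiffAt).isSymmSndFDerivAt (by simp)
  have hd : DifferentiableAt ℝ (fderiv ℝ ψ) x :=
    ((ψ.smooth 2).fderiv_right (m := 1) (by norm_num)).differentiable (by simp) x
  have h1 : ∀ v : ℝ × ℝ, fderiv ℝ (fun y => fderiv ℝ ψ y v) x = (fderiv ℝ (fderiv ℝ ψ) x).flip v := by
    intro v
    rw [fderiv_clm_apply hd (by fun_prop)]
    ext <;> simp
  have e1 : (D1 ψ : ℝ × ℝ → ℂ) = fun y => fderiv ℝ ψ y (1, 0) := rfl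
  have e2 : (D2 ψ : ℝ × ℝ → ℂ) = fun y => fderiv ℝ ψ y (0, 1) := rfl
  rw [D2_apply, D1_apply, e1, e2, h1, h1]
  exact hs.eq _ _

/-- The first-order operator `a x₁ + b x₂ + c ∂₁ + d ∂₂`. -/
def lin (a b c d : ℂ) : Sch →ₗ[ℂ] Sch := a • X1 + b • X2 + c • D1 + d • D2

lemma lin_apply (a b c d : ℂ) (ψ : Sch) :
    lin a b c d ψ = a • X1 ψ + b • X2 ψ + c • D1 ψ + d • D2 ψ := rfl

lemma lin_comm (a b c d a' b' c' d' : ℂ) (ψ : Sch) :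
    lin a b c d (lin a' b' c' d' ψ) =
      lin a' b' c' d' (lin a b c d ψ) + (c * a' - a * c' + d * b' - b * d') • ψ := by
  simp only [lin_apply, map_add, map_smul, X1_X2, D1_X1, D1_X2, D2_X1, D2_X2, D2_D1]
  module

/-! ### The inner product of Schwartz functions -/

lemma emb_add (φ ψ : Sch) : emb (φ + ψ) = emb φ + emb ψ :=
  map_add (SchwartzMap.toLpCLM ℂ ℂ 2 (volume : Measure (ℝ × ℝ))) φ ψ

lemma emb_sub (φ ψ : Sch) : emb (φ - ψ) = emb φ - emb ψ :=
  map_sub (SchwartzMap.toLpCLM ℂ ℂ 2 (volume : Measure (ℝ × ℝ))) φ ψ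

lemma emb_smul (c : ℂ) (ψ : Sch) : emb (c • ψ) = c • emb ψ :=
  map_smul (SchwartzMap.toLpCLM ℂ ℂ 2 (volume : Measure (ℝ × ℝ))) c ψ

lemma emb_zero : emb 0 = 0 :=
  map_zero (SchwartzMap.toLpCLM ℂ ℂ 2 (volume : Measure (ℝ × ℝ)))

lemma emb_injective : Function.Injective emb :=
  SchwartzMap.injective_toLp 2 volume

lemma inner_emb (φ ψ : Sch) : ⟪emb φ, emb ψ⟫_ℂ = ∫ x, conj (φ x) * ψ x := by
  refine (SchwartzMap.inner_toL2_toL2_eq φ ψ volume).trans ?_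
  refine integral_congr_ae (Eventually.of_forall fun x => ?_)
  simp [RCLike.inner_apply, mul_comm]

/-- The complex conjugate of a Schwartz function. -/
def conjS (ψ : Sch) : Sch :=
  SchwartzMap.postcompCLM (𝕜 := ℝ) Complex.conjCLE.toContinuousLinearMap ψ

@[simp] lemma conjS_apply (ψ : Sch) (x : ℝ × ℝ) : conjS ψ x = conj (ψ x) := by
  simp [conjS]

lemma hasFDerivAt_conjS (ψ : Sch) (x : ℝ × ℝ) :
    HasFDerivAt (conjS ψ) (pd (conj (D1 ψ x)) (conj (D2 ψ x))) x := by
  rw [show (conjS ψ : ℝ × ℝ → ℂ) = fun y => conj (ψ y) from funext (conjS_apply ψ)]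
  exact (hasFDerivAt_sch ψ x).pd_conj

lemma D1_conjS (ψ : Sch) : D1 (conjS ψ) = conjS (D1 ψ) := by
  ext x
  rw [conjS_apply, D1_eq_of_hasFDerivAt (hasFDerivAt_conjS ψ x)]

lemma D2_conjS (ψ : Sch) : D2 (conjS ψ) = conjS (D2 ψ) := by
  ext x
  rw [conjS_apply, D2_eq_of_hasFDerivAt (hasFDerivAt_conjS ψ x)]

lemma inner_X1 (φ ψ : Sch) : ⟪emb (X1 φ), emb ψ⟫_ℂ = ⟪emb φ, emb (X1 ψ)⟫_ℂ := by
  simp only [inner_emb, X1_apply, map_mul, Complex.conj_ofReal]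
  congr 1; ext x; ring

lemma inner_X2 (φ ψ : Sch) : ⟪emb (X2 φ), emb ψ⟫_ℂ = ⟪emb φ, emb (X2 ψ)⟫_ℂ := by
  simp only [inner_emb, X2_apply, map_mul, Complex.conj_ofReal]
  congr 1; ext x; ring

lemma inner_D1 (φ ψ : Sch) : ⟪emb (D1 φ), emb ψ⟫_ℂ = -⟪emb φ, emb (D1 ψ)⟫_ℂ := by
  have h : ∫ x, conjS φ x * D1 ψ x = -∫ x, D1 (conjS φ) x * ψ x :=
    SchwartzMap.integral_mul_lineDerivOp_right_eq_neg_left (μ := volume)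
      (conjS φ) ψ ((1, 0) : ℝ × ℝ)
  simp only [D1_conjS, conjS_apply] at h
  rw [inner_emb, inner_emb, h, neg_neg]

lemma inner_D2 (φ ψ : Sch) : ⟪emb (D2 φ), emb ψ⟫_ℂ = -⟪emb φ, emb (D2 ψ)⟫_ℂ := by
  have h : ∫ x, conjS φ x * D2 ψ x = -∫ x, D2 (conjS φ) x * ψ x :=
    SchwartzMap.integral_mul_lineDerivOp_right_eq_neg_left (μ := volume)
      (conjS φ) ψ ((0, 1) : ℝ × ℝ)
  simp only [D2_conjS, conjS_apply] at h
  rw [inner_emb, inner_emb, h, neg_neg]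

lemma inner_lin (a b c d : ℂ) (φ ψ : Sch) :
    ⟪emb (lin a b c d φ), emb ψ⟫_ℂ =
      ⟪emb φ, emb (lin (conj a) (conj b) (-conj c) (-conj d) ψ)⟫_ℂ := by
  simp only [lin_apply, emb_add, emb_smul, inner_add_left, inner_add_right, inner_smul_left,
    inner_smul_right, inner_X1, inner_X2, inner_D1, inner_D2]
  ring

/-! ### Families of functions closed under partial derivatives -/

/-- If the weight `v` controls all the functions of a family that is closed under partial
derivatives, it also controls all their iterated derivatives. -/
theorem exists_bound_iteratedFDeriv_of_family {V : Set (ℝ × ℝ → ℂ)} {v : ℝ × ℝ → ℝ}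
    (hv : ∀ x, 0 ≤ v x)
    (hd : ∀ F ∈ V, ∃ F₁ ∈ V, ∃ F₂ ∈ V, ∀ x, HasFDerivAt F (pd (F₁ x) (F₂ x)) x)
    (hb : ∀ F ∈ V, ∃ C, ∀ x, v x * ‖F x‖ ≤ C) (n : ℕ) :
    ∀ F ∈ V, ContDiff ℝ n F ∧ ∃ C, ∀ x, v x * ‖iteratedFDeriv ℝ n F x‖ ≤ C := by
  induction n with
  | zero =>
    intro F hF
    obtain ⟨F₁, -, F₂, -, h⟩ := hd F hF
    obtain ⟨C, hC⟩ := hb F hF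
    refine ⟨?_, C, fun x => by simpa using hC x⟩
    have : Differentiable ℝ F := fun x => (h x).differentiableAt
    simpa using this.continuous
  | succ n ih =>
    intro F hF
    obtain ⟨F₁, h₁, F₂, h₂, h⟩ := hd F hF
    obtain ⟨c₁, C₁, hC₁⟩ := ih F₁ h₁
    obtain ⟨c₂, C₂, hC₂⟩ := ih F₂ h₂
    -- the two summands of the derivative, as continuous linear images of the partial derivatives
    let J₁ : ℂ →L[ℝ] (ℝ × ℝ →L[ℝ] ℂ) :=
      ContinuousLinearMap.smulRightL ℝ (ℝ × ℝ) ℂ (ContinuousLinearMap.fst ℝ ℝ ℝ)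
    let J₂ : ℂ →L[ℝ] (ℝ × ℝ →L[ℝ] ℂ) :=
      ContinuousLinearMap.smulRightL ℝ (ℝ × ℝ) ℂ (ContinuousLinearMap.snd ℝ ℝ ℝ)
    have hF' : fderiv ℝ F = (fun x => J₁ (F₁ x)) + fun x => J₂ (F₂ x) := by
      ext1 x; exact (h x).fderiv
    have k₁ : ContDiff ℝ n fun x => J₁ (F₁ x) := J₁.contDiff.comp c₁
    have k₂ : ContDiff ℝ n fun x => J₂ (F₂ x) := J₂.contDiff.comp c₂
    refine ⟨?_, ‖J₁‖ * C₁ + ‖J₂‖ * C₂, fun x => ?_⟩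
    · rw [show ((n + 1 : ℕ) : WithTop ℕ∞) = (n : WithTop ℕ∞) + 1 by norm_cast]
      refine contDiff_succ_iff_fderiv.2 ⟨fun x => (h x).differentiableAt, by simp, ?_⟩
      rw [hF']; exact k₁.add k₂
    · rw [← norm_iteratedFDeriv_fderiv, hF', iteratedFDeriv_add_apply k₁.contDiffAt k₂.contDiffAt]
      have e₁ := J₁.norm_iteratedFDeriv_comp_left (x := x) c₁.contDiffAt (n := n) le_rfl
      have e₂ := J₂.norm_iteratedFDeriv_comp_left (x := x) c₂.contDiffAt (n := n) le_rfl
      calc v x * _ ≤ v x * (‖J₁‖ * ‖iteratedFDeriv ℝ n F₁ x‖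
            + ‖J₂‖ * ‖iteratedFDeriv ℝ n F₂ x‖) := by
            refine mul_le_mul_of_nonneg_left ?_ (hv x)
            exact (norm_add_le _ _).trans (add_le_add e₁ e₂)
        _ = ‖J₁‖ * (v x * ‖iteratedFDeriv ℝ n F₁ x‖)
            + ‖J₂‖ * (v x * ‖iteratedFDeriv ℝ n F₂ x‖) := by ring
        _ ≤ _ := by gcongr; exacts [hC₁ x, hC₂ x]

/-- The linear span of a family, whose members have their partial derivatives in that span, is
closed under partial derivatives. -/
lemma exists_hasFDerivAt_of_mem_span {S : Set (ℝ × ℝ → ℂ)}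
    (hd : ∀ F ∈ S, ∃ F₁ ∈ Submodule.span ℂ S, ∃ F₂ ∈ Submodule.span ℂ S,
      ∀ x, HasFDerivAt F (pd (F₁ x) (F₂ x)) x) :
    ∀ F ∈ Submodule.span ℂ S, ∃ F₁ ∈ Submodule.span ℂ S, ∃ F₂ ∈ Submodule.span ℂ S,
      ∀ x, HasFDerivAt F (pd (F₁ x) (F₂ x)) x := by
  intro F hF
  induction hF using Submodule.span_induction with
  | mem F hF => exact hd F hF
  | zero =>
    refine ⟨0, zero_mem _, 0, zero_mem _, fun x => ?_⟩
    exact hasFDerivAt_pd_const 0 x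
  | add F G _ _ hF hG =>
    obtain ⟨F₁, h₁, F₂, h₂, h⟩ := hF
    obtain ⟨G₁, k₁, G₂, k₂, k⟩ := hG
    refine ⟨F₁ + G₁, add_mem h₁ k₁, F₂ + G₂, add_mem h₂ k₂, fun x => ?_⟩
    have := (h x).add (k x)
    rwa [pd_add] at this
  | smul c F _ hF =>
    obtain ⟨F₁, h₁, F₂, h₂, h⟩ := hF
    refine ⟨c • F₁, Submodule.smul_mem _ _ h₁, c • F₂, Submodule.smul_mem _ _ h₂, fun x => ?_⟩
    have := (h x).const_mul c
    rwa [smul_pd] at this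

lemma exists_bound_of_mem_span {S : Set (ℝ × ℝ → ℂ)} {v : ℝ × ℝ → ℝ} (hv : ∀ x, 0 ≤ v x)
    (hb : ∀ F ∈ S, ∃ C, ∀ x, v x * ‖F x‖ ≤ C) :
    ∀ F ∈ Submodule.span ℂ S, ∃ C, ∀ x, v x * ‖F x‖ ≤ C := by
  intro F hF
  induction hF using Submodule.span_induction with
  | mem F hF => exact hb F hF
  | zero => exact ⟨0, fun x => by simp⟩
  | add F G _ _ hF hG =>
    obtain ⟨C, hC⟩ := hF
    obtain ⟨C', hC'⟩ := hG
    refine ⟨C + C', fun x => ?_⟩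
    calc v x * ‖F x + G x‖ ≤ v x * (‖F x‖ + ‖G x‖) :=
          mul_le_mul_of_nonneg_left (norm_add_le _ _) (hv x)
      _ = v x * ‖F x‖ + v x * ‖G x‖ := by ring
      _ ≤ _ := add_le_add (hC x) (hC' x)
  | smul c F _ hF =>
    obtain ⟨C, hC⟩ := hF
    refine ⟨‖c‖ * C, fun x => ?_⟩
    calc v x * ‖c • F x‖ = ‖c‖ * (v x * ‖F x‖) := by rw [norm_smul]; ring
      _ ≤ _ := mul_le_mul_of_nonneg_left (hC x) (norm_nonneg _)

/-- A smooth function all of whose derivatives are bounded by multiples of the same power of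
`1 + ‖x‖`. -/
def IsSymbol (N : ℕ) (f : ℝ × ℝ → ℂ) : Prop :=
  ContDiff ℝ ∞ f ∧ ∀ n : ℕ, ∃ C : ℝ, ∀ x, ‖iteratedFDeriv ℝ n f x‖ ≤ C * (1 + ‖x‖) ^ N

lemma IsSymbol.hasTemperateGrowth {N : ℕ} {f : ℝ × ℝ → ℂ} (h : IsSymbol N f) :
    f.HasTemperateGrowth :=
  ⟨h.1, fun n => ⟨N, h.2 n⟩⟩

/-- A family of functions of uniformly polynomial growth whose span is closed under partial
derivatives consists of symbols. -/
theorem isSymbol_of_mem_span {S : Set (ℝ × ℝ → ℂ)} {N : ℕ}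
    (hd : ∀ F ∈ S, ∃ F₁ ∈ Submodule.span ℂ S, ∃ F₂ ∈ Submodule.span ℂ S,
      ∀ x, HasFDerivAt F (pd (F₁ x) (F₂ x)) x)
    (hb : ∀ F ∈ S, ∃ C, ∀ x, ‖F x‖ ≤ C * (1 + ‖x‖) ^ N) {F : ℝ × ℝ → ℂ}
    (hF : F ∈ Submodule.span ℂ S) : IsSymbol N F := by
  have hv : ∀ x : ℝ × ℝ, 0 ≤ ((1 + ‖x‖) ^ N)⁻¹ := fun x => by positivity
  have hb' := exists_bound_of_mem_span (S := S) hv fun F hF => by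
    obtain ⟨C, hC⟩ := hb F hF
    refine ⟨C, fun x => ?_⟩
    rw [inv_mul_le_iff₀ (by positivity), mul_comm]
    exact hC x
  have key := fun n => exists_bound_iteratedFDeriv_of_family hv
    (exists_hasFDerivAt_of_mem_span hd) hb' n F hF
  refine ⟨contDiff_infty.2 fun n => (key n).1, fun n => ?_⟩
  obtain ⟨C, hC⟩ := (key n).2
  refine ⟨C, fun x => ?_⟩
  have := hC x
  rwa [inv_mul_le_iff₀ (by positivity), mul_comm] at this

/-- A family of functions of uniformly polynomial growth whose span is closed under partial
derivatives and under multiplication by the coordinates consists of Schwartz functions: the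
multiplications by the coordinates trade growth for decay. -/
theorem exists_sch_of_mem_span {S : Set (ℝ × ℝ → ℂ)} {N : ℕ}
    (hd : ∀ F ∈ S, ∃ F₁ ∈ Submodule.span ℂ S, ∃ F₂ ∈ Submodule.span ℂ S,
      ∀ x, HasFDerivAt F (pd (F₁ x) (F₂ x)) x)
    (hx₁ : ∀ F ∈ S, (fun x : ℝ × ℝ => (x.1 : ℂ) * F x) ∈ Submodule.span ℂ S)
    (hx₂ : ∀ F ∈ S, (fun x : ℝ × ℝ => (x.2 : ℂ) * F x) ∈ Submodule.span ℂ S)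
    (hb : ∀ F ∈ S, ∃ C, ∀ x, ‖F x‖ ≤ C * (1 + ‖x‖) ^ N) {F : ℝ × ℝ → ℂ}
    (hF : F ∈ Submodule.span ℂ S) : ∃ g : Sch, (g : ℝ × ℝ → ℂ) = F := by
  -- the span is closed under multiplication by powers of the coordinates
  have mulmem : ∀ p : ℝ × ℝ → ℂ, (∀ F ∈ S, (fun x => p x * F x) ∈ Submodule.span ℂ S) →
      ∀ k : ℕ, ∀ F ∈ Submodule.span ℂ S, (fun x => p x ^ k * F x) ∈ Submodule.span ℂ S := by
    intro p hp k
    have h1 : ∀ F ∈ Submodule.span ℂ S, (fun x => p x * F x) ∈ Submodule.span ℂ S := by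
      intro F hF
      induction hF using Submodule.span_induction with
      | mem F hF => exact hp F hF
      | zero =>
        rw [show (fun x => p x * (0 : ℝ × ℝ → ℂ) x) = 0 by ext x; simp]
        exact zero_mem _
      | add F G _ _ hF hG =>
        rw [show (fun x => p x * (F + G) x) = (fun x => p x * F x) + fun x => p x * G x by
          ext x; simp [mul_add]]
        exact add_mem hF hG
      | smul c F _ hF =>
        rw [show (fun x => p x * (c • F) x) = c • fun x => p x * F x by
          ext x; simp only [Pi.smul_apply, smul_eq_mul]; ring]
        exact Submodule.smul_mem _ c hF
    induction k with
    | zero => intro F hF; simpa using hF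
    | succ k ih =>
      intro F hF
      rw [show (fun x => p x ^ (k + 1) * F x) = fun x => p x * (p x ^ k * F x) by
        ext x; ring]
      exact h1 _ (ih F hF)
  have hv : ∀ x : ℝ × ℝ, 0 ≤ ((1 + ‖x‖) ^ N)⁻¹ := fun x => by positivity
  have hb' := exists_bound_of_mem_span (S := S) hv fun F hF => by
    obtain ⟨C, hC⟩ := hb F hF
    refine ⟨C, fun x => ?_⟩
    rw [inv_mul_le_iff₀ (by positivity), mul_comm]
    exact hC x
  have decay : ∀ k : ℕ, ∀ F ∈ (Submodule.span ℂ S : Set (ℝ × ℝ → ℂ)),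
      ∃ C, ∀ x : ℝ × ℝ, ‖x‖ ^ k * ‖F x‖ ≤ C := by
    intro k F hF
    obtain ⟨C₀, h₀⟩ := hb' F hF
    obtain ⟨C₁, h₁⟩ := hb' _ (mulmem _ hx₁ (k + N) F hF)
    obtain ⟨C₂, h₂⟩ := hb' _ (mulmem _ hx₂ (k + N) F hF)
    have p₀ : 0 ≤ C₀ := le_trans (by positivity) (h₀ 0)
    have p₁ : 0 ≤ C₁ := le_trans (by positivity) (h₁ 0)
    have p₂ : 0 ≤ C₂ := le_trans (by positivity) (h₂ 0)
    refine ⟨(C₀ + C₁ + C₂) * 2 ^ N, fun x => ?_⟩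
    rcases le_total ‖x‖ 1 with hx | hx
    · have e := h₀ x
      rw [inv_mul_le_iff₀ (by positivity)] at e
      calc ‖x‖ ^ k * ‖F x‖ ≤ 1 * ‖F x‖ := by
            gcongr; exact pow_le_one₀ (norm_nonneg _) hx
        _ ≤ (1 + ‖x‖) ^ N * C₀ := by simpa using e
        _ ≤ 2 ^ N * C₀ := by gcongr; linarith
        _ ≤ _ := by
          rw [mul_comm]
          gcongr
          linarith
    · have e : ‖x‖ ^ (k + N) * ‖F x‖ ≤ (1 + ‖x‖) ^ N * (C₁ + C₂) := by
        have e₁ := h₁ x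
        have e₂ := h₂ x
        rw [inv_mul_le_iff₀ (by positivity), norm_mul, norm_pow, Complex.norm_real] at e₁ e₂
        rcases max_choice ‖x.1‖ ‖x.2‖ with h | h
        · rw [Prod.norm_def, h, mul_add]
          rw [Prod.norm_def, h] at e₁
          have : 0 ≤ (1 + ‖x.1‖) ^ N * C₂ := by positivity
          linarith
        · rw [Prod.norm_def, h, mul_add]
          rw [Prod.norm_def, h] at e₂
          have : 0 ≤ (1 + ‖x.2‖) ^ N * C₁ := by positivity
          linarith
      have hxN : (1 + ‖x‖) ^ N ≤ 2 ^ N * ‖x‖ ^ N := by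
        rw [← mul_pow]; gcongr; linarith
      have hpos : 0 < ‖x‖ ^ N := by positivity
      have : ‖x‖ ^ N * (‖x‖ ^ k * ‖F x‖) ≤ ‖x‖ ^ N * ((C₁ + C₂) * 2 ^ N) := by
        calc ‖x‖ ^ N * (‖x‖ ^ k * ‖F x‖) = ‖x‖ ^ (k + N) * ‖F x‖ := by ring
          _ ≤ (1 + ‖x‖) ^ N * (C₁ + C₂) := e
          _ ≤ 2 ^ N * ‖x‖ ^ N * (C₁ + C₂) := by gcongr
          _ = _ := by ring
      refine (le_of_mul_le_mul_left this hpos).trans ?_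
      gcongr
      linarith
  have key := fun k n => exists_bound_iteratedFDeriv_of_family
    (v := fun x : ℝ × ℝ => ‖x‖ ^ k) (fun x => by positivity)
    (exists_hasFDerivAt_of_mem_span hd) (decay k) n F hF
  exact ⟨⟨F, contDiff_infty.2 fun n => (key 0 n).1, fun k n => (key k n).2⟩, rfl⟩

lemma toSch_coe (g : Sch) : toSch (g : ℝ × ℝ → ℂ) = g := by
  have h : ∃ g' : Sch, (g' : ℝ × ℝ → ℂ) = g := ⟨g, rfl⟩
  rw [toSch, dif_pos h]
  exact DFunLike.coe_injective h.choose_spec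

lemma coe_toSch {F : ℝ × ℝ → ℂ} (h : ∃ g : Sch, (g : ℝ × ℝ → ℂ) = F) :
    (toSch F : ℝ × ℝ → ℂ) = F := by
  obtain ⟨g, rfl⟩ := h
  rw [toSch_coe]

/-! ### Gaussians -/

lemma exists_abs_pow_le_exp_sq {b : ℝ} (hb : 0 < b) (k : ℕ) :
    ∃ C : ℝ, ∀ t : ℝ, |t| ^ k * Real.exp (-b * t ^ 2) ≤ C := by
  refine ⟨1 + k.factorial / b ^ k, fun t => ?_⟩
  have h1 : |t| ^ k ≤ 1 + (t ^ 2) ^ k := by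
    have : (t ^ 2) ^ k = (|t| ^ k) ^ 2 := by rw [← sq_abs, ← pow_mul, ← pow_mul, mul_comm]
    rw [this]
    nlinarith [sq_nonneg (|t| ^ k - 1), sq_nonneg (|t| ^ k)]
  have h2 : (t ^ 2) ^ k * b ^ k / k.factorial ≤ Real.exp (b * t ^ 2) := by
    have := Real.pow_div_factorial_le_exp (b * t ^ 2) (by positivity) k
    rwa [mul_pow, mul_comm (b ^ k)] at this
  have h3 : Real.exp (-b * t ^ 2) ≤ 1 := Real.exp_le_one_iff.2 (by nlinarith [sq_nonneg t])
  have h4 : Real.exp (b * t ^ 2) * Real.exp (-b * t ^ 2) = 1 := by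
    rw [← Real.exp_add]; simp
  have h5 : (t ^ 2) ^ k ≤ k.factorial / b ^ k * Real.exp (b * t ^ 2) := by
    rw [div_le_iff₀ (by positivity)] at h2
    rw [div_mul_eq_mul_div, le_div_iff₀ (by positivity)]
    linarith
  calc |t| ^ k * Real.exp (-b * t ^ 2)
      ≤ (1 + k.factorial / b ^ k * Real.exp (b * t ^ 2)) * Real.exp (-b * t ^ 2) := by
        gcongr; linarith
    _ = Real.exp (-b * t ^ 2) + k.factorial / b ^ k *
          (Real.exp (b * t ^ 2) * Real.exp (-b * t ^ 2)) := by ring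
    _ ≤ _ := by rw [h4]; linarith

lemma hasFDerivAt_gauss (b : ℝ) (x : ℝ × ℝ) :
    HasFDerivAt (fun x : ℝ × ℝ => ((Real.exp (-b * (x.1 ^ 2 + x.2 ^ 2)) : ℝ) : ℂ))
      (pd (-2 * b * x.1 * (Real.exp (-b * (x.1 ^ 2 + x.2 ^ 2)) : ℝ))
        (-2 * b * x.2 * (Real.exp (-b * (x.1 ^ 2 + x.2 ^ 2)) : ℝ))) x := by
  have h1 : HasFDerivAt (fun x : ℝ × ℝ => -b * (x.1 ^ 2 + x.2 ^ 2))
      ((-2 * b * x.1) • ContinuousLinearMap.fst ℝ ℝ ℝ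
        + (-2 * b * x.2) • ContinuousLinearMap.snd ℝ ℝ ℝ) x := by
    have := ((hasFDerivAt_fst (𝕜 := ℝ) (p := x)).pow 2).add
      ((hasFDerivAt_snd (𝕜 := ℝ) (p := x)).pow 2)
    refine (this.const_mul (-b)).congr_fderiv ?_
    ext <;> simp <;> ring
  refine (Complex.ofRealCLM.hasFDerivAt.comp x h1.exp).congr_fderiv ?_
  ext <;> simp <;> ring

/-- Gaussians are Schwartz functions. -/
lemma exists_sch_gauss {b : ℝ} (hb : 0 < b) :
    ∃ g : Sch, (g : ℝ × ℝ → ℂ) =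
      fun x => ((Real.exp (-b * (x.1 ^ 2 + x.2 ^ 2)) : ℝ) : ℂ) := by
  set G : ℝ × ℝ → ℂ := fun x => ((Real.exp (-b * (x.1 ^ 2 + x.2 ^ 2)) : ℝ) : ℂ) with hG
  let M : ℕ × ℕ → ℝ × ℝ → ℂ := fun p x => (x.1 : ℂ) ^ p.1 * (x.2 : ℂ) ^ p.2 * G x
  have hM : ∀ p, M p ∈ Submodule.span ℂ (Set.range M) :=
    fun p => Submodule.subset_span ⟨p, rfl⟩
  refine exists_sch_of_mem_span (S := Set.range M) (N := 0) ?_ ?_ ?_ ?_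
    (F := G) (by simpa [M] using hM (0, 0))
  · rintro _ ⟨⟨i, j⟩, rfl⟩
    refine ⟨(i : ℂ) • M (i - 1, j) + (-2 * b : ℂ) • M (i + 1, j),
      add_mem (Submodule.smul_mem _ _ (hM _)) (Submodule.smul_mem _ _ (hM _)),
      (j : ℂ) • M (i, j - 1) + (-2 * b : ℂ) • M (i, j + 1),
      add_mem (Submodule.smul_mem _ _ (hM _)) (Submodule.smul_mem _ _ (hM _)), fun x => ?_⟩
    have p1 : HasFDerivAt (fun x : ℝ × ℝ => (x.1 : ℂ) ^ i) (pd (i * x.1 ^ (i - 1)) 0) x := by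
      refine ((hasFDerivAt_ofReal_fst x).pow i).congr_fderiv ?_
      ext <;> simp
    have p2 : HasFDerivAt (fun x : ℝ × ℝ => (x.2 : ℂ) ^ j) (pd 0 (j * x.2 ^ (j - 1))) x := by
      refine ((hasFDerivAt_ofReal_snd x).pow j).congr_fderiv ?_
      ext <;> simp
    refine ((p1.pd_mul p2).pd_mul (hasFDerivAt_gauss b x)).pd_congr ?_ ?_ <;>
    · simp only [M, hG, Pi.add_apply, Pi.smul_apply, smul_eq_mul]; ring
  · rintro _ ⟨⟨i, j⟩, rfl⟩
    convert hM (i + 1, j) using 1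
    ext x; simp only [M]; ring
  · rintro _ ⟨⟨i, j⟩, rfl⟩
    convert hM (i, j + 1) using 1
    ext x; simp only [M]; ring
  · rintro _ ⟨⟨i, j⟩, rfl⟩
    obtain ⟨C, hC⟩ := exists_abs_pow_le_exp_sq hb i
    obtain ⟨C', hC'⟩ := exists_abs_pow_le_exp_sq hb j
    refine ⟨C * C', fun x => ?_⟩
    have e : ‖M (i, j) x‖ = (|x.1| ^ i * Real.exp (-b * x.1 ^ 2)) *
        (|x.2| ^ j * Real.exp (-b * x.2 ^ 2)) := by
      have : Real.exp (-b * (x.1 ^ 2 + x.2 ^ 2)) =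
          Real.exp (-b * x.1 ^ 2) * Real.exp (-b * x.2 ^ 2) := by
        rw [← Real.exp_add]; ring_nf
      simp only [M, hG, norm_mul, norm_pow, Complex.norm_real, Real.norm_eq_abs, this,
        Real.abs_exp]
      ring
    rw [e, pow_zero, mul_one]
    exact mul_le_mul (hC _) (hC' _) (by positivity) (le_trans (by positivity) (hC x.1))

/-- The Gaussian `exp (-b |x|²)` as a Schwartz function, for `b > 0`. -/
def gaussS (b : ℝ) : Sch := toSch fun x => ((Real.exp (-b * (x.1 ^ 2 + x.2 ^ 2)) : ℝ) : ℂ)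

lemma gaussS_apply {b : ℝ} (hb : 0 < b) (x : ℝ × ℝ) :
    gaussS b x = ((Real.exp (-b * (x.1 ^ 2 + x.2 ^ 2)) : ℝ) : ℂ) :=
  congrFun (coe_toSch (exists_sch_gauss hb)) x

lemma D1_gaussS {b : ℝ} (hb : 0 < b) : D1 (gaussS b) = (-2 * b : ℂ) • X1 (gaussS b) := by
  ext x
  have h : HasFDerivAt (gaussS b) _ x :=
    (coe_toSch (exists_sch_gauss hb)).symm ▸ hasFDerivAt_gauss b x
  rw [D1_eq_of_hasFDerivAt h, smul_apply, X1_apply, gaussS_apply hb, smul_eq_mul]; ring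

lemma D2_gaussS {b : ℝ} (hb : 0 < b) : D2 (gaussS b) = (-2 * b : ℂ) • X2 (gaussS b) := by
  ext x
  have h : HasFDerivAt (gaussS b) _ x :=
    (coe_toSch (exists_sch_gauss hb)).symm ▸ hasFDerivAt_gauss b x
  rw [D2_eq_of_hasFDerivAt h, smul_apply, X2_apply, gaussS_apply hb, smul_eq_mul]; ring

lemma integral_gauss_plane (b : ℝ) :
    ∫ x : ℝ × ℝ, Real.exp (-b * (x.1 ^ 2 + x.2 ^ 2)) = Real.sqrt (Real.pi / b) ^ 2 := by
  have : (fun x : ℝ × ℝ => Real.exp (-b * (x.1 ^ 2 + x.2 ^ 2))) =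
      fun x => Real.exp (-b * x.1 ^ 2) * Real.exp (-b * x.2 ^ 2) := by
    ext x; rw [← Real.exp_add]; ring_nf
  rw [this, Measure.volume_eq_prod,
    integral_prod_mul (fun t : ℝ => Real.exp (-b * t ^ 2)) (fun t : ℝ => Real.exp (-b * t ^ 2)),
    integral_gaussian]
  ring

lemma norm_sq_emb_gaussS {b : ℝ} (hb : 0 < b) : ‖emb (gaussS b)‖ ^ 2 = Real.pi / (2 * b) := by
  have h : ⟪emb (gaussS b), emb (gaussS b)⟫_ℂ = ((‖emb (gaussS b)‖ ^ 2 : ℝ) : ℂ) := by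
    rw [inner_self_eq_norm_sq_to_K]; simp
  rw [inner_emb] at h
  have e : ∀ x, conj (gaussS b x) * gaussS b x =
      ((Real.exp (-(2 * b) * (x.1 ^ 2 + x.2 ^ 2)) : ℝ) : ℂ) := by
    intro x
    rw [gaussS_apply hb, Complex.conj_ofReal, ← Complex.ofReal_mul, ← Real.exp_add]; ring_nf
  simp only [e] at h
  rw [integral_complex_ofReal, integral_gauss_plane, Real.sq_sqrt (by positivity)] at h
  exact_mod_cast h.symm

/-! ### Completeness: polynomials times a Gaussian -/

/-- An integrable real function on the plane with vanishing Fourier transform vanishes. -/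
lemma ae_eq_zero_of_fourier_real {h : ℝ × ℝ → ℝ} (hi : Integrable h)
    (hF : ∀ L : StrongDual ℝ (ℝ × ℝ), ∫ v, Complex.exp (L v * Complex.I) * h v = 0) :
    h =ᵐ[volume] 0 := by
  -- the positive and negative parts of `h` are densities of measures with equal Fourier transforms
  have hp : Integrable fun x => max (h x) 0 := hi.pos_part
  have hn : Integrable fun x => max (-h x) 0 := hi.neg_part
  have mp : AEMeasurable (fun x => Real.toNNReal (h x)) volume :=
    hi.aestronglyMeasurable.aemeasurable.real_toNNReal
  have mn : AEMeasurable (fun x => Real.toNNReal (-h x)) volume :=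
    hi.aestronglyMeasurable.aemeasurable.neg.real_toNNReal
  let μp : Measure (ℝ × ℝ) := volume.withDensity fun x => (Real.toNNReal (h x) : ℝ≥0∞)
  let μn : Measure (ℝ × ℝ) := volume.withDensity fun x => (Real.toNNReal (-h x) : ℝ≥0∞)
  have fp : IsFiniteMeasure μp := isFiniteMeasure_withDensity_ofReal hi.2
  have fn : IsFiniteMeasure μn := isFiniteMeasure_withDensity_ofReal hi.neg.2
  have key : μp = μn := by
    refine Measure.ext_of_charFunDual ?_
    ext L
    rw [charFunDual_apply, charFunDual_apply, integral_withDensity_eq_integral_smul₀ mp,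
      integral_withDensity_eq_integral_smul₀ mn, ← sub_eq_zero, ← integral_sub]
    · rw [← hF L]
      congr 1; ext v
      have e : (h v : ℂ) = ((Real.toNNReal (h v) : ℝ) : ℂ) - ((Real.toNNReal (-h v) : ℝ) : ℂ) := by
        rw [Real.coe_toNNReal', Real.coe_toNNReal', ← Complex.ofReal_sub]
        congr 1
        rcases le_total (h v) 0 with hv | hv <;> simp [hv]
      rw [e, NNReal.smul_def, NNReal.smul_def, Complex.real_smul, Complex.real_smul]
      ring
    all_goals
      simp only [NNReal.smul_def, Complex.real_smul, Real.coe_toNNReal']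
      refine Integrable.mul_bdd (c := 1) (Integrable.ofReal ‹_›)
        (Continuous.aestronglyMeasurable (by fun_prop)) (Eventually.of_forall fun v => ?_)
      rw [Complex.norm_exp_ofReal_mul_I]
  have hae := (withDensity_eq_iff mp.coe_nnreal_ennreal mn.coe_nnreal_ennreal
    (by
      have := hi.2
      have h2 := isFiniteMeasure_withDensity_ofReal hi.2
      have h3 := measure_ne_top μp Set.univ
      rwa [withDensity_apply _ MeasurableSet.univ, Measure.restrict_univ] at h3)).1 key
  filter_upwards [hae] with x hx
  have hx' : Real.toNNReal (h x) = Real.toNNReal (-h x) := by exact_mod_cast hx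
  have := congrArg (fun r : NNReal => (r : ℝ)) hx'
  simp only [Real.coe_toNNReal'] at this
  rcases le_total (h x) 0 with hv | hv <;> simp [hv] at this <;> simpa using this

/-- An integrable function on the plane with vanishing Fourier transform vanishes. -/
lemma ae_eq_zero_of_fourier {w : ℝ × ℝ → ℂ} (hi : Integrable w)
    (hF : ∀ L : StrongDual ℝ (ℝ × ℝ), ∫ v, Complex.exp (L v * Complex.I) * w v = 0) :
    w =ᵐ[volume] 0 := by
  have hbd : ∀ (L : StrongDual ℝ (ℝ × ℝ)) {u : ℝ × ℝ → ℂ}, Integrable u →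
      Integrable fun v => Complex.exp (L v * Complex.I) * u v := by
    intro L u hu
    refine Integrable.bdd_mul (c := 1) hu (Continuous.aestronglyMeasurable (by fun_prop))
      (Eventually.of_forall fun v => ?_)
    rw [Complex.norm_exp_ofReal_mul_I]
  have hc : Integrable fun v => conj (w v) :=
    Complex.conjCLE.toContinuousLinearMap.integrable_comp hi
  have hF' : ∀ L : StrongDual ℝ (ℝ × ℝ), ∫ v, Complex.exp (L v * Complex.I) * conj (w v) = 0 := by
    intro L
    have := congrArg conj (hF (-L))
    rw [← integral_conj, map_zero] at this
    rw [← this]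
    congr 1; ext v
    rw [map_mul, ← Complex.exp_conj]
    simp
  have hre := ae_eq_zero_of_fourier_real hi.re fun L => by
    have : ∀ v, Complex.exp (L v * Complex.I) * ((RCLike.re (w v) : ℝ) : ℂ) =
        (1 / 2 : ℂ) * (Complex.exp (L v * Complex.I) * w v
          + Complex.exp (L v * Complex.I) * conj (w v)) := by
      intro v
      rw [show ((RCLike.re (w v) : ℝ) : ℂ) = (w v + conj (w v)) / 2 from
        Complex.re_eq_add_conj _]
      ring
    simp only [this]
    rw [integral_const_mul, integral_add (hbd L hi) (hbd L hc), hF, hF']; simp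
  have him := ae_eq_zero_of_fourier_real hi.im fun L => by
    have : ∀ v, Complex.exp (L v * Complex.I) * ((RCLike.im (w v) : ℝ) : ℂ) =
        (1 / (2 * Complex.I) : ℂ) * (Complex.exp (L v * Complex.I) * w v
          - Complex.exp (L v * Complex.I) * conj (w v)) := by
      intro v
      rw [show ((RCLike.im (w v) : ℝ) : ℂ) = (w v - conj (w v)) / (2 * Complex.I) from
        Complex.im_eq_sub_conj _]
      ring
    simp only [this]
    rw [integral_const_mul, integral_sub (hbd L hi) (hbd L hc), hF, hF']; simp
  filter_upwards [hre, him] with v h1 h2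
  exact Complex.ext h1 h2

/-- A linear form is dominated by half of the exponent of the Gaussian `exp (-b |x|²)`, up to a
constant. -/
lemma abs_linear_le {b : ℝ} (hb : 0 < b) (α β : ℝ) (x : ℝ × ℝ) :
    |α * x.1 + β * x.2| ≤ (α ^ 2 + β ^ 2) / (2 * b) + b / 2 * (x.1 ^ 2 + x.2 ^ 2) := by
  have key : ∀ s t : ℝ, |s * t| ≤ s ^ 2 / (2 * b) + b / 2 * t ^ 2 := by
    intro s t
    have : s ^ 2 / (2 * b) + b / 2 * t ^ 2 - |s| * |t| = (|s| - b * |t|) ^ 2 / (2 * b) := by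
      field_simp
      rw [← sq_abs s, ← sq_abs t]; ring
    have h2 : 0 ≤ (|s| - b * |t|) ^ 2 / (2 * b) := by positivity
    rw [abs_mul]; linarith
  calc _ ≤ |α * x.1| + |β * x.2| := abs_add_le _ _
    _ ≤ _ := add_le_add (key α x.1) (key β x.2)
    _ = _ := by ring

/-- Polynomials times a Gaussian are total in `L²`: if `g` is orthogonal to all of them, the
Fourier transform of `exp (-b |x|²) g`, an everywhere convergent power series whose coefficients
are moments, vanishes. -/
theorem eq_zero_of_moments {b : ℝ} (hb : 0 < b) (g : L2)
    (h : ∀ (α β : ℝ) (n : ℕ),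
      ∫ x : ℝ × ℝ, ((α * x.1 + β * x.2 : ℝ) : ℂ) ^ n * gaussS b x * g x = 0) : g = 0 := by
  have hgm : AEStronglyMeasurable g volume := Lp.aestronglyMeasurable g
  have hint : ∀ {c : ℝ}, 0 < c → Integrable fun x => gaussS c x * g x := fun {c} hc =>
    ((gaussS c).memLp 2 volume).integrable_mul (Lp.memLp g)
  have hw : (fun x => gaussS b x * g x) =ᵐ[volume] 0 := by
    refine ae_eq_zero_of_fourier (hint hb) fun L => ?_
    set α := L (1, 0) with hα
    set β := L (0, 1) with hβ
    have hL : ∀ v : ℝ × ℝ, L v = α * v.1 + β * v.2 := by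
      intro v
      have : v = v.1 • ((1, 0) : ℝ × ℝ) + v.2 • ((0, 1) : ℝ × ℝ) := by ext <;> simp
      conv_lhs => rw [this]
      rw [map_add, map_smul, map_smul, smul_eq_mul, smul_eq_mul]; ring
    let F : ℕ → ℝ × ℝ → ℂ := fun n v => (L v * Complex.I) ^ n / n.factorial * (gaussS b v * g v)
    -- the exponential series is dominated by `exp |L v|`, which half of the Gaussian absorbs
    have hs : HasSum (fun n => ∫ v, F n v)
        (∫ v, Complex.exp (L v * Complex.I) * (gaussS b v * g v)) := by
      refine hasSum_integral_of_dominated_convergence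
        (fun n v => |L v| ^ n / n.factorial * ‖gaussS b v * g v‖) (fun n => ?_) (fun n => ?_) ?_ ?_
        ?_
      · refine (Continuous.aestronglyMeasurable (by fun_prop)).mul
          ((gaussS b).continuous.aestronglyMeasurable.mul hgm)
      · refine Eventually.of_forall fun v => ?_
        simp only [F, norm_mul, norm_div, norm_pow, Complex.norm_real, Complex.norm_I, mul_one,
          Real.norm_eq_abs, Complex.norm_natCast]
        exact le_rfl
      · refine Eventually.of_forall fun v => ?_
        exact (Real.summable_pow_div_factorial _).mul_right _
      · have e : ∀ v, ∑' n : ℕ, |L v| ^ n / n.factorial * ‖gaussS b v * g v‖ =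
            Real.exp |L v| * ‖gaussS b v * g v‖ := by
          intro v
          rw [tsum_mul_right, Real.exp_eq_exp_ℝ, NormedSpace.exp_eq_tsum_div]
        simp only [e]
        refine (((hint (half_pos hb)).norm).const_mul
          (Real.exp ((α ^ 2 + β ^ 2) / (2 * b)))).mono' ?_ (Eventually.of_forall fun v => ?_)
        · exact (Continuous.aestronglyMeasurable (by fun_prop)).mul
            ((gaussS b).continuous.aestronglyMeasurable.mul hgm).norm
        · rw [norm_mul, Real.norm_eq_abs, Real.abs_exp, norm_norm, norm_mul, norm_mul, ← mul_assoc,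
            ← mul_assoc]
          refine mul_le_mul_of_nonneg_right ?_ (norm_nonneg _)
          rw [gaussS_apply hb, gaussS_apply (half_pos hb), Complex.norm_real, Complex.norm_real,
            Real.norm_eq_abs, Real.norm_eq_abs, Real.abs_exp, Real.abs_exp, ← Real.exp_add,
            ← Real.exp_add, Real.exp_le_exp]
          have := abs_linear_le hb α β v
          rw [← hL] at this
          linarith
      · refine Eventually.of_forall fun v => HasSum.mul_right _ ?_
        have := NormedSpace.expSeries_div_hasSum_exp (L v * Complex.I)
        rwa [← Complex.exp_eq_exp_ℂ] at this
    have hz : ∀ n, ∫ v, F n v = 0 := by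
      intro n
      have : ∀ v, F n v = (Complex.I ^ n / n.factorial) *
          (((α * v.1 + β * v.2 : ℝ) : ℂ) ^ n * gaussS b v * g v) := by
        intro v
        simp only [F, ← hL, mul_pow]; ring
      simp only [this]
      rw [integral_const_mul, h, mul_zero]
    simp only [hz] at hs
    exact (hs.unique hasSum_zero)
  refine Lp.eq_zero_iff_ae_eq_zero.2 ?_
  filter_upwards [hw] with x hx
  have : gaussS b x ≠ 0 := by
    rw [gaussS_apply hb]; exact_mod_cast (Real.exp_pos _).ne'
  simpa [this] using hx

/-! ### Positive square roots of operators with an eigenbasis of Schwartz functions -/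

section Diagonal

variable {ι : Type*} {E : Type*} [NormedAddCommGroup E] [InnerProductSpace ℂ E]

/-- The graph of the operator that multiplies the coordinates in a Hilbert basis by `μ`. -/
def diagGraph (b : HilbertBasis ι ℂ E) (μ : ι → ℝ) : Submodule ℂ (E × E) where
  carrier := {p | ∀ i, ⟪b i, p.2⟫_ℂ = μ i * ⟪b i, p.1⟫_ℂ}
  add_mem' {p q} hp hq i := by
    have h1 := hp i
    have h2 := hq i
    simp only [Prod.snd_add, Prod.fst_add, inner_add_right, h1, h2]; ring
  zero_mem' i := by simp
  smul_mem' c p hp i := by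
    have h1 := hp i
    simp only [Prod.smul_snd, Prod.smul_fst, inner_smul_right, h1]; ring

lemma hilbertBasis_ext (b : HilbertBasis ι ℂ E) {x y : E} (h : ∀ i, ⟪b i, x⟫_ℂ = ⟪b i, y⟫_ℂ) :
    x = y := by
  apply b.repr.injective
  ext i
  rw [b.repr_apply_apply, b.repr_apply_apply, h]

/-- The operator that multiplies the coordinates in a Hilbert basis by `μ`, on its maximal
domain. -/
def diagOp (b : HilbertBasis ι ℂ E) (μ : ι → ℝ) : E →ₗ.[ℂ] E := (diagGraph b μ).toLinearPMap

lemma mem_graph_diagOp (b : HilbertBasis ι ℂ E) (μ : ι → ℝ) (x y : E) :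
    (x, y) ∈ (diagOp b μ).graph ↔ ∀ i, ⟪b i, y⟫_ℂ = μ i * ⟪b i, x⟫_ℂ := by
  rw [diagOp, Submodule.toLinearPMap_graph_eq]
  · rfl
  · rintro ⟨x, y⟩ hp hx
    refine hilbertBasis_ext b fun i => ?_
    have := hp i
    simp only at hx this
    rw [this, hx]; simp

lemma inner_diagOp (b : HilbertBasis ι ℂ E) (μ : ι → ℝ) (x : (diagOp b μ).domain) (i : ι) :
    ⟪b i, diagOp b μ x⟫_ℂ = μ i * ⟪b i, (x : E)⟫_ℂ :=
  (mem_graph_diagOp b μ _ _).1 ((diagOp b μ).mem_graph x) i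

lemma inner_basis_basis (b : HilbertBasis ι ℂ E) [DecidableEq ι] (i j : ι) :
    ⟪b i, b j⟫_ℂ = if i = j then 1 else 0 :=
  orthonormal_iff_ite.1 b.orthonormal i j

lemma basis_mem_graph_diagOp (b : HilbertBasis ι ℂ E) (μ : ι → ℝ) (i : ι) :
    (b i, (μ i : ℂ) • b i) ∈ (diagOp b μ).graph := by
  classical
  refine (mem_graph_diagOp b μ _ _).2 fun j => ?_
  rw [inner_smul_right, inner_basis_basis]
  split_ifs with h
  · rw [h]
  · simp

lemma dense_domain_of_basis (b : HilbertBasis ι ℂ E) {A : E →ₗ.[ℂ] E}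
    (h : ∀ i, b i ∈ A.domain) : Dense (A.domain : Set E) := by
  have h1 : Submodule.span ℂ (Set.range b) ≤ A.domain := by
    rw [Submodule.span_le]; rintro _ ⟨i, rfl⟩; exact h i
  have h2 : Dense (Submodule.span ℂ (Set.range b) : Set E) :=
    Submodule.dense_iff_topologicalClosure_eq_top.2 b.dense_span
  exact h2.mono h1

/-- An operator that multiplies the coordinates of the vectors of its domain by `μ` is a restriction
of the diagonal operator with maximal domain. -/
lemma le_diagOp (b : HilbertBasis ι ℂ E) (μ : ι → ℝ) {A : E →ₗ.[ℂ] E}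
    (h : ∀ (x : A.domain) (i : ι), ⟪b i, A x⟫_ℂ = μ i * ⟪b i, (x : E)⟫_ℂ) : A ≤ diagOp b μ := by
  refine LinearPMap.le_of_le_graph ?_
  rintro ⟨x, y⟩ hxy
  obtain ⟨z, rfl, rfl⟩ := (LinearPMap.mem_graph_iff _).1 hxy
  exact (mem_graph_diagOp b μ _ _).2 fun i => h z i

lemma inner_diagOp_comm (b : HilbertBasis ι ℂ E) (μ : ι → ℝ) {x y u v : E}
    (hx : ∀ i, ⟪b i, u⟫_ℂ = μ i * ⟪b i, x⟫_ℂ) (hy : ∀ i, ⟪b i, v⟫_ℂ = μ i * ⟪b i, y⟫_ℂ) :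
    ⟪u, y⟫_ℂ = ⟪x, v⟫_ℂ := by
  refine (b.hasSum_inner_mul_inner u y).unique ?_
  convert! b.hasSum_inner_mul_inner x v using 2 with i
  rw [hy, ← inner_conj_symm u, hx, map_mul, Complex.conj_ofReal, inner_conj_symm]; ring

theorem isSelfAdjoint_diagOp [CompleteSpace E] (b : HilbertBasis ι ℂ E) (μ : ι → ℝ) :
    IsSelfAdjoint (diagOp b μ) := by
  have hd : Dense ((diagOp b μ).domain : Set E) :=
    dense_domain_of_basis b fun i => LinearPMap.mem_domain_of_mem_graph (basis_mem_graph_diagOp b μ i)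
  refine le_antisymm ?_ ?_
  · refine le_diagOp b μ fun y i => ?_
    obtain ⟨e, he, he'⟩ := (LinearPMap.mem_graph_iff _).1 (basis_mem_graph_diagOp b μ i)
    have := LinearPMap.adjoint_isFormalAdjoint hd y e
    simp only at he he'
    rw [he, he', inner_smul_right] at this
    have h2 := congrArg conj this
    rw [inner_conj_symm, map_mul, inner_conj_symm, Complex.conj_ofReal] at h2
    exact h2
  · refine LinearPMap.IsFormalAdjoint.le_adjoint hd fun x y => ?_
    exact inner_diagOp_comm b μ (inner_diagOp b μ x) (inner_diagOp b μ y)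

lemma exists_of_summable (b : HilbertBasis ι ℂ E) {c : ι → ℂ} (hc : Summable fun i => ‖c i‖ ^ 2) :
    ∃ y : E, ∀ i, ⟪b i, y⟫_ℂ = c i := by
  have hm : Memℓp c 2 := by
    refine memℓp_gen ?_
    simpa using hc
  refine ⟨b.repr.symm ⟨c, hm⟩, fun i => ?_⟩
  rw [← b.repr_apply_apply, LinearIsometryEquiv.apply_symm_apply]

lemma hasSum_norm_inner_sq (b : HilbertBasis ι ℂ E) (x : E) :
    HasSum (fun i => ‖⟪b i, x⟫_ℂ‖ ^ 2) (‖x‖ ^ 2) := by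
  have h := b.hasSum_inner_mul_inner x x
  have e : ∀ i, ⟪x, b i⟫_ℂ * ⟪b i, x⟫_ℂ = ((‖⟪b i, x⟫_ℂ‖ ^ 2 : ℝ) : ℂ) := by
    intro i
    rw [← inner_conj_symm x, Complex.conj_mul']; norm_cast
  simp only [e, inner_self_eq_norm_sq_to_K] at h
  have h' : HasSum (fun i => ((‖⟪b i, x⟫_ℂ‖ ^ 2 : ℝ) : ℂ)) ((‖x‖ ^ 2 : ℝ) : ℂ) := by
    rw [Complex.ofReal_pow]; exact h
  exact Complex.hasSum_ofReal.1 h'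

/-- The square of a diagonal operator, on its natural domain, is the diagonal operator of the
squares: the domain condition on the intermediate vector holds because `μ² ≤ 1 + μ⁴`. -/
lemma exists_mem_graph_diagOp_sq (b : HilbertBasis ι ℂ E) (μ : ι → ℝ) (x y : E) :
    (∃ w, (x, w) ∈ (diagOp b μ).graph ∧ (w, y) ∈ (diagOp b μ).graph) ↔
      ∀ i, ⟪b i, y⟫_ℂ = ((μ i ^ 2 : ℝ) : ℂ) * ⟪b i, x⟫_ℂ := by
  simp only [mem_graph_diagOp]
  constructor
  · rintro ⟨w, h1, h2⟩ i
    rw [h2, h1]; push_cast; ring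
  · intro h
    obtain ⟨w, hw⟩ := exists_of_summable b (c := fun i => μ i * ⟪b i, x⟫_ℂ) (by
      refine Summable.of_nonneg_of_le (fun i => by positivity) (fun i => ?_)
        ((hasSum_norm_inner_sq b x).summable.add (hasSum_norm_inner_sq b y).summable)
      rw [h, norm_mul, norm_mul, Complex.norm_real, Complex.norm_real, mul_pow, mul_pow]
      have h0 : ‖μ i‖ ^ 2 ≤ 1 + ‖μ i ^ 2‖ ^ 2 := by
        rw [norm_pow]; nlinarith [sq_nonneg (‖μ i‖ ^ 2 - 1), sq_nonneg (‖μ i‖ ^ 2)]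
      nlinarith [sq_nonneg ‖⟪b i, x⟫_ℂ‖])
    refine ⟨w, hw, fun i => ?_⟩
    rw [h, hw]; push_cast; ring

end Diagonal

/-- An operator on Schwartz functions that is diagonal in a Hilbert basis of Schwartz functions
with eigenvalues `μ²`, `μ ≥ 0`, has exactly one positive square root, the diagonal operator with
eigenvalues `μ`. Indeed, if `A` is a positive square root, `e` a basis vector and `w = A e`, then
`v = w - μ e` satisfies `A v = - μ v`, which forces `v = 0`. -/
theorem isPosSqrt_iff {ι : Type*} (b : HilbertBasis ι ℂ L2) (e : ι → Sch)
    (hb : ∀ i, b i = emb (e i)) (P : Sch →ₗ[ℂ] Sch) (μ : ι → ℝ) (hμ : ∀ i, 0 ≤ μ i)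
    (hP : ∀ i, P (e i) = ((μ i ^ 2 : ℝ) : ℂ) • e i)
    (hsymm : ∀ φ ψ, ⟪emb (P φ), emb ψ⟫_ℂ = ⟪emb φ, emb (P ψ)⟫_ℂ) (A : L2 →ₗ.[ℂ] L2) :
    IsPosSqrt P A ↔ A = diagOp b μ := by
  classical
  -- the closure of `P` is the diagonal operator with eigenvalues `μ ^ 2`
  have hcl : ∀ x y : L2, (x, y) ∈ closure (Set.range fun ψ : Sch => (emb ψ, emb (P ψ))) ↔
      ∀ i, ⟪b i, y⟫_ℂ = ((μ i ^ 2 : ℝ) : ℂ) * ⟪b i, x⟫_ℂ := by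
    intro x y
    constructor
    · intro h i
      have hclosed : IsClosed {p : L2 × L2 | ⟪b i, p.2⟫_ℂ = ((μ i ^ 2 : ℝ) : ℂ) * ⟪b i, p.1⟫_ℂ} :=
        isClosed_eq (by fun_prop) (by fun_prop)
      refine closure_minimal ?_ hclosed h
      rintro _ ⟨ψ, rfl⟩
      simp only [Set.mem_ofPred_eq]
      rw [hb, ← hsymm, hP, emb_smul, inner_smul_left, Complex.conj_ofReal]
    · intro h
      have hx := b.hasSum_repr x
      have hy := b.hasSum_repr y
      have hxy := hx.prodMk hy
      refine mem_closure_of_tendsto hxy (Eventually.of_forall fun s => ?_)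
      refine ⟨∑ i ∈ s, b.repr x i • e i, ?_⟩
      have hsum : ∀ f : ι → Sch, emb (∑ i ∈ s, f i) = ∑ i ∈ s, emb (f i) := fun f =>
        map_sum (SchwartzMap.toLpCLM ℂ ℂ 2 (volume : Measure (ℝ × ℝ))) f s
      refine Prod.ext ?_ ?_
      · simp only [Prod.fst_sum, hsum, emb_smul, hb]
      · simp only [Prod.snd_sum, map_sum, map_smul, hP, hsum, emb_smul, hb]
        refine Finset.sum_congr rfl fun i _ => ?_
        rw [b.repr_apply_apply, b.repr_apply_apply, h, smul_smul, hb, mul_comm]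
  constructor
  · intro hA
    have hdense := hA.selfAdjoint.dense_domain
    have hsym : ∀ x y : A.domain, ⟪A x, (y : L2)⟫_ℂ = ⟪(x : L2), A y⟫_ℂ := by
      have := LinearPMap.adjoint_isFormalAdjoint hdense
      rw [LinearPMap.isSelfAdjoint_def.1 hA.selfAdjoint] at this
      exact this
    -- eigenvectors of `A ^ 2` are eigenvectors of `A`
    have heig : ∀ i, ∃ x : A.domain, (x : L2) = b i ∧ A x = (μ i : ℂ) • b i := by
      intro i
      obtain ⟨w, h1, h2⟩ := (hA.sq_eq (b i) (((μ i ^ 2 : ℝ) : ℂ) • b i)).2 ((hcl _ _).2 fun j => by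
        rw [inner_smul_right, inner_basis_basis]
        split_ifs with h
        · rw [h]
        · simp)
      obtain ⟨x, hx1, hx2⟩ := (LinearPMap.mem_graph_iff _).1 h1
      obtain ⟨x', hx1', hx2'⟩ := (LinearPMap.mem_graph_iff _).1 h2
      simp only at hx1 hx2 hx1' hx2'
      refine ⟨x, hx1, ?_⟩
      let v : A.domain := x' - (μ i : ℂ) • x
      have hv : (v : L2) = w - (μ i : ℂ) • b i := by
        rw [← hx1, ← hx1']; rfl
      have hAv : A v = -(μ i : ℂ) • (v : L2) := by
        rw [hv, LinearPMap.map_sub, LinearPMap.map_smul, hx2, hx2']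
        push_cast; module
      have hv0 : (v : L2) = 0 := by
        rcases (hμ i).eq_or_lt with h0 | hpos
        · -- here `v = A e` and `A v = 0`
          have hAv0 : A v = 0 := by rw [hAv, ← h0]; simp
          have := hsym v x
          rw [hAv0, inner_zero_left, hx2, show w = (v : L2) by rw [hv, ← h0]; simp] at this
          exact inner_self_eq_zero.1 this.symm
        · have := hA.nonneg v
          rw [hAv, inner_smul_right, inner_self_eq_norm_sq_to_K] at this
          have h3 : (-(μ i : ℂ) * ((‖(v : L2)‖ : ℂ)) ^ 2).re = -(μ i * ‖(v : L2)‖ ^ 2) := by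
            norm_cast; simp
          have h4 : 0 ≤ -(μ i * ‖(v : L2)‖ ^ 2) := by rw [← h3]; exact this
          have h5 : ‖(v : L2)‖ ^ 2 = 0 := by
            have : 0 ≤ ‖(v : L2)‖ ^ 2 := by positivity
            nlinarith
          simpa using h5
      rw [hx2]
      rw [hv] at hv0
      exact sub_eq_zero.1 hv0
    have hle : A ≤ diagOp b μ := by
      refine le_diagOp b μ fun x i => ?_
      obtain ⟨u, hu1, hu2⟩ := heig i
      rw [← hu1, ← hsym, hu2, inner_smul_left, Complex.conj_ofReal, hu1]
    refine le_antisymm hle ?_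
    have hform : A.IsFormalAdjoint (diagOp b μ) := fun x y => by
      refine inner_diagOp_comm b μ (fun i => ?_) (inner_diagOp b μ y)
      have := hle.2 (x := x) (y := ⟨x, hle.1 x.2⟩) rfl
      rw [this]
      exact inner_diagOp b μ _ i
    have := LinearPMap.IsFormalAdjoint.le_adjoint hdense hform
    rwa [LinearPMap.isSelfAdjoint_def.1 hA.selfAdjoint] at this
  · rintro rfl
    refine ⟨isSelfAdjoint_diagOp b μ, fun x => ?_, fun x y => ?_⟩
    · have h := b.hasSum_inner_mul_inner (x : L2) (diagOp b μ x)
      have e : ∀ i, ⟪(x : L2), b i⟫_ℂ * ⟪b i, diagOp b μ x⟫_ℂ =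
          ((μ i * ‖⟪b i, (x : L2)⟫_ℂ‖ ^ 2 : ℝ) : ℂ) := by
        intro i
        rw [inner_diagOp, ← inner_conj_symm (x : L2), mul_left_comm, Complex.conj_mul']
        norm_cast
      simp only [e] at h
      have h' := Complex.hasSum_re h
      simp only [Complex.ofReal_re] at h'
      exact h'.nonneg fun i => mul_nonneg (hμ i) (by positivity)
    · rw [exists_mem_graph_diagOp_sq, hcl]

/-! ### Ladder operators -/

/-- Two commuting pairs of annihilation operators `A`, `C` and creation operators `As`, `Cs` on the
Schwartz functions of the plane, that generate the multiplications by the coordinates, and a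
Gaussian vacuum vector `Ω`. -/
structure Ladder where
  A : Sch →ₗ[ℂ] Sch
  As : Sch →ₗ[ℂ] Sch
  C : Sch →ₗ[ℂ] Sch
  Cs : Sch →ₗ[ℂ] Sch
  Ω : Sch
  A_As : ∀ ψ, A (As ψ) = As (A ψ) + ψ
  C_Cs : ∀ ψ, C (Cs ψ) = Cs (C ψ) + ψ
  A_Cs : ∀ ψ, A (Cs ψ) = Cs (A ψ)
  C_As : ∀ ψ, C (As ψ) = As (C ψ)
  As_Cs : ∀ ψ, As (Cs ψ) = Cs (As ψ)
  inner_As : ∀ φ ψ, ⟪emb (As φ), emb ψ⟫_ℂ = ⟪emb φ, emb (A ψ)⟫_ℂ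
  inner_Cs : ∀ φ ψ, ⟪emb (Cs φ), emb ψ⟫_ℂ = ⟪emb φ, emb (C ψ)⟫_ℂ
  A_Ω : A Ω = 0
  C_Ω : C Ω = 0
  norm_Ω : ‖emb Ω‖ = 1
  exists_gauss : ∃ b > 0, ∃ c : ℂ, Ω = c • gaussS b
  exists_coord : ∀ α β : ℂ, ∃ p q r s : ℂ, ∀ ψ,
    α • X1 ψ + β • X2 ψ = p • A ψ + q • As ψ + r • C ψ + s • Cs ψ

namespace Ladder

variable (L : Ladder)

/-- The normalized joint eigenvectors `Asᵐ Csⁿ Ω / √(m! n!)` of the two number operators. -/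
def h (m n : ℕ) : Sch :=
  (((Real.sqrt m.factorial)⁻¹ * (Real.sqrt n.factorial)⁻¹ : ℝ) : ℂ) • L.As^[m] (L.Cs^[n] L.Ω)

lemma As_iterate_Cs (m : ℕ) (ψ : Sch) : L.As^[m] (L.Cs ψ) = L.Cs (L.As^[m] ψ) := by
  induction m generalizing ψ with
  | zero => rfl
  | succ m ih => rw [Function.iterate_succ_apply, Function.iterate_succ_apply, L.As_Cs, ih]

lemma h_zero_zero : L.h 0 0 = L.Ω := by simp [h]

lemma sqrt_factorial_succ_inv (m : ℕ) :
    (Real.sqrt m.factorial)⁻¹ =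
      Real.sqrt ((m + 1 : ℕ) : ℝ) * (Real.sqrt (m + 1).factorial)⁻¹ := by
  rw [Nat.factorial_succ, Nat.cast_mul, Real.sqrt_mul (by positivity)]
  have : Real.sqrt ((m + 1 : ℕ) : ℝ) ≠ 0 := by positivity
  have : Real.sqrt (m.factorial : ℝ) ≠ 0 := by positivity
  field_simp

lemma As_h (m n : ℕ) : L.As (L.h m n) = (Real.sqrt ((m + 1 : ℕ) : ℝ) : ℂ) • L.h (m + 1) n := by
  rw [h, h, map_smul, smul_smul, ← Function.iterate_succ_apply' L.As, sqrt_factorial_succ_inv m]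
  push_cast; congr 1; ring

lemma Cs_h (m n : ℕ) : L.Cs (L.h m n) = (Real.sqrt ((n + 1 : ℕ) : ℝ) : ℂ) • L.h m (n + 1) := by
  rw [h, h, map_smul, smul_smul, Function.iterate_succ_apply' L.Cs, As_iterate_Cs,
    sqrt_factorial_succ_inv n]
  push_cast; congr 1; ring

lemma h_succ_left (m n : ℕ) :
    L.h (m + 1) n = ((Real.sqrt ((m + 1 : ℕ) : ℝ))⁻¹ : ℂ) • L.As (L.h m n) := by
  rw [As_h, smul_smul, inv_mul_cancel₀, one_smul]
  exact_mod_cast (Real.sqrt_pos.2 (by positivity)).ne'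

lemma h_succ_right (m n : ℕ) :
    L.h m (n + 1) = ((Real.sqrt ((n + 1 : ℕ) : ℝ))⁻¹ : ℂ) • L.Cs (L.h m n) := by
  rw [Cs_h, smul_smul, inv_mul_cancel₀, one_smul]
  exact_mod_cast (Real.sqrt_pos.2 (by positivity)).ne'

lemma ofReal_sqrt_mul_self (m : ℕ) :
    (Real.sqrt (m : ℝ) : ℂ) * (Real.sqrt (m : ℝ) : ℂ) = m := by
  rw [← Complex.ofReal_mul, Real.mul_self_sqrt (by positivity)]; simp

/-- `As A` and `Cs C` are number operators, with the joint eigenvectors `h m n`. -/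
lemma As_A_C_h (m n : ℕ) : L.As (L.A (L.h m n)) = (m : ℂ) • L.h m n ∧
    L.Cs (L.C (L.h m n)) = (n : ℂ) • L.h m n := by
  induction m with
  | zero =>
    induction n with
    | zero => simp [h_zero_zero, L.A_Ω, L.C_Ω]
    | succ n ih =>
      rw [h_succ_right]
      simp only [map_smul, L.A_Cs, L.As_Cs, L.C_Cs, map_add, ih.1, ih.2, smul_smul]
      constructor
      · simp
      · push_cast; module
  | succ m ih =>
    rw [h_succ_left]
    simp only [map_smul, L.A_As, L.C_As, ← L.As_Cs, map_add, ih.1, ih.2, smul_smul]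
    constructor <;> push_cast <;> module

lemma A_h_zero (n : ℕ) : L.A (L.h 0 n) = 0 := by
  induction n with
  | zero => rw [h_zero_zero, L.A_Ω]
  | succ n ih => rw [h_succ_right, map_smul, L.A_Cs, ih]; simp

lemma A_h_succ (m n : ℕ) :
    L.A (L.h (m + 1) n) = (Real.sqrt ((m + 1 : ℕ) : ℝ) : ℂ) • L.h m n := by
  rw [h_succ_left, map_smul, L.A_As, (L.As_A_C_h m n).1]
  have h0 : (Real.sqrt ((m + 1 : ℕ) : ℝ) : ℂ) ≠ 0 := by
    exact_mod_cast (Real.sqrt_pos.2 (by positivity)).ne'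
  have h1 := ofReal_sqrt_mul_self (m + 1)
  rw [show (m : ℂ) • L.h m n + L.h m n = ((m + 1 : ℕ) : ℂ) • L.h m n by push_cast; module,
    smul_smul, ← h1, inv_mul_cancel_left₀ h0]

lemma inner_As_A (φ ψ : Sch) : ⟪emb (L.As (L.A φ)), emb ψ⟫_ℂ = ⟪emb φ, emb (L.As (L.A ψ))⟫_ℂ := by
  rw [L.inner_As, ← inner_conj_symm, ← L.inner_As, inner_conj_symm]

lemma inner_Cs_C (φ ψ : Sch) : ⟪emb (L.Cs (L.C φ)), emb ψ⟫_ℂ = ⟪emb φ, emb (L.Cs (L.C ψ))⟫_ℂ := by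
  rw [L.inner_Cs, ← inner_conj_symm, ← L.inner_Cs, inner_conj_symm]

lemma norm_h (m n : ℕ) : ⟪emb (L.h m n), emb (L.h m n)⟫_ℂ = 1 := by
  induction m with
  | zero =>
    induction n with
    | zero => rw [h_zero_zero, inner_self_eq_norm_sq_to_K, L.norm_Ω]; simp
    | succ n ih =>
      have h0 : (Real.sqrt ((n + 1 : ℕ) : ℝ) : ℂ) ≠ 0 := by
        exact_mod_cast (Real.sqrt_pos.2 (by positivity)).ne'
      have h1 := ofReal_sqrt_mul_self (n + 1)
      rw [h_succ_right, emb_smul, inner_smul_left, inner_smul_right, L.inner_Cs, L.C_Cs,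
        (L.As_A_C_h 0 n).2, map_inv₀, Complex.conj_ofReal,
        show (n : ℂ) • L.h 0 n + L.h 0 n = ((n + 1 : ℕ) : ℂ) • L.h 0 n by push_cast; module,
        emb_smul, inner_smul_right, ih, ← h1]
      field_simp
  | succ m ih =>
    have h0 : (Real.sqrt ((m + 1 : ℕ) : ℝ) : ℂ) ≠ 0 := by
      exact_mod_cast (Real.sqrt_pos.2 (by positivity)).ne'
    have h1 := ofReal_sqrt_mul_self (m + 1)
    rw [h_succ_left, emb_smul, inner_smul_left, inner_smul_right, L.inner_As, L.A_As,
      (L.As_A_C_h m n).1, map_inv₀, Complex.conj_ofReal,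
      show (m : ℂ) • L.h m n + L.h m n = ((m + 1 : ℕ) : ℂ) • L.h m n by push_cast; module,
      emb_smul, inner_smul_right, ih, ← h1]
    field_simp

/-- Joint eigenvectors of symmetric operators with different pairs of eigenvalues are orthogonal. -/
lemma inner_h_of_ne {m n m' n' : ℕ} (hne : (m, n) ≠ (m', n')) :
    ⟪emb (L.h m n), emb (L.h m' n')⟫_ℂ = 0 := by
  have e1 := L.inner_As_A (L.h m n) (L.h m' n')
  have e2 := L.inner_Cs_C (L.h m n) (L.h m' n')
  rw [(L.As_A_C_h m n).1, (L.As_A_C_h m' n').1, emb_smul, emb_smul, inner_smul_left,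
    inner_smul_right, Complex.conj_natCast] at e1
  rw [(L.As_A_C_h m n).2, (L.As_A_C_h m' n').2, emb_smul, emb_smul, inner_smul_left,
    inner_smul_right, Complex.conj_natCast] at e2
  by_contra h0
  have f1 := mul_right_cancel₀ h0 e1
  have f2 := mul_right_cancel₀ h0 e2
  exact hne (Prod.ext (by exact_mod_cast f1) (by exact_mod_cast f2))

lemma orthonormal_h : Orthonormal ℂ fun p : ℕ × ℕ => emb (L.h p.1 p.2) := by
  rw [orthonormal_iff_ite]
  intro p q
  split_ifs with hpq
  · rw [hpq, norm_h]
  · exact L.inner_h_of_ne hpq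

/-- The span of the vectors `L.h m n` is stable under the ladder operators. -/
lemma mem_span_h {ψ : Sch} (hψ : ψ ∈ Submodule.span ℂ (Set.range fun p : ℕ × ℕ => L.h p.1 p.2)) :
    L.A ψ ∈ Submodule.span ℂ (Set.range fun p : ℕ × ℕ => L.h p.1 p.2) ∧
    L.As ψ ∈ Submodule.span ℂ (Set.range fun p : ℕ × ℕ => L.h p.1 p.2) ∧
    L.C ψ ∈ Submodule.span ℂ (Set.range fun p : ℕ × ℕ => L.h p.1 p.2) ∧
    L.Cs ψ ∈ Submodule.span ℂ (Set.range fun p : ℕ × ℕ => L.h p.1 p.2) := by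
  have hm : ∀ m n, L.h m n ∈ Submodule.span ℂ (Set.range fun p : ℕ × ℕ => L.h p.1 p.2) :=
    fun m n => Submodule.subset_span ⟨(m, n), rfl⟩
  induction hψ using Submodule.span_induction with
  | mem ψ h =>
    obtain ⟨⟨m, n⟩, rfl⟩ := h
    refine ⟨?_, ?_, ?_, ?_⟩
    · cases m with
      | zero => simp only [A_h_zero]; exact zero_mem _
      | succ m => simp only [A_h_succ]; exact Submodule.smul_mem _ _ (hm _ _)
    · simp only [As_h]; exact Submodule.smul_mem _ _ (hm _ _)
    · have hC0 : ∀ m, L.C (L.h m 0) = 0 := by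
        intro m
        induction m with
        | zero => rw [h_zero_zero, L.C_Ω]
        | succ m ih => rw [h_succ_left, map_smul, L.C_As, ih]; simp
      cases n with
      | zero => simp only [hC0]; exact zero_mem _
      | succ n =>
        simp only [h_succ_right, map_smul, L.C_Cs, (L.As_A_C_h m n).2]
        exact Submodule.smul_mem _ _ (add_mem (Submodule.smul_mem _ _ (hm _ _)) (hm _ _))
    · simp only [Cs_h]; exact Submodule.smul_mem _ _ (hm _ _)
  | zero => simp only [map_zero]; exact ⟨zero_mem _, zero_mem _, zero_mem _, zero_mem _⟩
  | add φ ψ _ _ h1 h2 =>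
    simp only [map_add]
    exact ⟨add_mem h1.1 h2.1, add_mem h1.2.1 h2.2.1, add_mem h1.2.2.1 h2.2.2.1,
      add_mem h1.2.2.2 h2.2.2.2⟩
  | smul c ψ _ h1 =>
    simp only [map_smul]
    exact ⟨Submodule.smul_mem _ _ h1.1, Submodule.smul_mem _ _ h1.2.1,
      Submodule.smul_mem _ _ h1.2.2.1, Submodule.smul_mem _ _ h1.2.2.2⟩

/-- Completeness of the eigenvectors: their span contains the products of polynomials with the
Gaussian vacuum. -/
theorem orthogonal_span_h :
    (Submodule.span ℂ (Set.range fun p : ℕ × ℕ => emb (L.h p.1 p.2)))ᗮ = ⊥ := by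
  rw [Submodule.eq_bot_iff]
  intro g hg
  obtain ⟨b, hb, c, hc⟩ := L.exists_gauss
  have hc0 : c ≠ 0 := by
    rintro rfl
    have := L.norm_Ω
    rw [hc, zero_smul, emb_zero, norm_zero] at this
    exact zero_ne_one this
  -- `g` is orthogonal to the span of the eigenvectors, which contains polynomials times `Ω`
  have horth : ∀ ψ ∈ Submodule.span ℂ (Set.range fun p : ℕ × ℕ => L.h p.1 p.2),
      ⟪emb ψ, g⟫_ℂ = 0 := by
    intro ψ hψ
    induction hψ using Submodule.span_induction with
    | mem ψ h =>
      obtain ⟨p, rfl⟩ := h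
      exact (Submodule.mem_orthogonal _ _).1 hg _ (Submodule.subset_span ⟨p, rfl⟩)
    | zero => rw [emb_zero, inner_zero_left]
    | add φ ψ _ _ h1 h2 => rw [emb_add, inner_add_left, h1, h2, add_zero]
    | smul c ψ _ h1 => rw [emb_smul, inner_smul_left, h1, mul_zero]
  refine eq_zero_of_moments hb g fun α β n => ?_
  have hpoly : ∀ n : ℕ, ∃ ψ ∈ Submodule.span ℂ (Set.range fun p : ℕ × ℕ => L.h p.1 p.2),
      ∀ x : ℝ × ℝ, ψ x = ((α * x.1 + β * x.2 : ℝ) : ℂ) ^ n * (c * gaussS b x) := by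
    intro n
    induction n with
    | zero =>
      refine ⟨L.Ω, ?_, fun x => by rw [hc]; simp⟩
      rw [← h_zero_zero]
      exact Submodule.subset_span ⟨(0, 0), rfl⟩
    | succ n ih =>
      obtain ⟨ψ, hψ, hx⟩ := ih
      obtain ⟨p, q, r, s, hpqrs⟩ := L.exists_coord α β
      refine ⟨(α : ℂ) • X1 ψ + (β : ℂ) • X2 ψ, ?_, fun x => ?_⟩
      · obtain ⟨h1, h2, h3, h4⟩ := L.mem_span_h hψ
        rw [hpqrs]
        exact add_mem (add_mem (add_mem (Submodule.smul_mem _ _ h1) (Submodule.smul_mem _ _ h2))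
          (Submodule.smul_mem _ _ h3)) (Submodule.smul_mem _ _ h4)
      · rw [add_apply, smul_apply, smul_apply, X1_apply, X2_apply, hx, smul_eq_mul, smul_eq_mul]
        push_cast; ring
  obtain ⟨ψ, hψ, hx⟩ := hpoly n
  have h1 := horth ψ hψ
  have h2 : ⟪emb ψ, g⟫_ℂ = ∫ x, conj (ψ x) * g x := by
    rw [L2.inner_def]
    refine integral_congr_ae ?_
    filter_upwards [SchwartzMap.coeFn_toLp ψ 2 volume] with x hx
    rw [show (emb ψ : ℝ × ℝ → ℂ) x = ψ x from hx, RCLike.inner_apply, mul_comm]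
  rw [h2] at h1
  have h3 : ∀ x, conj (ψ x) * g x =
      conj c * (((α * x.1 + β * x.2 : ℝ) : ℂ) ^ n * gaussS b x * g x) := by
    intro x
    rw [hx, gaussS_apply hb, map_mul, map_mul, map_pow, Complex.conj_ofReal, Complex.conj_ofReal]
    ring
  simp only [h3] at h1
  rw [integral_const_mul] at h1
  exact (mul_eq_zero.1 h1).resolve_left (by simpa using hc0)

/-- The Hilbert basis of `L²(ℝ²)` formed by the joint eigenvectors of the number operators. -/
def basis : HilbertBasis (ℕ × ℕ) ℂ L2 :=
  HilbertBasis.mkOfOrthogonalEqBot L.orthonormal_h L.orthogonal_span_h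

lemma basis_apply (p : ℕ × ℕ) : L.basis p = emb (L.h p.1 p.2) := by
  rw [basis, HilbertBasis.coe_mkOfOrthogonalEqBot]

lemma inner_h (m n m' n' : ℕ) :
    ⟪emb (L.h m n), emb (L.h m' n')⟫_ℂ = if m = m' ∧ n = n' then 1 else 0 := by
  split_ifs with h
  · rw [h.1, h.2, norm_h]
  · exact L.inner_h_of_ne fun h' => h (Prod.ext_iff.1 h')

/-- Schwartz functions with the same coordinates are equal. -/
lemma ext_inner {φ ψ : Sch}
    (h : ∀ m n, ⟪emb (L.h m n), emb φ⟫_ℂ = ⟪emb (L.h m n), emb ψ⟫_ℂ) : φ = ψ :=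
  emb_injective (hilbertBasis_ext L.basis fun p => by rw [basis_apply, h])

end Ladder

namespace Ladder

/-- `k As A + c` has the single positive square root with eigenvalues `√(k m + c)`. -/
lemma isPosSqrt_number_iff (L : Ladder) {k c : ℝ} (hk : 0 ≤ k) (hc : 0 ≤ c) {P : Sch → Sch}
    (hP : ∀ ψ, P ψ = (k : ℂ) • L.As (L.A ψ) + (c : ℂ) • ψ) (A : L2 →ₗ.[ℂ] L2) :
    IsPosSqrt P A ↔ A = diagOp L.basis fun p => Real.sqrt (k * p.1 + c) := by
  have hP' : P = ((k : ℂ) • (L.As ∘ₗ L.A) + (c : ℂ) • LinearMap.id : Sch →ₗ[ℂ] Sch) := by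
    ext1 ψ; rw [hP]; rfl
  rw [hP']
  refine isPosSqrt_iff L.basis (fun p => L.h p.1 p.2) L.basis_apply _ _
    (fun p => Real.sqrt_nonneg _) (fun p => ?_) (fun φ ψ => ?_) A
  · rw [← hP', hP, (L.As_A_C_h _ _).1, Real.sq_sqrt (by positivity)]
    push_cast; module
  · rw [← hP', hP, hP, emb_add, emb_add, emb_smul, emb_smul, emb_smul, emb_smul, inner_add_left,
      inner_add_right, inner_smul_left, inner_smul_left, inner_smul_right, inner_smul_right,
      L.inner_As_A, Complex.conj_ofReal, Complex.conj_ofReal]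

end Ladder

lemma lin_gaussS_eq_zero {β : ℝ} (hβ : 0 < β) {a b c d : ℂ} (h1 : a = 2 * β * c)
    (h2 : b = 2 * β * d) : lin a b c d (gaussS β) = 0 := by
  rw [lin_apply, D1_gaussS hβ, D2_gaussS hβ, h1, h2]; module

/-- The normalized Gaussian. -/
def vac (β : ℝ) : Sch := ((Real.sqrt (2 * β / Real.pi) : ℝ) : ℂ) • gaussS β

lemma norm_vac {β : ℝ} (hβ : 0 < β) : ‖emb (vac β)‖ = 1 := by
  have h : ‖emb (vac β)‖ ^ 2 = 1 := by
    rw [vac, emb_smul, norm_smul, mul_pow, norm_sq_emb_gaussS hβ, Complex.norm_real,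
      Real.norm_eq_abs, sq_abs, Real.sq_sqrt (by positivity)]
    field_simp
  nlinarith [norm_nonneg (emb (vac β))]

lemma lin_vac_eq_zero {β : ℝ} (hβ : 0 < β) {a b c d : ℂ} (h1 : a = 2 * β * c)
    (h2 : b = 2 * β * d) : lin a b c d (vac β) = 0 := by
  rw [vac, map_smul, lin_gaussS_eq_zero hβ h1 h2, smul_zero]

lemma lin_comm_of_eq {a b c d a' b' c' d' : ℂ} (h : c * a' - a * c' + d * b' - b * d' = 0)
    (ψ : Sch) : lin a b c d (lin a' b' c' d' ψ) = lin a' b' c' d' (lin a b c d ψ) := by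
  rw [lin_comm, h, zero_smul, add_zero]

lemma lin_comm_of_eq_one {a b c d a' b' c' d' : ℂ}
    (h : c * a' - a * c' + d * b' - b * d' = 1) (ψ : Sch) :
    lin a b c d (lin a' b' c' d' ψ) = lin a' b' c' d' (lin a b c d ψ) + ψ := by
  rw [lin_comm, h, one_smul]

lemma inner_lin_of_conj {a b c d a' b' c' d' : ℂ} (ha : conj a = a') (hb : conj b = b')
    (hc : -conj c = c') (hd : -conj d = d') (φ ψ : Sch) :
    ⟪emb (lin a b c d φ), emb ψ⟫_ℂ = ⟪emb φ, emb (lin a' b' c' d' ψ)⟫_ℂ := by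
  rw [inner_lin, ha, hb, hc, hd]

/-! ### The length operator -/

/-- The ladder operators of the relative coordinate `q₁ - q₂` and of the sum `q₁ + q₂`; the first
annihilation operator is `da / (√2 λ)`. -/
def lengthLadder (lam : ℝ) (hlam : 0 < lam) : Ladder where
  A := lin (1 / (2 * lam)) (-(1 / (2 * lam))) (lam / 2) (-(lam / 2))
  As := lin (1 / (2 * lam)) (-(1 / (2 * lam))) (-(lam / 2)) (lam / 2)
  C := lin (1 / (2 * lam)) (1 / (2 * lam)) (lam / 2) (lam / 2)
  Cs := lin (1 / (2 * lam)) (1 / (2 * lam)) (-(lam / 2)) (-(lam / 2))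
  Ω := vac (1 / (2 * lam ^ 2))
  A_As := lin_comm_of_eq_one (by
    have : (lam : ℂ) ≠ 0 := by exact_mod_cast hlam.ne'
    field_simp; ring)
  C_Cs := lin_comm_of_eq_one (by
    have : (lam : ℂ) ≠ 0 := by exact_mod_cast hlam.ne'
    field_simp; ring)
  A_Cs := lin_comm_of_eq (by ring)
  C_As := lin_comm_of_eq (by ring)
  As_Cs := lin_comm_of_eq (by ring)
  inner_As := inner_lin_of_conj (by simp [map_ofNat]) (by simp [map_ofNat])
    (by simp [map_ofNat]) (by simp [map_ofNat])
  inner_Cs := inner_lin_of_conj (by simp [map_ofNat]) (by simp [map_ofNat])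
    (by simp [map_ofNat]) (by simp [map_ofNat])
  A_Ω := by
    have h0 : (lam : ℂ) ≠ 0 := by exact_mod_cast hlam.ne'
    refine lin_vac_eq_zero (by positivity) ?_ ?_ <;> push_cast <;> field_simp
  C_Ω := by
    have h0 : (lam : ℂ) ≠ 0 := by exact_mod_cast hlam.ne'
    refine lin_vac_eq_zero (by positivity) ?_ ?_ <;> push_cast <;> field_simp
  norm_Ω := norm_vac (by positivity)
  exists_gauss := ⟨_, by positivity, _, rfl⟩
  exists_coord := fun α β => by
    have h0 : (lam : ℂ) ≠ 0 := by exact_mod_cast hlam.ne'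
    refine ⟨lam * (α - β) / 2, lam * (α - β) / 2, lam * (α + β) / 2, lam * (α + β) / 2,
      fun ψ => ?_⟩
    simp only [lin_apply]
    match_scalars <;> field_simp <;> ring

lemma dq₁_eq (lam : ℝ) (hlam : 0 < lam) (ψ : Sch) :
    dq₁ ψ = (lam : ℂ) • ((lengthLadder lam hlam).A ψ + (lengthLadder lam hlam).As ψ) := by
  have h0 : (lam : ℂ) ≠ 0 := by exact_mod_cast hlam.ne'
  have : dq₁ ψ = X1 ψ - X2 ψ := rfl
  rw [this]
  simp only [lengthLadder, lin_apply]
  match_scalars <;> field_simp <;> ring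

lemma dq₂_eq (lam : ℝ) (hlam : 0 < lam) (ψ : Sch) :
    dq₂ lam ψ = (-Complex.I * lam : ℂ) •
      ((lengthLadder lam hlam).A ψ - (lengthLadder lam hlam).As ψ) := by
  have : dq₂ lam ψ = (-Complex.I * ((lam ^ 2 : ℝ) : ℂ)) • D1 ψ
    - (-Complex.I * ((lam ^ 2 : ℝ) : ℂ)) • D2 ψ := rfl
  rw [this]
  simp only [lengthLadder, lin_apply]
  push_cast
  match_scalars <;> ring

lemma da_eq (lam : ℝ) (hlam : 0 < lam) (ψ : Sch) :
    da lam ψ = (((Real.sqrt 2 * lam : ℝ)) : ℂ) • (lengthLadder lam hlam).A ψ := by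
  have h2 : (Real.sqrt 2 : ℂ) ^ 2 = 2 := by
    rw [← Complex.ofReal_pow, Real.sq_sqrt (by norm_num)]; simp
  have h0 : (Real.sqrt 2 : ℂ) ≠ 0 := by
    intro h; rw [h] at h2; norm_num at h2
  rw [da, dq₁_eq lam hlam, dq₂_eq lam hlam]
  push_cast
  match_scalars <;> field_simp
  · rw [h2, Complex.I_sq]; ring
  · rw [Complex.I_sq]; ring

lemma daStar_eq (lam : ℝ) (hlam : 0 < lam) (ψ : Sch) :
    daStar lam ψ = (((Real.sqrt 2 * lam : ℝ)) : ℂ) • (lengthLadder lam hlam).As ψ := by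
  have h2 : (Real.sqrt 2 : ℂ) ^ 2 = 2 := by
    rw [← Complex.ofReal_pow, Real.sq_sqrt (by norm_num)]; simp
  have h0 : (Real.sqrt 2 : ℂ) ≠ 0 := by
    intro h; rw [h] at h2; norm_num at h2
  rw [daStar, dq₁_eq lam hlam, dq₂_eq lam hlam]
  push_cast
  match_scalars <;> field_simp
  · rw [Complex.I_sq]; ring
  · rw [h2, Complex.I_sq]; ring

/-- `L² = 4θ (N + 1/2)`, with `N` the number operator of the relative coordinate. -/
lemma lengthSq_eq (lam : ℝ) (hlam : 0 < lam) (ψ : Sch) :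
    lengthSq lam ψ = ((4 * lam ^ 2 : ℝ) : ℂ) •
      (lengthLadder lam hlam).As ((lengthLadder lam hlam).A ψ) + ((2 * lam ^ 2 : ℝ) : ℂ) • ψ := by
  rw [lengthSq, dq₁_eq lam hlam, dq₁_eq lam hlam, dq₂_eq lam hlam, dq₂_eq lam hlam]
  simp only [map_smul, map_add, map_sub, (lengthLadder lam hlam).A_As]
  push_cast
  match_scalars <;> (ring_nf; rw [Complex.I_sq]; ring)

/-- The constants `c` for which `lᵢ(b)² = k b* b + c`, if `[b, b*] = k / 2`. -/
def lConst (lam k : ℝ) (i : Fin 3) : ℝ :=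
  match i with
  | 0 => k / 2
  | 1 => k - 2 * lam ^ 2
  | 2 => 2 * lam ^ 2

lemma lSq_eq (L : Ladder) {lam s : ℝ} {b bs : Sch → Sch} (hb : ∀ ψ, b ψ = (s : ℂ) • L.A ψ)
    (hbs : ∀ ψ, bs ψ = (s : ℂ) • L.As ψ) (i : Fin 3) (ψ : Sch) :
    lSq lam i b bs ψ = ((2 * s ^ 2 : ℝ) : ℂ) • L.As (L.A ψ)
      + ((lConst lam (2 * s ^ 2) i : ℝ) : ℂ) • ψ := by
  fin_cases i <;> simp only [lSq, lConst, hb, hbs, map_smul, L.A_As] <;> push_cast <;> module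

/-- The length operator is well defined and equals all `lᵢ(da)`: as `[da, da*] = 2θ`, all four
squares are the same operator `4θ (N + 1/2)`. -/
theorem existsUnique_length (lam : ℝ) (hlam : 0 < lam) :
    ∃ L : L2 →ₗ.[ℂ] L2, ∀ A : L2 →ₗ.[ℂ] L2, (IsPosSqrt (lengthSq lam) A ↔ A = L) ∧
      ∀ i : Fin 3, (IsPosSqrt (lSq lam i (da lam) (daStar lam)) A ↔ A = L) := by
  refine ⟨diagOp (lengthLadder lam hlam).basis fun p =>
    Real.sqrt (4 * lam ^ 2 * p.1 + 2 * lam ^ 2), fun A => ⟨?_, fun i => ?_⟩⟩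
  · exact (lengthLadder lam hlam).isPosSqrt_number_iff (by positivity) (by positivity)
      (lengthSq_eq lam hlam) A
  · refine (lengthLadder lam hlam).isPosSqrt_number_iff (by positivity) (by positivity)
      (fun ψ => ?_) A
    rw [lSq_eq (lengthLadder lam hlam) (da_eq lam hlam) (daStar_eq lam hlam)]
    have h2 : Real.sqrt 2 ^ 2 = 2 := Real.sq_sqrt (by norm_num)
    have e1 : 2 * (Real.sqrt 2 * lam) ^ 2 = 4 * lam ^ 2 := by rw [mul_pow, h2]; ring
    have e2 : lConst lam (4 * lam ^ 2) i = 2 * lam ^ 2 := by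
      fin_cases i <;> simp only [lConst] <;> ring
    rw [e1, e2]

/-! ### The ladder operators of the Moyal plane -/

/-- The ladder operators of the Moyal plane: `A`, `As` are the left multiplications by `z / λ`,
`z̄ / λ`, and `C`, `Cs` the right multiplications by `z̄ / λ`, `z / λ`. -/
def moyalLadder (lam : ℝ) (hlam : 0 < lam) : Ladder where
  A := lin (1 / (Real.sqrt 2 * lam)) (Complex.I / (Real.sqrt 2 * lam)) (lam / (2 * Real.sqrt 2))
    (Complex.I * lam / (2 * Real.sqrt 2))
  As := lin (1 / (Real.sqrt 2 * lam)) (-(Complex.I / (Real.sqrt 2 * lam)))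
    (-(lam / (2 * Real.sqrt 2))) (Complex.I * lam / (2 * Real.sqrt 2))
  C := lin (1 / (Real.sqrt 2 * lam)) (-(Complex.I / (Real.sqrt 2 * lam))) (lam / (2 * Real.sqrt 2))
    (-(Complex.I * lam / (2 * Real.sqrt 2)))
  Cs := lin (1 / (Real.sqrt 2 * lam)) (Complex.I / (Real.sqrt 2 * lam))
    (-(lam / (2 * Real.sqrt 2))) (-(Complex.I * lam / (2 * Real.sqrt 2)))
  Ω := vac (1 / lam ^ 2)
  A_As := lin_comm_of_eq_one (by
    have h0 : (lam : ℂ) ≠ 0 := by exact_mod_cast hlam.ne'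
    have h2 : (Real.sqrt 2 : ℂ) ^ 2 = 2 := by
      rw [← Complex.ofReal_pow, Real.sq_sqrt (by norm_num)]; simp
    have h3 : (Real.sqrt 2 : ℂ) ≠ 0 := by
      intro h; rw [h] at h2; norm_num at h2
    field_simp; rw [Complex.I_sq, h2]; ring)
  C_Cs := lin_comm_of_eq_one (by
    have h0 : (lam : ℂ) ≠ 0 := by exact_mod_cast hlam.ne'
    have h2 : (Real.sqrt 2 : ℂ) ^ 2 = 2 := by
      rw [← Complex.ofReal_pow, Real.sq_sqrt (by norm_num)]; simp
    have h3 : (Real.sqrt 2 : ℂ) ≠ 0 := by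
      intro h; rw [h] at h2; norm_num at h2
    field_simp; rw [Complex.I_sq, h2]; ring)
  A_Cs := lin_comm_of_eq (by ring_nf; rw [Complex.I_sq]; ring)
  C_As := lin_comm_of_eq (by ring_nf; rw [Complex.I_sq]; ring)
  As_Cs := lin_comm_of_eq (by ring)
  inner_As := inner_lin_of_conj (by simp) (by simp [neg_div])
    (by simp [map_ofNat]) (by simp [neg_div, map_ofNat])
  inner_Cs := inner_lin_of_conj (by simp) (by simp [neg_div])
    (by simp [map_ofNat]) (by simp [neg_div, map_ofNat])
  A_Ω := by
    have h0 : (lam : ℂ) ≠ 0 := by exact_mod_cast hlam.ne'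
    have h2 : (Real.sqrt 2 : ℂ) ≠ 0 := by exact_mod_cast (Real.sqrt_pos.2 two_pos).ne'
    refine lin_vac_eq_zero (by positivity) ?_ ?_ <;> push_cast <;> field_simp
  C_Ω := by
    have h0 : (lam : ℂ) ≠ 0 := by exact_mod_cast hlam.ne'
    have h2 : (Real.sqrt 2 : ℂ) ≠ 0 := by exact_mod_cast (Real.sqrt_pos.2 two_pos).ne'
    refine lin_vac_eq_zero (by positivity) ?_ ?_ <;> push_cast <;> field_simp
  norm_Ω := norm_vac (by positivity)
  exists_gauss := ⟨_, by positivity, _, rfl⟩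
  exists_coord := fun α β => by
    have h0 : (lam : ℂ) ≠ 0 := by exact_mod_cast hlam.ne'
    have h2 : (Real.sqrt 2 : ℂ) ≠ 0 := by exact_mod_cast (Real.sqrt_pos.2 two_pos).ne'
    -- `x₁ = (z⋆ + ⋆z + z̄⋆ + ⋆z̄) / (2√2)` and `x₂ = (z⋆ + ⋆z - z̄⋆ - ⋆z̄) / (2√2 i)`
    refine ⟨Real.sqrt 2 * lam / 4 * (α - Complex.I * β), Real.sqrt 2 * lam / 4 * (α + Complex.I * β),
      Real.sqrt 2 * lam / 4 * (α + Complex.I * β), Real.sqrt 2 * lam / 4 * (α - Complex.I * β),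
      fun ψ => ?_⟩
    simp only [lin_apply]
    match_scalars <;> field_simp <;> ring_nf <;> (try rw [Complex.I_sq]) <;> ring

/-! ### Oscillatory integrals over the plane -/

lemma integral_pd {α : Type*} [MeasurableSpace α] {μ : Measure α} {a b : α → ℂ}
    (ha : Integrable a μ) (hb : Integrable b μ) :
    ∫ t, pd (a t) (b t) ∂μ = pd (∫ t, a t ∂μ) (∫ t, b t ∂μ) := by
  have h : Integrable (fun t => pd (a t) (b t)) μ := by
    have h1 := (ContinuousLinearMap.smulRightL ℝ (ℝ × ℝ) ℂ
      (ContinuousLinearMap.fst ℝ ℝ ℝ)).integrable_comp ha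
    have h2 := (ContinuousLinearMap.smulRightL ℝ (ℝ × ℝ) ℂ
      (ContinuousLinearMap.snd ℝ ℝ ℝ)).integrable_comp hb
    exact h1.add h2
  refine pd_ext ?_ ?_ <;> rw [ContinuousLinearMap.integral_apply h] <;> simp

lemma aestronglyMeasurable_pd {α : Type*} [MeasurableSpace α] {μ : Measure α} {a b : α → ℂ}
    (ha : AEStronglyMeasurable a μ) (hb : AEStronglyMeasurable b μ) :
    AEStronglyMeasurable (fun t => pd (a t) (b t)) μ := by
  have h1 := (ContinuousLinearMap.smulRightL ℝ (ℝ × ℝ) ℂ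
    (ContinuousLinearMap.fst ℝ ℝ ℝ)).continuous.comp_aestronglyMeasurable ha
  have h2 := (ContinuousLinearMap.smulRightL ℝ (ℝ × ℝ) ℂ
    (ContinuousLinearMap.snd ℝ ℝ ℝ)).continuous.comp_aestronglyMeasurable hb
  exact h1.add h2

/-- Differentiation of a parametric integral over the parameter plane, in terms of partial
derivatives. -/
lemma hasFDerivAt_integral_pd {α : Type*} [MeasurableSpace α] {μ : Measure α}
    {F a b : ℝ × ℝ → α → ℂ} {bound : α → ℝ} {x₀ : ℝ × ℝ} {s : Set (ℝ × ℝ)} (hs : s ∈ 𝓝 x₀)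
    (hF : ∀ x, AEStronglyMeasurable (F x) μ) (hFi : Integrable (F x₀) μ)
    (ha : AEStronglyMeasurable (a x₀) μ) (hb : AEStronglyMeasurable (b x₀) μ)
    (hbd : ∀ᵐ t ∂μ, ∀ x ∈ s, ‖a x t‖ + ‖b x t‖ ≤ bound t) (hbi : Integrable bound μ)
    (hd : ∀ᵐ t ∂μ, ∀ x ∈ s, HasFDerivAt (fun x => F x t) (pd (a x t) (b x t)) x) :
    HasFDerivAt (fun x => ∫ t, F x t ∂μ) (pd (∫ t, a x₀ t ∂μ) (∫ t, b x₀ t ∂μ)) x₀ := by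
  have hx₀ : x₀ ∈ s := mem_of_mem_nhds hs
  have hai : Integrable (a x₀) μ := hbi.mono' ha (by
    filter_upwards [hbd] with t ht
    linarith [ht x₀ hx₀, norm_nonneg (b x₀ t)])
  have hbi' : Integrable (b x₀) μ := hbi.mono' hb (by
    filter_upwards [hbd] with t ht
    linarith [ht x₀ hx₀, norm_nonneg (a x₀ t)])
  rw [← integral_pd hai hbi']
  refine hasFDerivAt_integral_of_dominated_of_fderiv_le (F' := fun x t => pd (a x t) (b x t))
    hs (Eventually.of_forall hF) hFi (aestronglyMeasurable_pd ha hb) ?_ hbi hd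
  filter_upwards [hbd] with t ht x hx
  exact (norm_pd_le _ _).trans (ht x hx)

/-- The phase `exp((2i/θ) (u₂ x₁ - u₁ x₂))`, with `θ = λ²`. -/
def osc (lam : ℝ) (u x : ℝ × ℝ) : ℂ :=
  Complex.exp (((2 / lam ^ 2 * (u.2 * x.1 - u.1 * x.2) : ℝ) : ℂ) * Complex.I)

lemma norm_osc (lam : ℝ) (u x : ℝ × ℝ) : ‖osc lam u x‖ = 1 := Complex.norm_exp_ofReal_mul_I _

lemma continuous_osc (lam : ℝ) : Continuous fun p : (ℝ × ℝ) × (ℝ × ℝ) => osc lam p.1 p.2 := by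
  unfold osc; fun_prop

lemma continuous_osc_left (lam : ℝ) (x : ℝ × ℝ) : Continuous fun u => osc lam u x := by
  unfold osc; fun_prop

lemma hasFDerivAt_osc_right (lam : ℝ) (u x : ℝ × ℝ) :
    HasFDerivAt (fun x => osc lam u x)
      (pd (Complex.I * (2 / lam ^ 2) * (u.2 * osc lam u x))
        (-(Complex.I * (2 / lam ^ 2)) * (u.1 * osc lam u x))) x := by
  have h := (((hasFDerivAt_ofReal_fst x).pd_const_mul (Complex.I * (2 / lam ^ 2) * u.2)).pd_add
    ((hasFDerivAt_ofReal_snd x).pd_const_mul (-(Complex.I * (2 / lam ^ 2)) * u.1))).cexp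
  have e : (fun x : ℝ × ℝ => Complex.exp (Complex.I * (2 / lam ^ 2) * u.2 * x.1 +
      -(Complex.I * (2 / lam ^ 2)) * u.1 * x.2)) = fun x => osc lam u x := by
    ext x; rw [osc]; congr 1; push_cast; ring
  rw [e] at h
  refine h.congr_fderiv ?_
  rw [show Complex.exp (Complex.I * (2 / lam ^ 2) * u.2 * x.1 +
      -(Complex.I * (2 / lam ^ 2)) * u.1 * x.2) = osc lam u x from congrFun e x, smul_pd]
  congr 1 <;> ring

/-- The phase is antisymmetric, hence a reflection exchanges its arguments. -/
lemma osc_swap (lam : ℝ) (u x : ℝ × ℝ) : osc lam u (-x) = osc lam x u := by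
  rw [osc, osc]; congr 2; rw [Prod.fst_neg, Prod.snd_neg]; congr 1; ring

lemma osc_add_left (lam : ℝ) (u v x : ℝ × ℝ) : osc lam (u + v) x = osc lam u x * osc lam v x := by
  rw [osc, osc, osc, ← Complex.exp_add]; congr 1; simp; ring

lemma hasFDerivAt_osc_left (lam : ℝ) (u x : ℝ × ℝ) :
    HasFDerivAt (fun u => osc lam u x)
      (pd (-(Complex.I * (2 / lam ^ 2)) * (x.2 * osc lam u x))
        (Complex.I * (2 / lam ^ 2) * (x.1 * osc lam u x))) u := by
  have h := hasFDerivAt_osc_right lam (-x) u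
  have e : (fun u => osc lam (-x) u) = fun u => osc lam u x := by
    ext u; rw [← osc_swap, neg_neg]
  rw [e] at h
  refine h.pd_congr ?_ ?_ <;> rw [show osc lam (-x) u = osc lam u x from congrFun e u] <;> simp

lemma integrable_mul_osc {lam : ℝ} {g : ℝ × ℝ → ℂ} (hg : Integrable g) (x : ℝ × ℝ) :
    Integrable fun u => g u * osc lam u x :=
  hg.mul_bdd (c := 1) (continuous_osc_left lam x).aestronglyMeasurable
    (Eventually.of_forall fun u => (norm_osc lam u x).le)

/-- Integration by parts against the phase. -/
lemma integral_pd_mul_osc {lam : ℝ} {g g₁ g₂ : ℝ × ℝ → ℂ}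
    (hg : ∀ u, HasFDerivAt g (pd (g₁ u) (g₂ u)) u) (hi : Integrable g) (hi₁ : Integrable g₁)
    (hi₂ : Integrable g₂) (x : ℝ × ℝ) :
    ∫ u, g₁ u * osc lam u x = Complex.I * (2 / lam ^ 2) * (x.2 * ∫ u, g u * osc lam u x) ∧
    ∫ u, g₂ u * osc lam u x = -(Complex.I * (2 / lam ^ 2)) * (x.1 * ∫ u, g u * osc lam u x) := by
  have hd1 : ∀ u, fderiv ℝ g u (1, 0) = g₁ u := fun u => by rw [(hg u).fderiv]; simp
  have hd2 : ∀ u, fderiv ℝ g u (0, 1) = g₂ u := fun u => by rw [(hg u).fderiv]; simp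
  have ho1 : ∀ u, fderiv ℝ (fun u => osc lam u x) u (1, 0) =
      -(Complex.I * (2 / lam ^ 2)) * (x.2 * osc lam u x) := fun u => by
    rw [(hasFDerivAt_osc_left lam u x).fderiv]; simp
  have ho2 : ∀ u, fderiv ℝ (fun u => osc lam u x) u (0, 1) =
      Complex.I * (2 / lam ^ 2) * (x.1 * osc lam u x) := fun u => by
    rw [(hasFDerivAt_osc_left lam u x).fderiv]; simp
  have k := integrable_mul_osc (lam := lam) hi x
  constructor
  · have h := integral_mul_fderiv_eq_neg_fderiv_mul_of_integrable (μ := volume)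
      (f := g) (g := fun u => osc lam u x) (v := ((1, 0) : ℝ × ℝ))
      (by simp only [hd1]; exact integrable_mul_osc hi₁ x)
      (by
        simp only [ho1]
        refine (k.const_mul (-(Complex.I * (2 / lam ^ 2)) * x.2)).congr
          (Eventually.of_forall fun u => ?_)
        simp only; ring)
      k (fun u _ => (hg u).differentiableAt) fun u _ => (hasFDerivAt_osc_left lam u x).differentiableAt
    simp only [hd1, ho1] at h
    rw [eq_neg_iff_add_eq_zero, add_comm, ← eq_neg_iff_add_eq_zero] at h
    rw [h, ← integral_neg, ← integral_const_mul, ← integral_const_mul]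
    congr 1; ext u; ring
  · have h := integral_mul_fderiv_eq_neg_fderiv_mul_of_integrable (μ := volume)
      (f := g) (g := fun u => osc lam u x) (v := ((0, 1) : ℝ × ℝ))
      (by simp only [hd2]; exact integrable_mul_osc hi₂ x)
      (by
        simp only [ho2]
        refine (k.const_mul (Complex.I * (2 / lam ^ 2) * x.1)).congr
          (Eventually.of_forall fun u => ?_)
        simp only; ring)
      k (fun u _ => (hg u).differentiableAt) fun u _ => (hasFDerivAt_osc_left lam u x).differentiableAt
    simp only [hd2, ho2] at h
    rw [eq_neg_iff_add_eq_zero, add_comm, ← eq_neg_iff_add_eq_zero] at h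
    rw [h, ← integral_neg, ← integral_const_mul, ← integral_const_mul]
    congr 1; ext u; ring

/-! ### The symplectic Fourier transform -/

/-- The integral `∫ ψ(w) exp(-(2i/θ)(u₂ w₁ - u₁ w₂)) dw`. -/
def sftFun (lam : ℝ) (ψ : Sch) (u : ℝ × ℝ) : ℂ := ∫ w, ψ w * osc lam w u

lemma sch_integrable (ψ : Sch) : Integrable (ψ : ℝ × ℝ → ℂ) := ψ.integrable

lemma sftFun_D1 (lam : ℝ) (ψ : Sch) (u : ℝ × ℝ) :
    sftFun lam (D1 ψ) u = Complex.I * (2 / lam ^ 2) * (u.2 * sftFun lam ψ u) :=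
  (integral_pd_mul_osc (hasFDerivAt_sch ψ) (sch_integrable _) (sch_integrable (D1 ψ))
    (sch_integrable (D2 ψ)) u).1

lemma sftFun_D2 (lam : ℝ) (ψ : Sch) (u : ℝ × ℝ) :
    sftFun lam (D2 ψ) u = -(Complex.I * (2 / lam ^ 2)) * (u.1 * sftFun lam ψ u) :=
  (integral_pd_mul_osc (hasFDerivAt_sch ψ) (sch_integrable _) (sch_integrable (D1 ψ))
    (sch_integrable (D2 ψ)) u).2

lemma sftFun_smul (lam : ℝ) (c : ℂ) (ψ : Sch) (u : ℝ × ℝ) :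
    sftFun lam (c • ψ) u = c * sftFun lam ψ u := by
  rw [sftFun, sftFun, ← integral_const_mul]
  congr 1; ext w; rw [smul_apply, smul_eq_mul]; ring

lemma sftFun_add (lam : ℝ) (φ ψ : Sch) (u : ℝ × ℝ) :
    sftFun lam (φ + ψ) u = sftFun lam φ u + sftFun lam ψ u := by
  rw [sftFun, sftFun, sftFun, ← integral_add (integrable_mul_osc (sch_integrable φ) u)
    (integrable_mul_osc (sch_integrable ψ) u)]
  congr 1; ext w; rw [add_apply]; ring

lemma hasFDerivAt_sftFun (lam : ℝ) (ψ : Sch) (u : ℝ × ℝ) :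
    HasFDerivAt (sftFun lam ψ)
      (pd (sftFun lam ((Complex.I * (2 / lam ^ 2)) • X2 ψ) u)
        (sftFun lam ((-(Complex.I * (2 / lam ^ 2))) • X1 ψ) u)) u := by
  refine hasFDerivAt_integral_pd (bound := fun w =>
      ‖((Complex.I * (2 / lam ^ 2)) • X2 ψ) w‖ + ‖((-(Complex.I * (2 / lam ^ 2))) • X1 ψ) w‖)
    (F := fun u w => ψ w * osc lam w u)
    (a := fun u w => ((Complex.I * (2 / lam ^ 2)) • X2 ψ) w * osc lam w u)
    (b := fun u w => ((-(Complex.I * (2 / lam ^ 2))) • X1 ψ) w * osc lam w u)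
    univ_mem (fun u => ?_) (integrable_mul_osc (sch_integrable ψ) u) ?_ ?_ ?_ ?_ ?_
  · exact (integrable_mul_osc (sch_integrable ψ) u).aestronglyMeasurable
  · exact (integrable_mul_osc (sch_integrable _) u).aestronglyMeasurable
  · exact (integrable_mul_osc (sch_integrable _) u).aestronglyMeasurable
  · refine Eventually.of_forall fun w u _ => ?_
    rw [norm_mul, norm_mul, norm_osc, mul_one, mul_one]
  · exact (sch_integrable _).norm.add (sch_integrable _).norm
  · refine Eventually.of_forall fun w u _ => ?_
    refine ((hasFDerivAt_osc_right lam w u).pd_const_mul (ψ w)).pd_congr ?_ ?_ <;>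
    · rw [smul_apply, smul_eq_mul]; simp only [X1_apply, X2_apply]; ring

lemma exists_sch_sftFun {lam : ℝ} (hlam : lam ≠ 0) (ψ : Sch) :
    ∃ g : Sch, (g : ℝ × ℝ → ℂ) = sftFun lam ψ := by
  have hl : (lam : ℂ) ≠ 0 := by exact_mod_cast hlam
  have hmem : ∀ ψ, sftFun lam ψ ∈ Submodule.span ℂ (Set.range (sftFun lam)) :=
    fun ψ => Submodule.subset_span ⟨ψ, rfl⟩
  refine exists_sch_of_mem_span (S := Set.range (sftFun lam)) (N := 0) ?_ ?_ ?_ ?_ (hmem ψ)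
  · rintro _ ⟨ψ, rfl⟩
    exact ⟨_, hmem _, _, hmem _, hasFDerivAt_sftFun lam ψ⟩
  · rintro _ ⟨ψ, rfl⟩
    have : (fun x : ℝ × ℝ => (x.1 : ℂ) * sftFun lam ψ x) =
        (Complex.I * lam ^ 2 / 2) • sftFun lam (D2 ψ) := by
      ext u
      rw [Pi.smul_apply, sftFun_D2, smul_eq_mul]
      field_simp; rw [Complex.I_sq]; ring
    rw [this]; exact Submodule.smul_mem _ _ (hmem _)
  · rintro _ ⟨ψ, rfl⟩
    have : (fun x : ℝ × ℝ => (x.2 : ℂ) * sftFun lam ψ x) =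
        (-(Complex.I * lam ^ 2 / 2)) • sftFun lam (D1 ψ) := by
      ext u
      rw [Pi.smul_apply, sftFun_D1, smul_eq_mul]
      field_simp; rw [Complex.I_sq]; ring
    rw [this]; exact Submodule.smul_mem _ _ (hmem _)
  · rintro _ ⟨ψ, rfl⟩
    refine ⟨∫ w, ‖ψ w‖, fun u => ?_⟩
    rw [pow_zero, mul_one]
    refine (norm_integral_le_integral_norm _).trans_eq ?_
    congr 1; ext w; rw [norm_mul, norm_osc, mul_one]

/-- The symplectic Fourier transform of a Schwartz function. -/
def sft (lam : ℝ) (ψ : Sch) : Sch := toSch (sftFun lam ψ)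

section

variable {lam : ℝ} (hlam : lam ≠ 0)
include hlam

lemma sft_apply (ψ : Sch) (u : ℝ × ℝ) : sft lam ψ u = sftFun lam ψ u :=
  congrFun (coe_toSch (exists_sch_sftFun hlam ψ)) u

lemma sft_D1 (ψ : Sch) : sft lam (D1 ψ) = (Complex.I * (2 / lam ^ 2)) • X2 (sft lam ψ) := by
  ext u
  rw [sft_apply hlam, sftFun_D1, smul_apply, X2_apply, sft_apply hlam, smul_eq_mul]

lemma sft_D2 (ψ : Sch) : sft lam (D2 ψ) = (-(Complex.I * (2 / lam ^ 2))) • X1 (sft lam ψ) := by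
  ext u
  rw [sft_apply hlam, sftFun_D2, smul_apply, X1_apply, sft_apply hlam, smul_eq_mul]

lemma hasFDerivAt_sft (ψ : Sch) (u : ℝ × ℝ) :
    HasFDerivAt (sft lam ψ)
      (pd (sftFun lam ((Complex.I * (2 / lam ^ 2)) • X2 ψ) u)
        (sftFun lam ((-(Complex.I * (2 / lam ^ 2))) • X1 ψ) u)) u := by
  rw [show (sft lam ψ : ℝ × ℝ → ℂ) = sftFun lam ψ from coe_toSch (exists_sch_sftFun hlam ψ)]
  exact hasFDerivAt_sftFun lam ψ u

lemma D1_sft (ψ : Sch) : D1 (sft lam ψ) = sft lam ((Complex.I * (2 / lam ^ 2)) • X2 ψ) := by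
  ext u
  rw [D1_eq_of_hasFDerivAt (hasFDerivAt_sft hlam ψ u), sft_apply hlam]

lemma D2_sft (ψ : Sch) : D2 (sft lam ψ) = sft lam ((-(Complex.I * (2 / lam ^ 2))) • X1 ψ) := by
  ext u
  rw [D2_eq_of_hasFDerivAt (hasFDerivAt_sft hlam ψ u), sft_apply hlam]

lemma sft_smul (c : ℂ) (ψ : Sch) : sft lam (c • ψ) = c • sft lam ψ := by
  ext u
  rw [sft_apply hlam, sftFun_smul, smul_apply, sft_apply hlam, smul_eq_mul]

lemma sft_add (φ ψ : Sch) : sft lam (φ + ψ) = sft lam φ + sft lam ψ := by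
  ext u
  rw [sft_apply hlam, sftFun_add, add_apply, sft_apply hlam, sft_apply hlam]

end

/-! ### Functions of polynomial growth -/

/-- Continuous functions of polynomial growth. -/
def PolyGrowth (f : ℝ × ℝ → ℂ) : Prop :=
  Continuous f ∧ ∃ (N : ℕ) (C : ℝ), 0 ≤ C ∧ ∀ x, ‖f x‖ ≤ C * (1 + ‖x‖) ^ N

lemma polyGrowth_of_le {f : ℝ × ℝ → ℂ} (hf : Continuous f) {N : ℕ} {C : ℝ}
    (h : ∀ x, ‖f x‖ ≤ C * (1 + ‖x‖) ^ N) : PolyGrowth f := by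
  refine ⟨hf, N, C, ?_, h⟩
  simpa using (norm_nonneg _).trans (h 0)

lemma polyGrowth_of_temperate {f : ℝ × ℝ → ℂ} (hf : f.HasTemperateGrowth) : PolyGrowth f := by
  obtain ⟨N, C, h⟩ := hf.2 0
  exact polyGrowth_of_le hf.1.continuous (N := N) (C := C) fun x => by simpa using h x

lemma hasTemperateGrowth_fderiv {f : ℝ × ℝ → ℂ} (hf : f.HasTemperateGrowth) (v : ℝ × ℝ) :
    (fun x => fderiv ℝ f x v).HasTemperateGrowth := by
  have h : (fderiv ℝ f).HasTemperateGrowth := by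
    refine ⟨hf.1.fderiv_right (by simp), fun n => ?_⟩
    obtain ⟨k, C, h⟩ := hf.2 (n + 1)
    exact ⟨k, C, fun x => by rw [norm_iteratedFDeriv_fderiv]; exact h x⟩
  exact (ContinuousLinearMap.apply ℝ ℂ v).hasTemperateGrowth.comp h

lemma IsSymbol.fderiv {N : ℕ} {f : ℝ × ℝ → ℂ} (hf : IsSymbol N f) (v : ℝ × ℝ) :
    IsSymbol N (fun x => fderiv ℝ f x v) := by
  refine ⟨(hasTemperateGrowth_fderiv hf.hasTemperateGrowth v).1, fun n => ?_⟩
  obtain ⟨C, h⟩ := hf.2 (n + 1)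
  have hc : ContDiff ℝ ∞ (_root_.fderiv ℝ f) := hf.1.fderiv_right (by simp)
  refine ⟨‖ContinuousLinearMap.apply ℝ ℂ v‖ * C, fun x => ?_⟩
  have e := (ContinuousLinearMap.apply ℝ ℂ v).norm_iteratedFDeriv_comp_left (x := x)
    hc.contDiffAt (n := n) (by exact_mod_cast le_top)
  refine e.trans ?_
  rw [norm_iteratedFDeriv_fderiv, mul_assoc]
  exact mul_le_mul_of_nonneg_left (h x) (norm_nonneg _)

lemma IsSymbol.conj {N : ℕ} {f : ℝ × ℝ → ℂ} (hf : IsSymbol N f) :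
    IsSymbol N (fun x => conj (f x)) := by
  refine ⟨Complex.conjCLE.toContinuousLinearMap.contDiff.comp hf.1, fun n => ?_⟩
  obtain ⟨C, h⟩ := hf.2 n
  refine ⟨‖Complex.conjCLE.toContinuousLinearMap‖ * C, fun x => ?_⟩
  have e := Complex.conjCLE.toContinuousLinearMap.norm_iteratedFDeriv_comp_left (x := x)
    hf.1.contDiffAt (n := n) (by exact_mod_cast le_top)
  refine e.trans ?_
  rw [mul_assoc]
  exact mul_le_mul_of_nonneg_left (h x) (norm_nonneg _)

lemma integrable_one_add_norm_pow_mul (Φ : Sch) (N : ℕ) :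
    Integrable fun u => (1 + ‖u‖) ^ N * ‖Φ u‖ := by
  have h := ((Φ.integrable (μ := volume)).norm.add
    (Φ.integrable_pow_mul volume N)).const_mul (2 ^ N)
  refine h.mono' (Continuous.aestronglyMeasurable (by fun_prop))
    (Eventually.of_forall fun u => ?_)
  rw [Real.norm_of_nonneg (by positivity), Pi.add_apply]
  have : (1 + ‖u‖) ^ N ≤ 2 ^ N * (1 + ‖u‖ ^ N) := by
    rcases le_total ‖u‖ 1 with hu | hu
    · calc (1 + ‖u‖) ^ N ≤ 2 ^ N * 1 := by
            rw [mul_one]; gcongr; linarith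
        _ ≤ _ := by gcongr; linarith [pow_nonneg (norm_nonneg u) N]
    · calc (1 + ‖u‖) ^ N ≤ (2 * ‖u‖) ^ N := by gcongr; linarith
        _ = 2 ^ N * ‖u‖ ^ N := mul_pow _ _ _
        _ ≤ _ := by gcongr; linarith
  calc _ ≤ 2 ^ N * (1 + ‖u‖ ^ N) * ‖Φ u‖ := by gcongr
    _ = _ := by ring

lemma one_add_norm_add_pow_le (x u : ℝ × ℝ) (N : ℕ) :
    (1 + ‖x + u‖) ^ N ≤ (1 + ‖x‖) ^ N * (1 + ‖u‖) ^ N := by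
  rw [← mul_pow]
  gcongr
  nlinarith [norm_add_le x u, norm_nonneg x, norm_nonneg u]

/-- The twisted convolution `∫ f(x + u) Φ(u) exp((2i/θ)(u₂ x₁ - u₁ x₂)) du`. -/
def twist (lam : ℝ) (f : ℝ × ℝ → ℂ) (Φ : Sch) (x : ℝ × ℝ) : ℂ :=
  ∫ u, f (x + u) * Φ u * osc lam u x

lemma PolyGrowth.integrable_shift {f : ℝ × ℝ → ℂ} (hf : PolyGrowth f) (Φ : Sch) (x : ℝ × ℝ) :
    Integrable fun u => f (x + u) * Φ u := by
  obtain ⟨hc, N, C, hC, h⟩ := hf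
  refine ((integrable_one_add_norm_pow_mul Φ N).const_mul (C * (1 + ‖x‖) ^ N)).mono'
    (Continuous.aestronglyMeasurable (by fun_prop)) (Eventually.of_forall fun u => ?_)
  rw [norm_mul]
  calc _ ≤ C * ((1 + ‖x‖) ^ N * (1 + ‖u‖) ^ N) * ‖Φ u‖ := by
        gcongr; exact (h _).trans (mul_le_mul_of_nonneg_left (one_add_norm_add_pow_le x u N) hC)
    _ = _ := by ring

lemma PolyGrowth.integrable_twist {f : ℝ × ℝ → ℂ} (hf : PolyGrowth f) (lam : ℝ) (Φ : Sch)
    (x : ℝ × ℝ) : Integrable fun u => f (x + u) * Φ u * osc lam u x :=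
  integrable_mul_osc (hf.integrable_shift Φ x) x

lemma exists_norm_twist_le {f : ℝ × ℝ → ℂ} {N : ℕ} {C : ℝ} (hC : 0 ≤ C)
    (h : ∀ x, ‖f x‖ ≤ C * (1 + ‖x‖) ^ N) (lam : ℝ) (Φ : Sch) :
    ∃ C', ∀ x, ‖twist lam f Φ x‖ ≤ C' * (1 + ‖x‖) ^ N := by
  refine ⟨∫ u, C * ((1 + ‖u‖) ^ N * ‖Φ u‖), fun x => ?_⟩
  rw [← integral_mul_const]
  refine norm_integral_le_of_norm_le
    (((integrable_one_add_norm_pow_mul Φ N).const_mul C).mul_const _)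
    (Eventually.of_forall fun u => ?_)
  rw [norm_mul, norm_mul, norm_osc, mul_one]
  calc _ ≤ C * ((1 + ‖x‖) ^ N * (1 + ‖u‖) ^ N) * ‖Φ u‖ := by
        gcongr; exact (h _).trans (mul_le_mul_of_nonneg_left (one_add_norm_add_pow_le x u N) hC)
    _ = _ := by ring

lemma twist_add {f : ℝ × ℝ → ℂ} (hf : PolyGrowth f) (lam : ℝ) (Φ Ψ : Sch) (x : ℝ × ℝ) :
    twist lam f (Φ + Ψ) x = twist lam f Φ x + twist lam f Ψ x := by
  rw [twist, twist, twist, ← integral_add (hf.integrable_twist lam Φ x)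
    (hf.integrable_twist lam Ψ x)]
  congr 1; ext u; rw [add_apply]; ring

lemma twist_smul (lam : ℝ) (f : ℝ × ℝ → ℂ) (c : ℂ) (Φ : Sch) (x : ℝ × ℝ) :
    twist lam f (c • Φ) x = c * twist lam f Φ x := by
  rw [twist, twist, ← integral_const_mul]
  congr 1; ext u; rw [smul_apply, smul_eq_mul]; ring

lemma twist_add_left {f g : ℝ × ℝ → ℂ} (hf : PolyGrowth f) (hg : PolyGrowth g) (lam : ℝ) (Φ : Sch)
    (x : ℝ × ℝ) :
    twist lam (fun y => f y + g y) Φ x = twist lam f Φ x + twist lam g Φ x := by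
  rw [twist, twist, twist, ← integral_add (hf.integrable_twist lam Φ x)
    (hg.integrable_twist lam Φ x)]
  congr 1; ext u; ring

lemma twist_smul_left (lam : ℝ) (f : ℝ × ℝ → ℂ) (c : ℂ) (Φ : Sch) (x : ℝ × ℝ) :
    twist lam (fun y => c * f y) Φ x = c * twist lam f Φ x := by
  rw [twist, twist, ← integral_const_mul]
  congr 1; ext u; ring

lemma twist_fst_mul {f : ℝ × ℝ → ℂ} (hf : PolyGrowth f) (lam : ℝ) (Φ : Sch) (x : ℝ × ℝ) :
    twist lam (fun y => (y.1 : ℂ) * f y) Φ x = x.1 * twist lam f Φ x + twist lam f (X1 Φ) x := by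
  rw [twist, twist, twist, ← integral_const_mul,
    ← integral_add ((hf.integrable_twist lam Φ x).const_mul _) (hf.integrable_twist lam (X1 Φ) x)]
  congr 1; ext u; rw [X1_apply, Prod.fst_add]; push_cast; ring

lemma twist_snd_mul {f : ℝ × ℝ → ℂ} (hf : PolyGrowth f) (lam : ℝ) (Φ : Sch) (x : ℝ × ℝ) :
    twist lam (fun y => (y.2 : ℂ) * f y) Φ x = x.2 * twist lam f Φ x + twist lam f (X2 Φ) x := by
  rw [twist, twist, twist, ← integral_const_mul,
    ← integral_add ((hf.integrable_twist lam Φ x).const_mul _) (hf.integrable_twist lam (X2 Φ) x)]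
  congr 1; ext u; rw [X2_apply, Prod.snd_add]; push_cast; ring

/-- `∂₁ f` for a function on the plane. -/
def d1 (f : ℝ × ℝ → ℂ) (x : ℝ × ℝ) : ℂ := fderiv ℝ f x (1, 0)

/-- `∂₂ f` for a function on the plane. -/
def d2 (f : ℝ × ℝ → ℂ) (x : ℝ × ℝ) : ℂ := fderiv ℝ f x (0, 1)

lemma hasFDerivAt_temperate {f : ℝ × ℝ → ℂ} (hf : f.HasTemperateGrowth) (x : ℝ × ℝ) :
    HasFDerivAt f (pd (d1 f x) (d2 f x)) x := by
  have h := (hf.1.differentiable (by simp) x).hasFDerivAt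
  rwa [fderiv_eq_pd] at h

lemma hasFDerivAt_shift {f : ℝ × ℝ → ℂ} (hf : f.HasTemperateGrowth) (x u : ℝ × ℝ) :
    HasFDerivAt (fun x => f (x + u)) (pd (d1 f (x + u)) (d2 f (x + u))) x :=
  (hasFDerivAt_comp_add_right u).2 (hasFDerivAt_temperate hf (x + u))

/-- Multiplication of a twisted convolution by the coordinates, from integration by parts. -/
lemma twist_parts {f : ℝ × ℝ → ℂ} (hf : f.HasTemperateGrowth) (lam : ℝ) (Φ : Sch) (x : ℝ × ℝ) :
    twist lam (d1 f) Φ x + twist lam f (D1 Φ) x =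
      Complex.I * (2 / lam ^ 2) * (x.2 * twist lam f Φ x) ∧
    twist lam (d2 f) Φ x + twist lam f (D2 Φ) x =
      -(Complex.I * (2 / lam ^ 2)) * (x.1 * twist lam f Φ x) := by
  have p := polyGrowth_of_temperate hf
  have p1 : PolyGrowth (d1 f) := polyGrowth_of_temperate (hasTemperateGrowth_fderiv hf _)
  have p2 : PolyGrowth (d2 f) := polyGrowth_of_temperate (hasTemperateGrowth_fderiv hf _)
  have hg : ∀ u, HasFDerivAt (fun u => f (x + u) * Φ u)
      (pd (d1 f (x + u) * Φ u + f (x + u) * D1 Φ u) (d2 f (x + u) * Φ u + f (x + u) * D2 Φ u)) u :=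
    fun u => by
      have h := hasFDerivAt_shift hf u x
      simp only [add_comm _ x] at h
      exact h.pd_mul (hasFDerivAt_sch Φ u)
  obtain ⟨h1, h2⟩ := integral_pd_mul_osc (lam := lam) hg (p.integrable_shift Φ x)
    ((p1.integrable_shift Φ x).add (p.integrable_shift (D1 Φ) x))
    ((p2.integrable_shift Φ x).add (p.integrable_shift (D2 Φ) x)) x
  constructor
  · rw [twist, twist, twist, ← h1, ← integral_add (p1.integrable_twist lam Φ x)
      (p.integrable_twist lam (D1 Φ) x)]
    congr 1; ext u; ring
  · rw [twist, twist, twist, ← h2, ← integral_add (p2.integrable_twist lam Φ x)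
      (p.integrable_twist lam (D2 Φ) x)]
    congr 1; ext u; ring

lemma hasFDerivAt_twist {f : ℝ × ℝ → ℂ} (hf : f.HasTemperateGrowth) (lam : ℝ) (Φ : Sch)
    (x : ℝ × ℝ) :
    HasFDerivAt (twist lam f Φ)
      (pd (twist lam (d1 f) Φ x + Complex.I * (2 / lam ^ 2) * twist lam f (X2 Φ) x)
        (twist lam (d2 f) Φ x + -(Complex.I * (2 / lam ^ 2)) * twist lam f (X1 Φ) x)) x := by
  have p := polyGrowth_of_temperate hf
  have p1 : PolyGrowth (d1 f) := polyGrowth_of_temperate (hasTemperateGrowth_fderiv hf _)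
  have p2 : PolyGrowth (d2 f) := polyGrowth_of_temperate (hasTemperateGrowth_fderiv hf _)
  -- a bound for the integrands that is uniform in a neighbourhood of `x`
  have bd : ∀ {g : ℝ × ℝ → ℂ} (_ : PolyGrowth g) (Ξ : Sch), ∃ B : ℝ × ℝ → ℝ, Integrable B ∧
      ∀ u, ∀ y ∈ Metric.ball x 1, ‖g (y + u) * Ξ u‖ ≤ B u := by
    rintro g ⟨-, N, C, hC, h⟩ Ξ
    refine ⟨_, (integrable_one_add_norm_pow_mul Ξ N).const_mul (C * (2 + ‖x‖) ^ N),
      fun u y hy => ?_⟩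
    have hy' : ‖y‖ ≤ 1 + ‖x‖ := by
      have h1 : ‖y - x‖ < 1 := by simpa [dist_eq_norm] using hy
      have h2 : ‖y‖ ≤ ‖y - x‖ + ‖x‖ := by
        simpa using norm_add_le (y - x) x
      linarith
    rw [norm_mul]
    calc _ ≤ C * ((1 + ‖y‖) ^ N * (1 + ‖u‖) ^ N) * ‖Ξ u‖ := by
          gcongr; exact (h _).trans (mul_le_mul_of_nonneg_left (one_add_norm_add_pow_le y u N) hC)
      _ ≤ C * ((2 + ‖x‖) ^ N * (1 + ‖u‖) ^ N) * ‖Ξ u‖ := by gcongr ?_ * (?_ ^ _ * _) * _; linarith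
      _ = _ := by ring
  obtain ⟨B1, i1, b1⟩ := bd p1 Φ
  obtain ⟨B2, i2, b2⟩ := bd p2 Φ
  obtain ⟨B3, i3, b3⟩ := bd p (X1 Φ)
  obtain ⟨B4, i4, b4⟩ := bd p (X2 Φ)
  obtain ⟨c, hc⟩ : ∃ c : ℂ, c = Complex.I * (2 / lam ^ 2) := ⟨_, rfl⟩
  rw [← hc]
  have e1 : twist lam (d1 f) Φ x + c * twist lam f (X2 Φ) x =
      ∫ u, (d1 f (x + u) * Φ u * osc lam u x + c * (f (x + u) * X2 Φ u * osc lam u x)) := by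
    rw [integral_add (p1.integrable_twist lam Φ x) ((p.integrable_twist lam _ x).const_mul _),
      integral_const_mul]; rfl
  have e2 : twist lam (d2 f) Φ x + -c * twist lam f (X1 Φ) x =
      ∫ u, (d2 f (x + u) * Φ u * osc lam u x + -c * (f (x + u) * X1 Φ u * osc lam u x)) := by
    rw [integral_add (p2.integrable_twist lam Φ x) ((p.integrable_twist lam _ x).const_mul _),
      integral_const_mul]; rfl
  rw [e1, e2]
  refine hasFDerivAt_integral_pd
    (bound := fun u => (B1 u + ‖c‖ * B4 u) + (B2 u + ‖c‖ * B3 u))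
    (F := fun x u => f (x + u) * Φ u * osc lam u x)
    (a := fun x u => d1 f (x + u) * Φ u * osc lam u x + c * (f (x + u) * X2 Φ u * osc lam u x))
    (b := fun x u => d2 f (x + u) * Φ u * osc lam u x + -c * (f (x + u) * X1 Φ u * osc lam u x))
    (Metric.ball_mem_nhds x one_pos) (fun y => (p.integrable_twist lam Φ y).aestronglyMeasurable)
    (p.integrable_twist lam Φ x) ?_ ?_ ?_ ?_ ?_
  · exact ((p1.integrable_twist lam Φ x).add
      ((p.integrable_twist lam _ x).const_mul _)).aestronglyMeasurable
  · exact ((p2.integrable_twist lam Φ x).add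
      ((p.integrable_twist lam _ x).const_mul _)).aestronglyMeasurable
  · refine Eventually.of_forall fun u y hy => add_le_add ?_ ?_
    · refine (norm_add_le _ _).trans (add_le_add ?_ ?_)
      · rw [norm_mul, norm_osc, mul_one]; exact b1 u y hy
      · rw [norm_mul, norm_mul, norm_osc, mul_one]
        exact mul_le_mul_of_nonneg_left (b4 u y hy) (norm_nonneg _)
    · refine (norm_add_le _ _).trans (add_le_add ?_ ?_)
      · rw [norm_mul, norm_osc, mul_one]; exact b2 u y hy
      · rw [norm_mul, norm_mul, norm_osc, mul_one, norm_neg]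
        exact mul_le_mul_of_nonneg_left (b3 u y hy) (norm_nonneg _)
  · exact (i1.add (i4.const_mul _)).add (i2.add (i3.const_mul _))
  · refine Eventually.of_forall fun u y _ => ?_
    refine ((((hasFDerivAt_shift hf y u).pd_mul (hasFDerivAt_pd_const (Φ u) y)).pd_mul
      (hasFDerivAt_osc_right lam u y))).pd_congr ?_ ?_
    · rw [X2_apply, hc]; ring
    · rw [X1_apply, hc]; ring

/-! ### The Moyal product with a Schwartz function -/

/-- The normalization `(πθ)⁻²` of the Moyal product. -/
def mconst (lam : ℝ) : ℂ := ((1 / (Real.pi * lam ^ 2) ^ 2 : ℝ) : ℂ)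

/-- With the inner integral evaluated, the Moyal product is a twisted convolution with the
symplectic Fourier transform of the second factor. -/
lemma moyal_eq {lam : ℝ} (hlam : lam ≠ 0) (f : ℝ × ℝ → ℂ) (ψ : Sch) (x : ℝ × ℝ) :
    moyal lam f ψ x = mconst lam * twist lam f (sft lam ψ) x := by
  rw [moyal, twist, mconst]
  congr 2; ext u
  rw [mul_assoc]; congr 1
  -- substitute `w = x + v`
  have h := integral_add_left_eq_self (μ := (volume : Measure (ℝ × ℝ)))
    (fun w => ψ w * Complex.exp (-(2 * Complex.I / ((lam ^ 2 : ℝ) : ℂ)) *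
      ((u.2 * (w.1 - x.1) - u.1 * (w.2 - x.2) : ℝ) : ℂ))) x
  simp only [Prod.fst_add, Prod.snd_add, add_sub_cancel_left] at h
  rw [h, sft_apply hlam, sftFun, ← integral_mul_const]
  congr 1; ext w
  rw [osc, osc, mul_assoc, ← Complex.exp_add]
  congr 2; push_cast; ring

lemma hasTemperateGrowth_d1 {f : ℝ × ℝ → ℂ} (hf : f.HasTemperateGrowth) :
    (d1 f).HasTemperateGrowth := hasTemperateGrowth_fderiv hf _

lemma hasTemperateGrowth_d2 {f : ℝ × ℝ → ℂ} (hf : f.HasTemperateGrowth) :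
    (d2 f).HasTemperateGrowth := hasTemperateGrowth_fderiv hf _

section

variable {lam : ℝ} (hlam : lam ≠ 0)
include hlam

lemma moyal_add {f : ℝ × ℝ → ℂ} (hf : f.HasTemperateGrowth) (φ ψ : Sch) (x : ℝ × ℝ) :
    moyal lam f (φ + ψ : Sch) x = moyal lam f φ x + moyal lam f ψ x := by
  simp only [moyal_eq hlam]
  rw [sft_add hlam, twist_add (polyGrowth_of_temperate hf)]; ring

lemma moyal_smul (f : ℝ × ℝ → ℂ) (c : ℂ) (ψ : Sch) (x : ℝ × ℝ) :
    moyal lam f (c • ψ : Sch) x = c * moyal lam f ψ x := by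
  simp only [moyal_eq hlam]
  rw [sft_smul hlam, twist_smul]; ring

lemma moyal_add_left {f g : ℝ × ℝ → ℂ} (hf : f.HasTemperateGrowth) (hg : g.HasTemperateGrowth)
    (ψ : Sch) (x : ℝ × ℝ) :
    moyal lam (fun y => f y + g y) ψ x = moyal lam f ψ x + moyal lam g ψ x := by
  simp only [moyal_eq hlam]
  rw [twist_add_left (polyGrowth_of_temperate hf) (polyGrowth_of_temperate hg)]; ring

lemma moyal_smul_left (f : ℝ × ℝ → ℂ) (c : ℂ) (ψ : Sch) (x : ℝ × ℝ) :
    moyal lam (fun y => c * f y) ψ x = c * moyal lam f ψ x := by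
  simp only [moyal_eq hlam]
  rw [twist_smul_left]; ring

lemma X1_sft (ψ : Sch) : X1 (sft lam ψ) = (Complex.I * lam ^ 2 / 2) • sft lam (D2 ψ) := by
  have hl : (lam : ℂ) ≠ 0 := by exact_mod_cast hlam
  rw [sft_D2 hlam, smul_smul]
  have : Complex.I * lam ^ 2 / 2 * -(Complex.I * (2 / lam ^ 2)) = 1 := by
    field_simp; rw [Complex.I_sq]; ring
  rw [this, one_smul]

lemma X2_sft (ψ : Sch) : X2 (sft lam ψ) = (-(Complex.I * lam ^ 2 / 2)) • sft lam (D1 ψ) := by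
  have hl : (lam : ℂ) ≠ 0 := by exact_mod_cast hlam
  rw [sft_D1 hlam, smul_smul]
  have : -(Complex.I * lam ^ 2 / 2) * (Complex.I * (2 / lam ^ 2)) = 1 := by
    field_simp; rw [Complex.I_sq]; ring
  rw [this, one_smul]

/-- The Leibniz rule for the Moyal product. -/
lemma hasFDerivAt_moyal {f : ℝ × ℝ → ℂ} (hf : f.HasTemperateGrowth) (ψ : Sch) (x : ℝ × ℝ) :
    HasFDerivAt (moyal lam f ψ)
      (pd (moyal lam (d1 f) ψ x + moyal lam f (D1 ψ) x)
        (moyal lam (d2 f) ψ x + moyal lam f (D2 ψ) x)) x := by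
  have e : (moyal lam f ψ) = fun x => mconst lam * twist lam f (sft lam ψ) x :=
    funext (moyal_eq hlam f ψ)
  rw [e]
  refine ((hasFDerivAt_twist hf lam (sft lam ψ) x).pd_const_mul (mconst lam)).pd_congr ?_ ?_
  · rw [moyal_eq hlam, moyal_eq hlam, sft_D1 hlam, twist_smul]; ring
  · rw [moyal_eq hlam, moyal_eq hlam, sft_D2 hlam, twist_smul]; ring

lemma moyal_fst_mul {f : ℝ × ℝ → ℂ} (hf : f.HasTemperateGrowth) (ψ : Sch) (x : ℝ × ℝ) :
    moyal lam (fun y => (y.1 : ℂ) * f y) ψ x =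
      x.1 * moyal lam f ψ x + Complex.I * lam ^ 2 / 2 * moyal lam f (D2 ψ) x := by
  simp only [moyal_eq hlam]
  rw [twist_fst_mul (polyGrowth_of_temperate hf), X1_sft hlam, twist_smul]; ring

lemma moyal_snd_mul {f : ℝ × ℝ → ℂ} (hf : f.HasTemperateGrowth) (ψ : Sch) (x : ℝ × ℝ) :
    moyal lam (fun y => (y.2 : ℂ) * f y) ψ x =
      x.2 * moyal lam f ψ x - Complex.I * lam ^ 2 / 2 * moyal lam f (D1 ψ) x := by
  simp only [moyal_eq hlam]
  rw [twist_snd_mul (polyGrowth_of_temperate hf), X2_sft hlam, twist_smul]; ring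

/-- Multiplication by a coordinate passes through the Moyal product up to a derivative. -/
lemma fst_mul_moyal {f : ℝ × ℝ → ℂ} (hf : f.HasTemperateGrowth) (ψ : Sch) (x : ℝ × ℝ) :
    x.1 * moyal lam f ψ x =
      moyal lam f (X1 ψ) x + Complex.I * lam ^ 2 / 2 * moyal lam (d2 f) ψ x := by
  have hl : (lam : ℂ) ≠ 0 := by exact_mod_cast hlam
  have h := (twist_parts hf lam (sft lam ψ) x).2
  rw [D2_sft hlam, sft_smul hlam, twist_smul] at h
  have h' : twist lam (d2 f) (sft lam ψ) x = Complex.I * (2 / lam ^ 2) *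
      (twist lam f (sft lam (X1 ψ)) x - x.1 * twist lam f (sft lam ψ) x) := by
    linear_combination h
  simp only [moyal_eq hlam]
  rw [h']
  field_simp; rw [Complex.I_sq]; ring

lemma snd_mul_moyal {f : ℝ × ℝ → ℂ} (hf : f.HasTemperateGrowth) (ψ : Sch) (x : ℝ × ℝ) :
    x.2 * moyal lam f ψ x =
      moyal lam f (X2 ψ) x - Complex.I * lam ^ 2 / 2 * moyal lam (d1 f) ψ x := by
  have hl : (lam : ℂ) ≠ 0 := by exact_mod_cast hlam
  have h := (twist_parts hf lam (sft lam ψ) x).1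
  rw [D1_sft hlam, sft_smul hlam, twist_smul] at h
  have h' : twist lam (d1 f) (sft lam ψ) x = Complex.I * (2 / lam ^ 2) *
      (x.2 * twist lam f (sft lam ψ) x - twist lam f (sft lam (X2 ψ)) x) := by
    linear_combination h
  simp only [moyal_eq hlam]
  rw [h']
  field_simp; rw [Complex.I_sq]; ring

/-- The functions `f ⋆ ψ`, with `f` a symbol of a fixed order, form a family that is closed under
derivatives and multiplications by coordinates; hence they are Schwartz. -/
lemma exists_sch_moyal_of_isSymbol {N : ℕ} {f : ℝ × ℝ → ℂ} (hf : IsSymbol N f) (ψ : Sch) :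
    ∃ g : Sch, (g : ℝ × ℝ → ℂ) = moyal lam f ψ := by
  have hmem : ∀ {f : ℝ × ℝ → ℂ} (_ : IsSymbol N f) (ψ : Sch), moyal lam f ψ ∈
      Submodule.span ℂ {F : ℝ × ℝ → ℂ | ∃ f ψ, IsSymbol N f ∧ F = moyal lam f (ψ : Sch)} :=
    fun hf ψ => Submodule.subset_span ⟨_, ψ, hf, rfl⟩
  refine exists_sch_of_mem_span (N := N) ?_ ?_ ?_ ?_ (hmem hf ψ)
  · rintro _ ⟨f, ψ, hf, rfl⟩
    exact ⟨_, add_mem (hmem (hf.fderiv _) ψ) (hmem hf (D1 ψ)), _,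
      add_mem (hmem (hf.fderiv _) ψ) (hmem hf (D2 ψ)),
      hasFDerivAt_moyal hlam hf.hasTemperateGrowth ψ⟩
  · rintro _ ⟨f, ψ, hf, rfl⟩
    rw [funext (fst_mul_moyal hlam hf.hasTemperateGrowth ψ)]
    exact add_mem (hmem hf _) (Submodule.smul_mem _ _ (hmem (hf.fderiv _) _))
  · rintro _ ⟨f, ψ, hf, rfl⟩
    rw [funext (snd_mul_moyal hlam hf.hasTemperateGrowth ψ)]
    exact sub_mem (hmem hf _) (Submodule.smul_mem _ _ (hmem (hf.fderiv _) _))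
  · rintro _ ⟨f, ψ, hf, rfl⟩
    obtain ⟨-, h⟩ := hf
    obtain ⟨C, h⟩ := h 0
    have h' : ∀ x, ‖f x‖ ≤ |C| * (1 + ‖x‖) ^ N := fun x => by
      have := h x
      rw [norm_iteratedFDeriv_zero] at this
      exact this.trans (mul_le_mul_of_nonneg_right (le_abs_self C) (by positivity))
    obtain ⟨C', hC'⟩ := exists_norm_twist_le (abs_nonneg C) h' lam (sft lam ψ)
    refine ⟨‖mconst lam‖ * C', fun x => ?_⟩
    rw [moyal_eq hlam, norm_mul, mul_assoc]
    exact mul_le_mul_of_nonneg_left (hC' x) (norm_nonneg _)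

/-- A function all of whose derivatives are bounded by a fixed power is a multiplier. -/
theorem IsSymbol.isMultiplier {N : ℕ} {f : ℝ × ℝ → ℂ} (hf : IsSymbol N f) : IsMultiplier lam f :=
  ⟨hf.hasTemperateGrowth, exists_sch_moyal_of_isSymbol hlam hf,
    exists_sch_moyal_of_isSymbol hlam hf.conj⟩

end

/-! ### Multipliers -/

lemma IsMultiplier.conj {lam : ℝ} {f : ℝ × ℝ → ℂ} (hf : IsMultiplier lam f) :
    IsMultiplier lam fun x => conj (f x) := by
  refine ⟨Complex.conjCLE.toContinuousLinearMap.hasTemperateGrowth.comp hf.temperate, hf.right, ?_⟩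
  simpa only [Complex.conj_conj] using hf.left

namespace IsMultiplier

variable {lam : ℝ} {f g : ℝ × ℝ → ℂ}

lemma coe_leftMul (hf : IsMultiplier lam f) (ψ : Sch) :
    (leftMul lam f ψ : ℝ × ℝ → ℂ) = moyal lam f ψ := coe_toSch (hf.left ψ)

lemma leftMul_apply (hf : IsMultiplier lam f) (ψ : Sch) (x : ℝ × ℝ) :
    leftMul lam f ψ x = moyal lam f ψ x := congrFun (hf.coe_leftMul ψ) x

lemma leftMul_add (hf : IsMultiplier lam f) (hlam : lam ≠ 0) (φ ψ : Sch) :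
    leftMul lam f (φ + ψ) = leftMul lam f φ + leftMul lam f ψ := by
  ext x
  rw [add_apply, hf.leftMul_apply, hf.leftMul_apply, hf.leftMul_apply, moyal_add hlam hf.temperate]

lemma leftMul_smul (hf : IsMultiplier lam f) (hlam : lam ≠ 0) (c : ℂ) (ψ : Sch) :
    leftMul lam f (c • ψ) = c • leftMul lam f ψ := by
  ext x
  rw [smul_apply, hf.leftMul_apply, hf.leftMul_apply, moyal_smul hlam, smul_eq_mul]

lemma of_forall (hf : f.HasTemperateGrowth) (h1 : ∀ ψ : Sch, ∃ g : Sch, ∀ x, moyal lam f ψ x = g x)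
    (h2 : ∀ ψ : Sch, ∃ g : Sch, ∀ x, moyal lam (fun x => (starRingEnd ℂ) (f x)) ψ x = g x) :
    IsMultiplier lam f :=
  ⟨hf, fun ψ => (h1 ψ).imp fun _ h => (funext h).symm, fun ψ => (h2 ψ).imp fun _ h => (funext h).symm⟩

end IsMultiplier

section

variable {lam : ℝ} (hlam : lam ≠ 0) {f g : ℝ × ℝ → ℂ}

include hlam

lemma leftMul_add_left (hf : IsMultiplier lam f) (hg : IsMultiplier lam g)
    (h : IsMultiplier lam fun y => f y + g y) (ψ : Sch) :
    leftMul lam (fun y => f y + g y) ψ = leftMul lam f ψ + leftMul lam g ψ := by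
  ext x
  rw [add_apply, hf.leftMul_apply, hg.leftMul_apply, h.leftMul_apply,
    moyal_add_left hlam hf.temperate hg.temperate]

lemma leftMul_smul_left (hf : IsMultiplier lam f) (c : ℂ) (ψ : Sch) :
    leftMul lam (fun y => c * f y) ψ = c • leftMul lam f ψ := by
  have e : moyal lam (fun y => c * f y) ψ = (c • leftMul lam f ψ : Sch) := by
    ext x; rw [moyal_smul_left hlam, smul_apply, hf.leftMul_apply, smul_eq_mul]
  rw [leftMul, e, toSch_coe]

lemma IsMultiplier.add (hf : IsMultiplier lam f) (hg : IsMultiplier lam g) :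
    IsMultiplier lam fun y => f y + g y := by
  refine IsMultiplier.of_forall (hf.temperate.add hg.temperate)
    (fun ψ => ⟨leftMul lam f ψ + leftMul lam g ψ, fun x => ?_⟩) fun ψ =>
    ⟨leftMul lam (fun x => conj (f x)) ψ + leftMul lam (fun x => conj (g x)) ψ, fun x => ?_⟩
  · rw [moyal_add_left hlam hf.temperate hg.temperate, add_apply, hf.leftMul_apply,
      hg.leftMul_apply]
  · simp only [map_add]
    rw [moyal_add_left hlam hf.conj.temperate hg.conj.temperate, add_apply, hf.conj.leftMul_apply,
      hg.conj.leftMul_apply]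

lemma IsMultiplier.const_mul (hf : IsMultiplier lam f) (c : ℂ) :
    IsMultiplier lam fun y => c * f y := by
  refine IsMultiplier.of_forall
    ((Function.HasTemperateGrowth.const c).mul hf.temperate)
    (fun ψ => ⟨c • leftMul lam f ψ, fun x => ?_⟩) fun ψ =>
    ⟨(conj c) • leftMul lam (fun x => conj (f x)) ψ, fun x => ?_⟩
  · rw [moyal_smul_left hlam, smul_apply, hf.leftMul_apply, smul_eq_mul]
  · simp only [map_mul]
    rw [moyal_smul_left hlam, smul_apply, hf.conj.leftMul_apply, smul_eq_mul]

omit hlam in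
lemma conj_d1 (hf : f.HasTemperateGrowth) (x : ℝ × ℝ) :
    conj (d1 f x) = d1 (fun x => conj (f x)) x := by
  have h := (hasFDerivAt_temperate hf x).pd_conj
  rw [d1, d1, h.fderiv]; simp [d1]

omit hlam in
lemma conj_d2 (hf : f.HasTemperateGrowth) (x : ℝ × ℝ) :
    conj (d2 f x) = d2 (fun x => conj (f x)) x := by
  have h := (hasFDerivAt_temperate hf x).pd_conj
  rw [d2, d2, h.fderiv]; simp [d2]

lemma leftMul_d2_aux (hf : IsMultiplier lam f) (ψ : Sch) (x : ℝ × ℝ) : moyal lam (d2 f) ψ x =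
    ((-(Complex.I * (2 / lam ^ 2))) • (X1 (leftMul lam f ψ) - leftMul lam f (X1 ψ)) : Sch) x := by
  have hl : (lam : ℂ) ≠ 0 := by exact_mod_cast hlam
  have h := fst_mul_moyal hlam hf.temperate ψ x
  rw [smul_apply, sub_apply, X1_apply, hf.leftMul_apply, hf.leftMul_apply, h, smul_eq_mul]
  field_simp; ring_nf; rw [Complex.I_sq]; ring

lemma leftMul_d1_aux (hf : IsMultiplier lam f) (ψ : Sch) (x : ℝ × ℝ) : moyal lam (d1 f) ψ x =
    ((Complex.I * (2 / lam ^ 2)) • (X2 (leftMul lam f ψ) - leftMul lam f (X2 ψ)) : Sch) x := by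
  have hl : (lam : ℂ) ≠ 0 := by exact_mod_cast hlam
  have h := snd_mul_moyal hlam hf.temperate ψ x
  rw [smul_apply, sub_apply, X2_apply, hf.leftMul_apply, hf.leftMul_apply, h, smul_eq_mul]
  field_simp; ring_nf; rw [Complex.I_sq]; ring

lemma IsMultiplier.d1 (hf : IsMultiplier lam f) : IsMultiplier lam (d1 f) := by
  refine IsMultiplier.of_forall (hasTemperateGrowth_d1 hf.temperate)
    (fun ψ => ⟨_, leftMul_d1_aux hlam hf ψ⟩) fun ψ => ?_
  rw [funext (conj_d1 hf.temperate)]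
  exact ⟨_, leftMul_d1_aux hlam hf.conj ψ⟩

lemma IsMultiplier.d2 (hf : IsMultiplier lam f) : IsMultiplier lam (d2 f) := by
  refine IsMultiplier.of_forall (hasTemperateGrowth_d2 hf.temperate)
    (fun ψ => ⟨_, leftMul_d2_aux hlam hf ψ⟩) fun ψ => ?_
  rw [funext (conj_d2 hf.temperate)]
  exact ⟨_, leftMul_d2_aux hlam hf.conj ψ⟩

omit hlam in
lemma moyal_fst_mul_aux (hlam : lam ≠ 0) (hf : IsMultiplier lam f) (ψ : Sch) (x : ℝ × ℝ) :
    moyal lam (fun y => (y.1 : ℂ) * f y) ψ x =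
    (X1 (leftMul lam f ψ) + (Complex.I * lam ^ 2 / 2) • leftMul lam f (D2 ψ) : Sch) x := by
  rw [moyal_fst_mul hlam hf.temperate, add_apply, smul_apply, X1_apply, hf.leftMul_apply,
    hf.leftMul_apply, smul_eq_mul]

lemma moyal_snd_mul_aux (hf : IsMultiplier lam f) (ψ : Sch) (x : ℝ × ℝ) :
    moyal lam (fun y => (y.2 : ℂ) * f y) ψ x =
    (X2 (leftMul lam f ψ) - (Complex.I * lam ^ 2 / 2) • leftMul lam f (D1 ψ) : Sch) x := by
  rw [moyal_snd_mul hlam hf.temperate, sub_apply, smul_apply, X2_apply, hf.leftMul_apply,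
    hf.leftMul_apply, smul_eq_mul]

lemma IsMultiplier.fst_mul (hf : IsMultiplier lam f) :
    IsMultiplier lam fun y => (y.1 : ℂ) * f y := by
  refine IsMultiplier.of_forall (hasTemperateGrowth_ofReal_fst.mul hf.temperate)
    (fun ψ => ⟨_, moyal_fst_mul_aux hlam hf ψ⟩) fun ψ => ?_
  simp only [map_mul, Complex.conj_ofReal]
  exact ⟨_, moyal_fst_mul_aux hlam hf.conj ψ⟩

lemma IsMultiplier.snd_mul (hf : IsMultiplier lam f) :
    IsMultiplier lam fun y => (y.2 : ℂ) * f y := by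
  refine IsMultiplier.of_forall (hasTemperateGrowth_ofReal_snd.mul hf.temperate)
    (fun ψ => ⟨_, moyal_snd_mul_aux hlam hf ψ⟩) fun ψ => ?_
  simp only [map_mul, Complex.conj_ofReal]
  exact ⟨_, moyal_snd_mul_aux hlam hf.conj ψ⟩

lemma leftMul_fst_mul (hf : IsMultiplier lam f) (ψ : Sch) :
    leftMul lam (fun y => (y.1 : ℂ) * f y) ψ =
      X1 (leftMul lam f ψ) + (Complex.I * lam ^ 2 / 2) • leftMul lam f (D2 ψ) := by
  ext x
  rw [(hf.fst_mul hlam).leftMul_apply, moyal_fst_mul_aux hlam hf]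

lemma leftMul_snd_mul (hf : IsMultiplier lam f) (ψ : Sch) :
    leftMul lam (fun y => (y.2 : ℂ) * f y) ψ =
      X2 (leftMul lam f ψ) - (Complex.I * lam ^ 2 / 2) • leftMul lam f (D1 ψ) := by
  ext x
  rw [(hf.snd_mul hlam).leftMul_apply, moyal_snd_mul_aux hlam hf]

/-- The commutator of a left multiplication with a first order operator. -/
lemma lin_leftMul (hf : IsMultiplier lam f) (a b c d : ℂ) (ψ : Sch) :
    lin a b c d (leftMul lam f ψ) = leftMul lam f (lin a b c d ψ) +
      ((c - Complex.I * lam ^ 2 / 2 * b) • leftMul lam (d1 f) ψ +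
        (d + Complex.I * lam ^ 2 / 2 * a) • leftMul lam (d2 f) ψ) := by
  have h1 : D1 (leftMul lam f ψ) = leftMul lam (d1 f) ψ + leftMul lam f (D1 ψ) := by
    ext x
    have h : HasFDerivAt (leftMul lam f ψ) _ x :=
      (hf.coe_leftMul ψ).symm ▸ hasFDerivAt_moyal hlam hf.temperate ψ x
    rw [D1_eq_of_hasFDerivAt h, add_apply, (hf.d1 hlam).leftMul_apply, hf.leftMul_apply]
  have h2 : D2 (leftMul lam f ψ) = leftMul lam (d2 f) ψ + leftMul lam f (D2 ψ) := by
    ext x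
    have h : HasFDerivAt (leftMul lam f ψ) _ x :=
      (hf.coe_leftMul ψ).symm ▸ hasFDerivAt_moyal hlam hf.temperate ψ x
    rw [D2_eq_of_hasFDerivAt h, add_apply, (hf.d2 hlam).leftMul_apply, hf.leftMul_apply]
  have h3 : X1 (leftMul lam f ψ) = leftMul lam f (X1 ψ) +
      (Complex.I * lam ^ 2 / 2) • leftMul lam (d2 f) ψ := by
    ext x
    rw [X1_apply, add_apply, smul_apply, (hf.d2 hlam).leftMul_apply, hf.leftMul_apply,
      hf.leftMul_apply, fst_mul_moyal hlam hf.temperate, smul_eq_mul]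
  have h4 : X2 (leftMul lam f ψ) = leftMul lam f (X2 ψ) -
      (Complex.I * lam ^ 2 / 2) • leftMul lam (d1 f) ψ := by
    ext x
    rw [X2_apply, sub_apply, smul_apply, (hf.d1 hlam).leftMul_apply, hf.leftMul_apply,
      hf.leftMul_apply, snd_mul_moyal hlam hf.temperate, smul_eq_mul]
  rw [lin_apply, lin_apply, h1, h2, h3, h4]
  simp only [hf.leftMul_add hlam, hf.leftMul_smul hlam]
  module

end

/-! ### The adjoint of a left multiplication -/

/-- Exchange of the integrations in a matrix element of a left multiplication: the symbol is
integrated last. -/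
lemma integral_mul_twist {f : ℝ × ℝ → ℂ} (hf : PolyGrowth f) (lam : ℝ) (g Φ : Sch) :
    ∫ x, g x * twist lam f Φ x = ∫ y, f y * ∫ x, g x * (Φ (y - x) * osc lam y x) := by
  have e : ∀ x, g x * twist lam f Φ x = ∫ y, g x * (f y * Φ (y - x) * osc lam y x) := by
    intro x
    rw [twist, ← integral_const_mul,
      ← integral_add_left_eq_self (μ := (volume : Measure (ℝ × ℝ)))
        (fun y => g x * (f y * Φ (y - x) * osc lam y x)) x]
    congr 1; ext u
    rw [add_sub_cancel_left, add_comm x u, osc_add_left, show osc lam x x = 1 by simp [osc, mul_comm],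
      mul_one]
  simp only [e]
  obtain ⟨hc, N, C, hC, h⟩ := hf
  have hi : Integrable (Function.uncurry fun x y : ℝ × ℝ => g x * (f y * Φ (y - x) * osc lam y x))
      (volume.prod volume) := by
    have h1 := ((integrable_one_add_norm_pow_mul g N).convolution_integrand
      (ContinuousLinearMap.mul ℝ ℝ) ((integrable_one_add_norm_pow_mul Φ N).const_mul C)).swap
    refine h1.mono' (Continuous.aestronglyMeasurable ?_) (Eventually.of_forall fun p => ?_)
    · have := continuous_osc lam
      have h2 : Continuous fun p : (ℝ × ℝ) × (ℝ × ℝ) => osc lam p.2 p.1 :=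
        this.comp continuous_swap
      change Continuous fun p : (ℝ × ℝ) × (ℝ × ℝ) => g p.1 * (f p.2 * Φ (p.2 - p.1) * osc lam p.2 p.1)
      fun_prop
    · obtain ⟨x, y⟩ := p
      simp only [Function.uncurry_apply_pair, norm_mul, norm_osc, mul_one, Function.comp_apply,
        Prod.swap_prod_mk, ContinuousLinearMap.mul_apply']
      have h3 := one_add_norm_add_pow_le x (y - x) N
      rw [add_sub_cancel] at h3
      calc _ ≤ ‖g x‖ * (C * ((1 + ‖x‖) ^ N * (1 + ‖y - x‖) ^ N) * ‖Φ (y - x)‖) := by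
            gcongr; exact (h y).trans (mul_le_mul_of_nonneg_left h3 hC)
        _ = _ := by ring
  rw [integral_integral_swap hi]
  congr 1; ext y
  rw [← integral_const_mul]
  congr 1; ext x; ring

/-- The kernel that appears in both sides of the adjunction. -/
lemma integral_conj_sft_swap {lam : ℝ} (hlam : lam ≠ 0) (φ ψ : Sch) (y : ℝ × ℝ) :
    ∫ x, conjS φ x * (sft lam ψ (y - x) * osc lam y x) =
      ∫ w, ψ w * (conj (sft lam φ (y - w)) * osc lam w y) := by
  have e1 : ∀ x, conjS φ x * (sft lam ψ (y - x) * osc lam y x) =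
      ∫ w, conjS φ x * ψ w * (osc lam w y * osc lam x w * osc lam y x) := by
    intro x
    rw [sft_apply hlam, sftFun, ← integral_mul_const, ← integral_const_mul]
    congr 1; ext w
    have : osc lam w (y - x) = osc lam w y * osc lam x w := by
      rw [osc, osc, osc, ← Complex.exp_add]; congr 1; simp; ring
    rw [this]; ring
  have e2 : ∀ w, ψ w * (conj (sft lam φ (y - w)) * osc lam w y) =
      ∫ x, conjS φ x * ψ w * (osc lam w y * osc lam x w * osc lam y x) := by
    intro w
    rw [sft_apply hlam, sftFun, ← integral_conj, ← integral_mul_const, ← integral_const_mul]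
    congr 1; ext x
    have : conj (osc lam x (y - w)) = osc lam x w * osc lam y x := by
      rw [osc, osc, osc, ← Complex.exp_add, ← Complex.exp_conj]; congr 1; simp [map_ofNat]; ring
    rw [map_mul, this, conjS_apply]; ring
  simp only [e1, e2]
  refine integral_integral_swap ?_
  refine ((sch_integrable (conjS φ)).mul_prod (sch_integrable ψ)).mul_bdd (c := 1)
    (Continuous.aestronglyMeasurable ?_) (Eventually.of_forall fun p => ?_)
  · unfold osc; fun_prop
  · rw [norm_mul, norm_mul, norm_osc, norm_osc, norm_osc]; norm_num

/-- The adjoint of the left multiplication by `f` is the left multiplication by its conjugate. -/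
theorem inner_leftMul {lam : ℝ} (hlam : lam ≠ 0) {f : ℝ × ℝ → ℂ} (hf : IsMultiplier lam f)
    (φ ψ : Sch) :
    ⟪emb φ, emb (leftMul lam f ψ)⟫_ℂ = ⟪emb (leftMul lam (fun x => conj (f x)) φ), emb ψ⟫_ℂ := by
  have hm : conj (mconst lam) = mconst lam := by rw [mconst, Complex.conj_ofReal]
  have e1 : ∫ x, conj (φ x) * leftMul lam f ψ x =
      mconst lam * ∫ x, conjS φ x * twist lam f (sft lam ψ) x := by
    rw [← integral_const_mul]
    congr 1; ext x
    rw [hf.leftMul_apply, moyal_eq hlam, conjS_apply]; ring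
  have e2 : ∫ x, conj (leftMul lam (fun x => conj (f x)) φ x) * ψ x = mconst lam *
      conj (∫ x, conjS ψ x * twist lam (fun x => conj (f x)) (sft lam φ) x) := by
    rw [← integral_conj, ← integral_const_mul]
    congr 1; ext x
    rw [hf.conj.leftMul_apply, moyal_eq hlam, conjS_apply, map_mul, map_mul, hm, Complex.conj_conj]
    ring
  rw [inner_emb, inner_emb, e1, e2, integral_mul_twist (polyGrowth_of_temperate hf.temperate),
    integral_mul_twist (polyGrowth_of_temperate hf.conj.temperate), ← integral_conj]
  congr 2; ext y
  rw [map_mul, Complex.conj_conj, integral_conj_sft_swap hlam, ← integral_conj]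
  congr 2; ext w
  have : conj (osc lam y w) = osc lam w y := by
    rw [osc, osc, ← Complex.exp_conj]; congr 1; simp [map_ofNat]; ring
  rw [map_mul, map_mul, this, conjS_apply, Complex.conj_conj]

/-! ### The ladder operators and left multiplications -/

/-- `∂_{z̄} f = (∂₁ f + i ∂₂ f) / √2`. -/
def dzb (f : ℝ × ℝ → ℂ) (x : ℝ × ℝ) : ℂ :=
  (fderiv ℝ f x (1, 0) + Complex.I * fderiv ℝ f x (0, 1)) / ((Real.sqrt 2 : ℝ) : ℂ)

lemma dz_eq (f : ℝ × ℝ → ℂ) :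
    dz f = fun x => (1 / (Real.sqrt 2 : ℂ)) * (d1 f x + -Complex.I * d2 f x) := by
  ext x; rw [dz, d1, d2]; ring

lemma dzb_eq (f : ℝ × ℝ → ℂ) :
    dzb f = fun x => (1 / (Real.sqrt 2 : ℂ)) * (d1 f x + Complex.I * d2 f x) := by
  ext x; rw [dzb, d1, d2]; ring

lemma ofReal_sqrt_two_ne_zero : (Real.sqrt 2 : ℂ) ≠ 0 := by
  exact_mod_cast (Real.sqrt_pos.2 two_pos).ne'

lemma dzb_conj {f : ℝ × ℝ → ℂ} (hf : f.HasTemperateGrowth) :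
    dzb (fun x => conj (f x)) = fun x => conj (dz f x) := by
  ext x
  simp only [dzb_eq, dz_eq, map_mul, map_add, conj_d1 hf, conj_d2 hf, map_div₀, map_one, map_neg,
    Complex.conj_I, neg_neg, Complex.conj_ofReal]

lemma dz_conj {f : ℝ × ℝ → ℂ} (hf : f.HasTemperateGrowth) :
    dz (fun x => conj (f x)) = fun x => conj (dzb f x) := by
  ext x
  simp only [dzb_eq, dz_eq, map_mul, map_add, conj_d1 hf, conj_d2 hf, map_div₀, map_one,
    Complex.conj_I, Complex.conj_ofReal]

section

variable {lam : ℝ} {f : ℝ × ℝ → ℂ}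

lemma IsMultiplier.dz (hlam : lam ≠ 0) (hf : IsMultiplier lam f) : IsMultiplier lam (dz f) := by
  rw [dz_eq]
  exact ((hf.d1 hlam).add hlam ((hf.d2 hlam).const_mul hlam _)).const_mul hlam _

lemma IsMultiplier.dzb (hlam : lam ≠ 0) (hf : IsMultiplier lam f) : IsMultiplier lam (dzb f) := by
  rw [dzb_eq]
  exact ((hf.d1 hlam).add hlam ((hf.d2 hlam).const_mul hlam _)).const_mul hlam _

lemma leftMul_dz (hlam : lam ≠ 0) (hf : IsMultiplier lam f) (ψ : Sch) : leftMul lam (dz f) ψ =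
    (1 / (Real.sqrt 2 : ℂ)) • (leftMul lam (d1 f) ψ - Complex.I • leftMul lam (d2 f) ψ) := by
  have h := (hf.d2 hlam).const_mul hlam (-Complex.I)
  rw [dz_eq, leftMul_smul_left hlam ((hf.d1 hlam).add hlam h),
    leftMul_add_left hlam (hf.d1 hlam) h ((hf.d1 hlam).add hlam h),
    leftMul_smul_left hlam (hf.d2 hlam)]
  module

lemma leftMul_dzb (hlam : lam ≠ 0) (hf : IsMultiplier lam f) (ψ : Sch) : leftMul lam (dzb f) ψ =
    (1 / (Real.sqrt 2 : ℂ)) • (leftMul lam (d1 f) ψ + Complex.I • leftMul lam (d2 f) ψ) := by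
  have h := (hf.d2 hlam).const_mul hlam Complex.I
  rw [dzb_eq, leftMul_smul_left hlam ((hf.d1 hlam).add hlam h),
    leftMul_add_left hlam (hf.d1 hlam) h ((hf.d1 hlam).add hlam h),
    leftMul_smul_left hlam (hf.d2 hlam)]

lemma z_mul_eq (f : ℝ × ℝ → ℂ) : (fun x => z x * f x) =
    fun x => (1 / (Real.sqrt 2 : ℂ)) * (x.1 * f x + Complex.I * (x.2 * f x)) := by
  ext x; rw [z]; ring

lemma zbar_mul_eq (f : ℝ × ℝ → ℂ) : (fun x => zbar x * f x) =
    fun x => (1 / (Real.sqrt 2 : ℂ)) * (x.1 * f x + -Complex.I * (x.2 * f x)) := by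
  ext x
  rw [zbar, z, map_div₀, map_add, map_mul, Complex.conj_I, Complex.conj_ofReal,
    Complex.conj_ofReal, Complex.conj_ofReal]
  ring

lemma IsMultiplier.z_mul (hlam : lam ≠ 0) (hf : IsMultiplier lam f) :
    IsMultiplier lam fun x => z x * f x := by
  rw [z_mul_eq]
  exact ((hf.fst_mul hlam).add hlam ((hf.snd_mul hlam).const_mul hlam _)).const_mul hlam _

lemma IsMultiplier.zbar_mul (hlam : lam ≠ 0) (hf : IsMultiplier lam f) :
    IsMultiplier lam fun x => zbar x * f x := by
  rw [zbar_mul_eq]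
  exact ((hf.fst_mul hlam).add hlam ((hf.snd_mul hlam).const_mul hlam _)).const_mul hlam _

end

section

variable {lam : ℝ} (hlam : 0 < lam) {f : ℝ × ℝ → ℂ}
include hlam

lemma A_leftMul (hf : IsMultiplier lam f) (ψ : Sch) :
    (moyalLadder lam hlam).A (leftMul lam f ψ) =
      leftMul lam f ((moyalLadder lam hlam).A ψ) + (lam : ℂ) • leftMul lam (dzb f) ψ := by
  have h0 : (lam : ℂ) ≠ 0 := by exact_mod_cast hlam.ne'
  have h3 := ofReal_sqrt_two_ne_zero
  refine (lin_leftMul hlam.ne' hf _ _ _ _ ψ).trans ?_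
  rw [leftMul_dzb hlam.ne' hf]
  congr 1
  match_scalars <;> (field_simp; ring_nf; try rw [Complex.I_sq]; try ring)

lemma As_leftMul (hf : IsMultiplier lam f) (ψ : Sch) :
    (moyalLadder lam hlam).As (leftMul lam f ψ) =
      leftMul lam f ((moyalLadder lam hlam).As ψ) - (lam : ℂ) • leftMul lam (dz f) ψ := by
  have h0 : (lam : ℂ) ≠ 0 := by exact_mod_cast hlam.ne'
  have h3 := ofReal_sqrt_two_ne_zero
  refine (lin_leftMul hlam.ne' hf _ _ _ _ ψ).trans ?_
  rw [leftMul_dz hlam.ne' hf, sub_eq_add_neg (leftMul lam f _)]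
  congr 1
  match_scalars <;> (field_simp; ring_nf; try rw [Complex.I_sq]; try ring)

lemma C_leftMul (hf : IsMultiplier lam f) (ψ : Sch) :
    (moyalLadder lam hlam).C (leftMul lam f ψ) = leftMul lam f ((moyalLadder lam hlam).C ψ) := by
  have h0 : (lam : ℂ) ≠ 0 := by exact_mod_cast hlam.ne'
  have h3 := ofReal_sqrt_two_ne_zero
  refine (lin_leftMul hlam.ne' hf _ _ _ _ ψ).trans (add_eq_left.2 ?_)
  match_scalars <;> (field_simp; ring_nf; try rw [Complex.I_sq]; try ring)

lemma Cs_leftMul (hf : IsMultiplier lam f) (ψ : Sch) :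
    (moyalLadder lam hlam).Cs (leftMul lam f ψ) = leftMul lam f ((moyalLadder lam hlam).Cs ψ) := by
  have h0 : (lam : ℂ) ≠ 0 := by exact_mod_cast hlam.ne'
  have h3 := ofReal_sqrt_two_ne_zero
  refine (lin_leftMul hlam.ne' hf _ _ _ _ ψ).trans (add_eq_left.2 ?_)
  match_scalars <;> (field_simp; ring_nf; try rw [Complex.I_sq]; try ring)

/-- The Moyal anticommutator with `z` is twice the multiplication of symbols by `z`. -/
lemma leftMul_z_mul (hf : IsMultiplier lam f) (ψ : Sch) : leftMul lam (fun x => z x * f x) ψ =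
    (lam / 2 : ℂ) • ((moyalLadder lam hlam).A (leftMul lam f ψ) +
      leftMul lam f ((moyalLadder lam hlam).A ψ)) := by
  have h0 : (lam : ℂ) ≠ 0 := by exact_mod_cast hlam.ne'
  have h3 := ofReal_sqrt_two_ne_zero
  have h1 := (hf.fst_mul hlam.ne')
  have h2 := (hf.snd_mul hlam.ne').const_mul hlam.ne' Complex.I
  rw [z_mul_eq, leftMul_smul_left hlam.ne' (h1.add hlam.ne' h2),
    leftMul_add_left hlam.ne' h1 h2 (h1.add hlam.ne' h2),
    leftMul_smul_left hlam.ne' (hf.snd_mul hlam.ne'), leftMul_fst_mul hlam.ne' hf,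
    leftMul_snd_mul hlam.ne' hf]
  have hC := Cs_leftMul hlam hf ψ
  rw [← sub_eq_zero] at hC
  rw [← add_zero ((moyalLadder lam hlam).A (leftMul lam f ψ) + _), ← hC]
  simp only [moyalLadder, lin_apply, hf.leftMul_add hlam.ne', hf.leftMul_smul hlam.ne']
  match_scalars <;> (field_simp; ring_nf; try rw [Complex.I_sq]; try ring)

/-- The Moyal anticommutator with `z̄` is twice the multiplication of symbols by `z̄`. -/
lemma leftMul_zbar_mul (hf : IsMultiplier lam f) (ψ : Sch) :
    leftMul lam (fun x => zbar x * f x) ψ =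
    (lam / 2 : ℂ) • ((moyalLadder lam hlam).As (leftMul lam f ψ) +
      leftMul lam f ((moyalLadder lam hlam).As ψ)) := by
  have h0 : (lam : ℂ) ≠ 0 := by exact_mod_cast hlam.ne'
  have h3 := ofReal_sqrt_two_ne_zero
  have h1 := (hf.fst_mul hlam.ne')
  have h2 := (hf.snd_mul hlam.ne').const_mul hlam.ne' (-Complex.I)
  rw [zbar_mul_eq, leftMul_smul_left hlam.ne' (h1.add hlam.ne' h2),
    leftMul_add_left hlam.ne' h1 h2 (h1.add hlam.ne' h2),
    leftMul_smul_left hlam.ne' (hf.snd_mul hlam.ne'), leftMul_fst_mul hlam.ne' hf,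
    leftMul_snd_mul hlam.ne' hf]
  have hC := C_leftMul hlam hf ψ
  rw [← sub_eq_zero] at hC
  rw [← add_zero ((moyalLadder lam hlam).As (leftMul lam f ψ) + _), ← hC]
  simp only [moyalLadder, lin_apply, hf.leftMul_add hlam.ne', hf.leftMul_smul hlam.ne']
  match_scalars <;> (field_simp; ring_nf; try rw [Complex.I_sq]; try ring)

end

/-! ### Gaussians as left multipliers -/

/-- The Gaussian integral on the plane, with a complex linear term. -/
lemma integral_cexp_plane {b : ℝ} (hb : 0 < b) (c₁ c₂ : ℂ) :
    ∫ x : ℝ × ℝ, Complex.exp (-(b : ℂ) * (x.1 ^ 2 + x.2 ^ 2) + c₁ * x.1 + c₂ * x.2) =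
      Real.pi / b * Complex.exp ((c₁ ^ 2 + c₂ ^ 2) / (4 * b)) := by
  have hb' : (b : ℂ) ≠ 0 := by exact_mod_cast hb.ne'
  have e : (fun x : ℝ × ℝ => Complex.exp (-(b : ℂ) * (x.1 ^ 2 + x.2 ^ 2) + c₁ * x.1 + c₂ * x.2)) =
      fun x => Complex.exp (-(b : ℂ) * x.1 ^ 2 + c₁ * x.1 + 0) *
        Complex.exp (-(b : ℂ) * x.2 ^ 2 + c₂ * x.2 + 0) := by
    ext x; rw [← Complex.exp_add]; congr 1; ring
  have hre : (-(b : ℂ)).re < 0 := by simpa using hb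
  rw [e, Measure.volume_eq_prod,
    integral_prod_mul (fun t : ℝ => Complex.exp (-(b : ℂ) * t ^ 2 + c₁ * t + 0))
      (fun t : ℝ => Complex.exp (-(b : ℂ) * t ^ 2 + c₂ * t + 0)),
    integral_cexp_quadratic hre, integral_cexp_quadratic hre, mul_mul_mul_comm, ← Complex.exp_add,
    neg_neg]
  congr 1
  · rw [← Complex.cpow_add _ _ (by simp [hb.ne', Real.pi_ne_zero])]; norm_num
  · congr 1; field_simp; ring

/-- The Gaussian symbol `(1 + s) exp(-s |x|² / θ)`, with `θ = λ²`. -/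
def gsym (lam s : ℝ) (x : ℝ × ℝ) : ℂ :=
  (1 + s : ℂ) * ((Real.exp (-(s / lam ^ 2) * (x.1 ^ 2 + x.2 ^ 2)) : ℝ) : ℂ)

lemma gsym_zero (lam : ℝ) : gsym lam 0 = fun _ => 1 := by ext x; simp [gsym]

lemma isSymbol_sch (ψ : Sch) : IsSymbol 0 ψ :=
  ⟨ψ.smooth', fun n => (ψ.decay 0 n).imp fun C hC x => by simpa using hC.2 x⟩

lemma isSymbol_const (N : ℕ) (c : ℂ) : IsSymbol N fun _ => c := by
  refine ⟨contDiff_const, fun n => ⟨‖c‖, fun x => ?_⟩⟩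
  have h1 : 1 ≤ (1 + ‖x‖) ^ N := one_le_pow₀ (by linarith [norm_nonneg x])
  rcases n with _ | n
  · rw [norm_iteratedFDeriv_zero]; exact le_mul_of_one_le_right (norm_nonneg _) h1
  · rw [iteratedFDeriv_const_of_ne (by simp)]
    simp only [Pi.zero_apply, norm_zero]; positivity

lemma isSymbol_gsym {lam s : ℝ} (hlam : 0 < lam) (hs : 0 ≤ s) : IsSymbol 0 (gsym lam s) := by
  rcases hs.eq_or_lt with rfl | hs
  · rw [gsym_zero]; exact isSymbol_const 0 1
  · have : gsym lam s = ((1 + s : ℂ) • gaussS (s / lam ^ 2) : Sch) := by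
      ext x; rw [smul_apply, gaussS_apply (by positivity), gsym, smul_eq_mul]
    rw [this]; exact isSymbol_sch _

lemma isMultiplier_gsym {lam s : ℝ} (hlam : 0 < lam) (hs : 0 ≤ s) : IsMultiplier lam (gsym lam s) :=
  (isSymbol_gsym hlam hs).isMultiplier hlam.ne'

lemma hasFDerivAt_gsym (lam s : ℝ) (x : ℝ × ℝ) :
    HasFDerivAt (gsym lam s) (pd (-2 * (s / lam ^ 2) * x.1 * gsym lam s x)
      (-2 * (s / lam ^ 2) * x.2 * gsym lam s x)) x := by
  refine ((hasFDerivAt_gauss (s / lam ^ 2) x).pd_const_mul (1 + s : ℂ)).pd_congr ?_ ?_ <;>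
  · rw [gsym]; push_cast; ring

lemma dz_gsym (lam s : ℝ) :
    dz (gsym lam s) = fun x => (-2 * (s / lam ^ 2) : ℂ) * (zbar x * gsym lam s x) := by
  ext x
  have h := hasFDerivAt_gsym lam s x
  rw [congrFun (dz_eq _) x, congrFun (zbar_mul_eq (gsym lam s)) x]
  simp only [d1, d2, h.fderiv, pd_apply]
  push_cast; ring

/-- The vacuum Gaussian is an eigenfunction of the symplectic Fourier transform. -/
lemma sft_gaussS {lam : ℝ} (hlam : 0 < lam) (u : ℝ × ℝ) :
    sft lam (gaussS (1 / lam ^ 2)) u = Real.pi * lam ^ 2 * gaussS (1 / lam ^ 2) u := by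
  have h0 : (lam : ℂ) ≠ 0 := by exact_mod_cast hlam.ne'
  have hb : 0 < 1 / lam ^ 2 := by positivity
  have e : ∀ w : ℝ × ℝ, gaussS (1 / lam ^ 2) w * osc lam w u =
      Complex.exp (-((1 / lam ^ 2 : ℝ) : ℂ) * (w.1 ^ 2 + w.2 ^ 2) +
        (-(2 * Complex.I / lam ^ 2 * u.2)) * w.1 + (2 * Complex.I / lam ^ 2 * u.1) * w.2) := by
    intro w
    rw [gaussS_apply hb, osc, Complex.ofReal_exp, ← Complex.exp_add]
    congr 1; push_cast; ring
  rw [sft_apply hlam.ne', sftFun]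
  simp only [e]
  rw [integral_cexp_plane hb, gaussS_apply hb, Complex.ofReal_exp]
  congr 1
  · push_cast; field_simp
  · congr 1; push_cast; field_simp; ring_nf; rw [Complex.I_sq]; ring

/-- The normalization `1 + s` of the Gaussian symbol makes it fix the vacuum. -/
lemma leftMul_gsym_vac {lam s : ℝ} (hlam : 0 < lam) (hs : 0 ≤ s) :
    leftMul lam (gsym lam s) (vac (1 / lam ^ 2)) = vac (1 / lam ^ 2) := by
  have h0 : (lam : ℂ) ≠ 0 := by exact_mod_cast hlam.ne'
  have hs0 : (1 + s : ℂ) ≠ 0 := by exact_mod_cast (by positivity : (1 + s : ℝ) ≠ 0)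
  have hpi : (Real.pi : ℂ) ≠ 0 := by exact_mod_cast Real.pi_ne_zero
  have hb : 0 < 1 / lam ^ 2 := by positivity
  rw [vac, (isMultiplier_gsym hlam hs).leftMul_smul hlam.ne']
  congr 1
  ext x
  rw [(isMultiplier_gsym hlam hs).leftMul_apply, moyal_eq hlam.ne', twist]
  have e : ∀ u, gsym lam s (x + u) * sft lam (gaussS (1 / lam ^ 2)) u * osc lam u x =
      (1 + s) * (Real.pi * lam ^ 2) * Complex.exp (-(s / lam ^ 2) * (x.1 ^ 2 + x.2 ^ 2)) *
      Complex.exp (-(((1 + s) / lam ^ 2 : ℝ) : ℂ) * (u.1 ^ 2 + u.2 ^ 2) +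
        (-(2 / lam ^ 2) * (s * x.1 + Complex.I * x.2)) * u.1 +
          (-(2 / lam ^ 2) * (s * x.2 - Complex.I * x.1)) * u.2) := by
    intro u
    have : Complex.exp (-(s / lam ^ 2) * (x.1 ^ 2 + x.2 ^ 2)) *
      Complex.exp (-(((1 + s) / lam ^ 2 : ℝ) : ℂ) * (u.1 ^ 2 + u.2 ^ 2) +
        (-(2 / lam ^ 2) * (s * x.1 + Complex.I * x.2)) * u.1 +
          (-(2 / lam ^ 2) * (s * x.2 - Complex.I * x.1)) * u.2) =
        ((Real.exp (-(s / lam ^ 2) * ((x + u).1 ^ 2 + (x + u).2 ^ 2)) : ℝ) : ℂ) *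
        ((Real.exp (-(1 / lam ^ 2) * (u.1 ^ 2 + u.2 ^ 2)) : ℝ) : ℂ) * osc lam u x := by
      rw [osc, Complex.ofReal_exp, Complex.ofReal_exp, ← Complex.exp_add, ← Complex.exp_add,
        ← Complex.exp_add]
      congr 1; simp only [Prod.fst_add, Prod.snd_add]; push_cast; field_simp; ring
    rw [mul_assoc _ (Complex.exp _), this, sft_gaussS hlam, gsym, gaussS_apply hb]; ring
  simp only [e]
  rw [integral_const_mul, integral_cexp_plane (by positivity), mconst, gaussS_apply hb,
    Complex.ofReal_exp]
  have e2 : Complex.exp (((-(1 / lam ^ 2) * (x.1 ^ 2 + x.2 ^ 2) : ℝ) : ℂ)) =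
      Complex.exp (-(s / lam ^ 2) * (x.1 ^ 2 + x.2 ^ 2)) *
      Complex.exp (((-(2 / lam ^ 2) * (s * x.1 + Complex.I * x.2)) ^ 2 +
        (-(2 / lam ^ 2) * (s * x.2 - Complex.I * x.1)) ^ 2 : ℂ) /
        (4 * (((1 + s) / lam ^ 2 : ℝ) : ℂ))) := by
    rw [← Complex.exp_add]; congr 1; push_cast; field_simp; ring_nf; rw [Complex.I_sq]; ring
  rw [e2]; push_cast; field_simp

/-- Left multiplication by the Gaussian `(1 + s) exp(-s |x|² / θ)` is diagonal, with eigenvalues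
`((1 - s) / (1 + s))ᵐ`. -/
theorem leftMul_gsym_h {lam s : ℝ} (hlam : 0 < lam) (hs : 0 ≤ s) (m n : ℕ) :
    leftMul lam (gsym lam s) ((moyalLadder lam hlam).h m n) =
      (((1 - s) / (1 + s)) ^ m : ℂ) • (moyalLadder lam hlam).h m n := by
  have h0 : (lam : ℂ) ≠ 0 := by exact_mod_cast hlam.ne'
  have hs0 : (1 + s : ℂ) ≠ 0 := by exact_mod_cast (by positivity : (1 + s : ℝ) ≠ 0)
  have hG := isMultiplier_gsym hlam hs
  induction m with
  | zero =>
    induction n with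
    | zero => rw [Ladder.h_zero_zero, pow_zero, one_smul]; exact leftMul_gsym_vac hlam hs
    | succ n ih =>
      rw [Ladder.h_succ_right, hG.leftMul_smul hlam.ne', ← Cs_leftMul hlam hG, ih, map_smul,
        smul_comm]
  | succ m ih =>
    have h1 := As_leftMul hlam hG ((moyalLadder lam hlam).h m n)
    have hz : leftMul lam (dz (gsym lam s)) ((moyalLadder lam hlam).h m n) =
        (-2 * (s / lam ^ 2) : ℂ) • leftMul lam (fun x => zbar x * gsym lam s x)
          ((moyalLadder lam hlam).h m n) := by
      rw [dz_gsym, leftMul_smul_left hlam.ne' (hG.zbar_mul hlam.ne')]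
    rw [hz, leftMul_zbar_mul hlam hG] at h1
    -- `(1 + s) G ⋆ As h = (1 - s) As (G ⋆ h)`
    have h2 : leftMul lam (gsym lam s) ((moyalLadder lam hlam).As ((moyalLadder lam hlam).h m n)) =
        ((1 - s) / (1 + s) : ℂ) • (moyalLadder lam hlam).As
          (leftMul lam (gsym lam s) ((moyalLadder lam hlam).h m n)) := by
      have h3 : (1 + s : ℂ) • leftMul lam (gsym lam s)
          ((moyalLadder lam hlam).As ((moyalLadder lam hlam).h m n)) =
          (1 - s : ℂ) • (moyalLadder lam hlam).As
          (leftMul lam (gsym lam s) ((moyalLadder lam hlam).h m n)) := by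
        have e : (lam : ℂ) * (-2 * (s / lam ^ 2)) * (lam / 2) = -s := by field_simp
        rw [smul_smul, smul_smul, e] at h1
        rw [← sub_eq_zero] at h1
        rw [eq_comm, ← sub_eq_zero, ← h1]
        module
      rw [div_eq_inv_mul, mul_smul, ← h3, smul_smul, inv_mul_cancel₀ hs0, one_smul]
    rw [Ladder.h_succ_left, hG.leftMul_smul hlam.ne', h2, ih, map_smul]
    module

lemma one_leftMul {lam : ℝ} (hlam : 0 < lam) (ψ : Sch) : leftMul lam (fun _ => 1) ψ = ψ := by
  have h1 : IsMultiplier lam fun _ => (1 : ℂ) := (isSymbol_const 0 1).isMultiplier hlam.ne'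
  refine (moyalLadder lam hlam).ext_inner fun m n => ?_
  rw [inner_leftMul hlam.ne' h1]
  simp only [map_one]
  rw [← gsym_zero lam, leftMul_gsym_h hlam le_rfl]
  simp

lemma isMultiplier_one {lam : ℝ} (hlam : 0 < lam) : IsMultiplier lam fun _ => 1 :=
  (isSymbol_const 0 1).isMultiplier hlam.ne'

lemma isMultiplier_z {lam : ℝ} (hlam : 0 < lam) : IsMultiplier lam z := by
  simpa using (isMultiplier_one hlam).z_mul hlam.ne'

lemma isMultiplier_zbar {lam : ℝ} (hlam : 0 < lam) : IsMultiplier lam zbar := by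
  simpa using (isMultiplier_one hlam).zbar_mul hlam.ne'

lemma leftMul_z {lam : ℝ} (hlam : 0 < lam) (ψ : Sch) :
    leftMul lam z ψ = (lam : ℂ) • (moyalLadder lam hlam).A ψ := by
  have h := leftMul_z_mul hlam (isMultiplier_one hlam) ψ
  simp only [mul_one, one_leftMul hlam] at h
  rw [h]; module

lemma leftMul_zbar {lam : ℝ} (hlam : 0 < lam) (ψ : Sch) :
    leftMul lam zbar ψ = (lam : ℂ) • (moyalLadder lam hlam).As ψ := by
  have h := leftMul_zbar_mul hlam (isMultiplier_one hlam) ψ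
  simp only [mul_one, one_leftMul hlam] at h
  rw [h]; module

/-- The explicit form of the Wigner transition functions `h_{m0}`. -/
lemma h_zero_right_apply {lam : ℝ} (hlam : 0 < lam) (m : ℕ) (x : ℝ × ℝ) :
    (moyalLadder lam hlam).h m 0 x =
      ((Real.sqrt (2 / (Real.pi * lam ^ 2)) * 2 ^ m /
        Real.sqrt ((lam ^ 2) ^ m * (m.factorial : ℝ)) : ℝ) : ℂ) *
      zbar x ^ m * ((Real.exp (-(x.1 ^ 2 + x.2 ^ 2) / lam ^ 2) : ℝ) : ℂ) := by
  have h0 : (lam : ℂ) ≠ 0 := by exact_mod_cast hlam.ne'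
  have h3 := ofReal_sqrt_two_ne_zero
  have hb : 0 < 1 / lam ^ 2 := by positivity
  induction m generalizing x with
  | zero =>
    rw [Ladder.h_zero_zero]
    change vac _ x = _
    rw [vac, smul_apply, gaussS_apply hb]
    simp only [pow_zero, mul_one, Nat.factorial_zero, Nat.cast_one, Real.sqrt_one, div_one,
      smul_eq_mul]
    rw [show 2 * (1 / lam ^ 2) / Real.pi = 2 / (Real.pi * lam ^ 2) by field_simp,
      show -(1 / lam ^ 2) * (x.1 ^ 2 + x.2 ^ 2) = -(x.1 ^ 2 + x.2 ^ 2) / lam ^ 2 by ring]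
  | succ m ih =>
    obtain ⟨K, hK⟩ : ∃ K : ℂ, K = ((Real.sqrt (2 / (Real.pi * lam ^ 2)) * 2 ^ m /
        Real.sqrt ((lam ^ 2) ^ m * (m.factorial : ℝ)) : ℝ) : ℂ) := ⟨_, rfl⟩
    rw [← hK] at ih
    have hzb : HasFDerivAt zbar (pd (1 / Real.sqrt 2) (-Complex.I / Real.sqrt 2)) x := by
      have := (((hasFDerivAt_ofReal_fst x).pd_add
        ((hasFDerivAt_ofReal_snd x).pd_const_mul (-Complex.I))).pd_const_mul (1 / (Real.sqrt 2 : ℂ)))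
      have e : zbar = fun x : ℝ × ℝ => (1 / (Real.sqrt 2 : ℂ)) * (x.1 + -Complex.I * x.2) := by
        simpa using zbar_mul_eq fun _ => 1
      rw [e]
      exact this.pd_congr (by ring) (by ring)
    have hpow : HasFDerivAt (fun x => zbar x ^ m) (pd (m * zbar x ^ (m - 1) * (1 / Real.sqrt 2))
        (m * zbar x ^ (m - 1) * (-Complex.I / Real.sqrt 2))) x := by
      refine (hzb.pow m).congr_fderiv ?_
      rw [smul_pd, nsmul_eq_mul]
    have hd := (hpow.pd_const_mul K).pd_mul (hasFDerivAt_gauss (1 / lam ^ 2) x)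
    rw [← show ((moyalLadder lam hlam).h m 0 : ℝ × ℝ → ℂ) = fun x => (K * zbar x ^ m) *
      ((Real.exp (-(1 / lam ^ 2) * (x.1 ^ 2 + x.2 ^ 2)) : ℝ) : ℂ) from funext fun x => by
        rw [ih]; congr 3; ring] at hd
    have hs : ((Real.sqrt ((m + 1 : ℕ) : ℝ))⁻¹ : ℂ) * (2 / lam) * K =
        ((Real.sqrt (2 / (Real.pi * lam ^ 2)) * 2 ^ (m + 1) /
        Real.sqrt ((lam ^ 2) ^ (m + 1) * ((m + 1).factorial : ℝ)) : ℝ) : ℂ) := by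
      have hsq : Real.sqrt ((lam ^ 2) ^ (m + 1) * ((m + 1).factorial : ℝ)) =
          lam * Real.sqrt ((m + 1 : ℕ) : ℝ) * Real.sqrt ((lam ^ 2) ^ m * (m.factorial : ℝ)) := by
        rw [Nat.factorial_succ, Nat.cast_mul,
          show (lam ^ 2) ^ (m + 1) * (((m + 1 : ℕ) : ℝ) * (m.factorial : ℝ)) =
            lam ^ 2 * ((m + 1 : ℕ) : ℝ) * ((lam ^ 2) ^ m * (m.factorial : ℝ)) by ring,
          Real.sqrt_mul (by positivity), Real.sqrt_mul (by positivity) ((m + 1 : ℕ) : ℝ),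
          Real.sqrt_sq hlam.le]
      rw [hK, hsq]
      have : Real.sqrt ((m + 1 : ℕ) : ℝ) ≠ 0 := by positivity
      have : Real.sqrt ((lam ^ 2) ^ m * (m.factorial : ℝ)) ≠ 0 := by positivity
      rw [← Complex.ofReal_inv]
      have h4 : (2 / lam : ℂ) = ((2 / lam : ℝ) : ℂ) := by push_cast; rfl
      rw [h4, ← Complex.ofReal_mul, ← Complex.ofReal_mul]
      congr 1
      field_simp
      ring
    rw [Ladder.h_succ_left, smul_apply, smul_eq_mul, ← hs, mul_assoc, mul_assoc, mul_assoc]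
    congr 1
    -- `As` raises the power of `z̄`, since `∂ z̄ = 0`
    have hA : (moyalLadder lam hlam).As ((moyalLadder lam hlam).h m 0) x =
        1 / (Real.sqrt 2 * lam) * (x.1 * (moyalLadder lam hlam).h m 0 x) +
        -(Complex.I / (Real.sqrt 2 * lam)) * (x.2 * (moyalLadder lam hlam).h m 0 x) +
        -(lam / (2 * Real.sqrt 2)) * D1 ((moyalLadder lam hlam).h m 0) x +
        Complex.I * lam / (2 * Real.sqrt 2) * D2 ((moyalLadder lam hlam).h m 0) x := by
      rw [← X1_apply, ← X2_apply]; rfl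
    have hzx : (x.1 : ℂ) = Real.sqrt 2 * zbar x + Complex.I * x.2 := by
      have := congrFun (zbar_mul_eq fun _ => 1) x
      simp only [mul_one] at this
      rw [this]; field_simp; ring
    have he : -(x.1 ^ 2 + x.2 ^ 2) / lam ^ 2 = -(1 / lam ^ 2) * (x.1 ^ 2 + x.2 ^ 2) := by ring
    rw [hA, D1_eq_of_hasFDerivAt hd, D2_eq_of_hasFDerivAt hd, ih, he, pow_succ]
    generalize ((Real.exp (-(1 / lam ^ 2) * (x.1 ^ 2 + x.2 ^ 2)) : ℝ) : ℂ) = E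
    rw [hzx]
    push_cast
    field_simp
    ring_nf
    rw [Complex.I_sq]; ring

lemma wigner_eq {lam : ℝ} (hlam : 0 < lam) (m : ℕ) : wigner lam m = (moyalLadder lam hlam).h m 0 := by
  rw [wigner, ← toSch_coe ((moyalLadder lam hlam).h m 0)]
  congr 1
  ext x
  rw [h_zero_right_apply hlam]

/-! ### The commutator with the Dirac operator -/

lemma enorm_le_one_iff (w : ℂ) : ‖w‖ₑ ≤ 1 ↔ ‖w‖ ≤ 1 := by
  rw [← ofReal_norm, ENNReal.ofReal_le_one]

section

variable {lam : ℝ} (hlam : 0 < lam)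
include hlam

/-- `∂̄` is the difference of the left and the right multiplication by `z`, divided by `θ`. -/
lemma dbarS_eq (ψ : Sch) : dbarS ψ =
    (1 / lam : ℂ) • ((moyalLadder lam hlam).A ψ - (moyalLadder lam hlam).Cs ψ) := by
  have h0 : (lam : ℂ) ≠ 0 := by exact_mod_cast hlam.ne'
  have h3 := ofReal_sqrt_two_ne_zero
  change ((1 / Real.sqrt 2 : ℝ) : ℂ) • (D1 ψ + Complex.I • D2 ψ) = _
  simp only [moyalLadder, lin_apply]
  push_cast
  match_scalars <;> (field_simp; try ring)

/-- `∂` is the difference of the right and the left multiplication by `z̄`, divided by `θ`. -/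
lemma dS_eq (ψ : Sch) : dS ψ =
    (1 / lam : ℂ) • ((moyalLadder lam hlam).C ψ - (moyalLadder lam hlam).As ψ) := by
  have h0 : (lam : ℂ) ≠ 0 := by exact_mod_cast hlam.ne'
  have h3 := ofReal_sqrt_two_ne_zero
  change ((1 / Real.sqrt 2 : ℝ) : ℂ) • (D1 ψ - Complex.I • D2 ψ) = _
  simp only [moyalLadder, lin_apply]
  push_cast
  match_scalars <;> (field_simp; try ring)

lemma dbarS_leftMul {f : ℝ × ℝ → ℂ} (hf : IsMultiplier lam f) (ψ : Sch) :
    dbarS (leftMul lam f ψ) = leftMul lam f (dbarS ψ) + leftMul lam (dzb f) ψ := by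
  have h0 : (lam : ℂ) ≠ 0 := by exact_mod_cast hlam.ne'
  rw [dbarS_eq hlam, dbarS_eq hlam, A_leftMul hlam hf, Cs_leftMul hlam hf,
    hf.leftMul_smul hlam.ne', sub_eq_add_neg ((moyalLadder lam hlam).A ψ),
    hf.leftMul_add hlam.ne', ← neg_one_smul ℂ,
    hf.leftMul_smul hlam.ne']
  match_scalars <;> field_simp

lemma dS_leftMul {f : ℝ × ℝ → ℂ} (hf : IsMultiplier lam f) (ψ : Sch) :
    dS (leftMul lam f ψ) = leftMul lam f (dS ψ) + leftMul lam (dz f) ψ := by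
  have h0 : (lam : ℂ) ≠ 0 := by exact_mod_cast hlam.ne'
  rw [dS_eq hlam, dS_eq hlam, As_leftMul hlam hf, C_leftMul hlam hf,
    hf.leftMul_smul hlam.ne', sub_eq_add_neg ((moyalLadder lam hlam).C ψ),
    hf.leftMul_add hlam.ne', ← neg_one_smul ℂ,
    hf.leftMul_smul hlam.ne']
  match_scalars <;> field_simp

lemma inner_dS (φ ψ : Sch) : ⟪emb (dS φ), emb ψ⟫_ℂ = -⟪emb φ, emb (dbarS ψ)⟫_ℂ := by
  have hA : ⟪emb ((moyalLadder lam hlam).A ψ), emb φ⟫_ℂ =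
      ⟪emb ψ, emb ((moyalLadder lam hlam).As φ)⟫_ℂ := by
    rw [← inner_conj_symm, ← (moyalLadder lam hlam).inner_As, inner_conj_symm]
  have hC : ⟪emb ((moyalLadder lam hlam).C φ), emb ψ⟫_ℂ =
      ⟪emb φ, emb ((moyalLadder lam hlam).Cs ψ)⟫_ℂ := by
    rw [← inner_conj_symm, ← (moyalLadder lam hlam).inner_Cs, inner_conj_symm]
  rw [dS_eq hlam, dbarS_eq hlam]
  simp only [emb_smul, emb_sub, inner_smul_left, inner_smul_right, inner_sub_left, inner_sub_right,
    hC, (moyalLadder lam hlam).inner_As, map_div₀, map_one, Complex.conj_ofReal]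
  ring

lemma inner_dbarS (φ ψ : Sch) : ⟪emb (dbarS φ), emb ψ⟫_ℂ = -⟪emb φ, emb (dS ψ)⟫_ℂ := by
  rw [← inner_conj_symm, ← neg_neg ⟪emb ψ, emb (dbarS φ)⟫_ℂ, ← inner_dS hlam, map_neg,
    inner_conj_symm]

/-- `[D, 𝓛(f)]` is the left multiplication by the derivatives of `f`. -/
theorem commForm_leftOp {f : ℝ × ℝ → ℂ} (hf : IsMultiplier lam f) (φ ψ : Sch × Sch) :
    commForm (leftOp lam f) φ ψ = -Complex.I * Real.sqrt 2 *
      (⟪emb φ.1, emb (leftMul lam (dzb f) ψ.2)⟫_ℂ + ⟪emb φ.2, emb (leftMul lam (dz f) ψ.1)⟫_ℂ) := by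
  simp only [commForm, leftOp, dirac, hf.leftMul_smul hlam.ne', emb_smul, inner_smul_left,
    inner_smul_right, inner_dbarS hlam, inner_dS hlam, dbarS_leftMul hlam hf, dS_leftMul hlam hf,
    emb_add, inner_add_right, map_mul, map_neg, Complex.conj_I, Complex.conj_ofReal]
  ring

omit hlam in
lemma enorm_commForm_le (T : Sch → L2) {φ ψ : Sch × Sch}
    (hφ : ‖emb φ.1‖ ^ 2 + ‖emb φ.2‖ ^ 2 ≤ 1) (hψ : ‖emb ψ.1‖ ^ 2 + ‖emb ψ.2‖ ^ 2 ≤ 1) :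
    ‖commForm T φ ψ‖ₑ ≤ commNorm T :=
  le_iSup_of_le φ (le_iSup_of_le ψ (le_iSup_of_le hφ (le_iSup_of_le hψ le_rfl)))

/-- The matrix elements of `𝓛(∂f)` are bounded by `‖[D, 𝓛(f)]‖ / √2`. -/
lemma enorm_inner_dz_le {f : ℝ × ℝ → ℂ} (hf : IsMultiplier lam f) {φ ψ : Sch}
    (hφ : ‖emb φ‖ ≤ 1) (hψ : ‖emb ψ‖ ≤ 1) :
    ‖(Real.sqrt 2 : ℂ) * ⟪emb φ, emb (leftMul lam (dz f) ψ)⟫_ℂ‖ₑ ≤ commNorm (leftOp lam f) := by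
  have h := enorm_commForm_le (leftOp lam f) (φ := (0, φ)) (ψ := (ψ, 0))
    (by simpa [emb_zero] using hφ) (by simpa [emb_zero] using hψ)
  rw [commForm_leftOp hlam hf] at h
  simpa [emb_zero, enorm_mul, enorm_neg, ← ofReal_norm Complex.I] using h

lemma norm_inner_dz_le {f : ℝ × ℝ → ℂ} (hf : IsMultiplier lam f)
    (h1 : commNorm (leftOp lam f) ≤ 1) {φ ψ : Sch} (hφ : ‖emb φ‖ ≤ 1) (hψ : ‖emb ψ‖ ≤ 1) :
    ‖⟪emb φ, emb (leftMul lam (dz f) ψ)⟫_ℂ‖ ≤ 1 / Real.sqrt 2 := by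
  have h := (enorm_inner_dz_le hlam hf hφ hψ).trans h1
  rw [enorm_le_one_iff, norm_mul, Complex.norm_real, Real.norm_of_nonneg (by positivity)] at h
  rw [le_div_iff₀ (by positivity)]
  linarith

/-- Telescoping step: the difference of consecutive expectation values is a matrix element
of the derivative. -/
lemma inner_h_sub (f : ℝ × ℝ → ℂ) (hf : IsMultiplier lam f) (m : ℕ) :
    (Real.sqrt ((m + 1 : ℕ) : ℝ) : ℂ) *
      (⟪emb ((moyalLadder lam hlam).h (m + 1) 0),
          emb (leftMul lam f ((moyalLadder lam hlam).h (m + 1) 0))⟫_ℂ -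
        ⟪emb ((moyalLadder lam hlam).h m 0),
          emb (leftMul lam f ((moyalLadder lam hlam).h m 0))⟫_ℂ) =
      lam * ⟪emb ((moyalLadder lam hlam).h (m + 1) 0),
        emb (leftMul lam (dz f) ((moyalLadder lam hlam).h m 0))⟫_ℂ := by
  have h := As_leftMul hlam hf ((moyalLadder lam hlam).h m 0)
  rw [Ladder.As_h, hf.leftMul_smul hlam.ne'] at h
  have h2 := congrArg (fun ψ => ⟪emb ((moyalLadder lam hlam).h (m + 1) 0), emb ψ⟫_ℂ) h
  have h3 : ⟪emb ((moyalLadder lam hlam).h (m + 1) 0), emb ((moyalLadder lam hlam).As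
      (leftMul lam f ((moyalLadder lam hlam).h m 0)))⟫_ℂ = (Real.sqrt ((m + 1 : ℕ) : ℝ) : ℂ) *
      ⟪emb ((moyalLadder lam hlam).h m 0), emb (leftMul lam f ((moyalLadder lam hlam).h m 0))⟫_ℂ := by
    rw [← inner_conj_symm, (moyalLadder lam hlam).inner_As, Ladder.A_h_succ, emb_smul,
      inner_smul_right, map_mul, Complex.conj_ofReal, inner_conj_symm]
  simp only [h3, emb_sub, emb_smul, inner_sub_right, inner_smul_right] at h2
  linear_combination -h2

/-- Left multiplication by `f` is diagonal in the Wigner basis, with eigenvalues `c m`. -/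
def IsDiag (f : ℝ × ℝ → ℂ) (c : ℕ → ℂ) : Prop :=
  ∀ m n, leftMul lam f ((moyalLadder lam hlam).h m n) = c m • (moyalLadder lam hlam).h m n

variable {hlam}

lemma IsDiag.inner {f : ℝ × ℝ → ℂ} {c : ℕ → ℂ} (hf : IsMultiplier lam f) (h : IsDiag hlam f c)
    (m n : ℕ) (ψ : Sch) :
    ⟪emb ((moyalLadder lam hlam).h m n), emb (leftMul lam (fun x => conj (f x)) ψ)⟫_ℂ =
      conj (c m) * ⟪emb ((moyalLadder lam hlam).h m n), emb ψ⟫_ℂ := by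
  have e := inner_leftMul hlam.ne' hf.conj ((moyalLadder lam hlam).h m n) ψ
  simp only [Complex.conj_conj] at e
  rw [e, h, emb_smul, inner_smul_left]

lemma IsDiag.conj {f : ℝ × ℝ → ℂ} {c : ℕ → ℂ} (hf : IsMultiplier lam f) (h : IsDiag hlam f c) :
    IsDiag hlam (fun x => conj (f x)) fun m => conj (c m) := by
  refine fun m n => (moyalLadder lam hlam).ext_inner fun m' n' => ?_
  rw [h.inner hf, emb_smul, inner_smul_right, Ladder.inner_h]
  split_ifs with hm
  · rw [hm.1]
  · simp

lemma IsDiag.inner' {f : ℝ × ℝ → ℂ} {c : ℕ → ℂ} (hf : IsMultiplier lam f) (h : IsDiag hlam f c)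
    (m n : ℕ) (ψ : Sch) :
    ⟪emb ((moyalLadder lam hlam).h m n), emb (leftMul lam f ψ)⟫_ℂ =
      c m * ⟪emb ((moyalLadder lam hlam).h m n), emb ψ⟫_ℂ := by
  have := (h.conj hf).inner hf.conj m n ψ
  simpa only [Complex.conj_conj] using this

/-- The derivative of a diagonal element is a weighted shift, by `[z̄, f] = -θ ∂f`. -/
lemma IsDiag.dz_h {f : ℝ × ℝ → ℂ} {c : ℕ → ℂ} (hf : IsMultiplier lam f) (h : IsDiag hlam f c)
    (m n : ℕ) : leftMul lam (dz f) ((moyalLadder lam hlam).h m n) =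
      (Real.sqrt ((m + 1 : ℕ) : ℝ) / lam * (c (m + 1) - c m)) •
        (moyalLadder lam hlam).h (m + 1) n := by
  have h0 : (lam : ℂ) ≠ 0 := by exact_mod_cast hlam.ne'
  have e := As_leftMul hlam hf ((moyalLadder lam hlam).h m n)
  rw [h, map_smul, Ladder.As_h, hf.leftMul_smul hlam.ne', h] at e
  have e2 : (lam : ℂ) • leftMul lam (dz f) ((moyalLadder lam hlam).h m n) =
      (Real.sqrt ((m + 1 : ℕ) : ℝ) * (c (m + 1) - c m)) • (moyalLadder lam hlam).h (m + 1) n := by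
    rw [eq_sub_iff_add_eq, add_comm, ← eq_sub_iff_add_eq] at e
    rw [e]; module
  rw [← inv_smul_smul₀ h0 (leftMul lam (dz f) _), e2, smul_smul]
  congr 1; field_simp

lemma norm_emb_h (m n : ℕ) : ‖emb ((moyalLadder lam hlam).h m n)‖ = 1 := by
  have := (moyalLadder lam hlam).orthonormal_h.1 (m, n)
  exact this

/-- If the coordinates of `y` are dominated by the shifted coordinates of `x`, then `y` is
dominated by `x`. -/
lemma norm_le_of_shift {x y : L2} {K : ℝ} (hK : 0 ≤ K)
    (h0 : ∀ n, ⟪emb ((moyalLadder lam hlam).h 0 n), y⟫_ℂ = 0)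
    (h1 : ∀ m n, ‖⟪emb ((moyalLadder lam hlam).h (m + 1) n), y⟫_ℂ‖ ≤
      K * ‖⟪emb ((moyalLadder lam hlam).h m n), x⟫_ℂ‖) : ‖y‖ ≤ K * ‖x‖ := by
  have hx := hasSum_norm_inner_sq (moyalLadder lam hlam).basis x
  have hy := hasSum_norm_inner_sq (moyalLadder lam hlam).basis y
  simp only [Ladder.basis_apply] at hx hy
  have hinj : Function.Injective fun p : ℕ × ℕ => (p.1 + 1, p.2) := by
    rintro ⟨a, b⟩ ⟨c, d⟩ h; simpa using h
  rw [← hinj.hasSum_iff] at hy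
  · have := hasSum_le (fun p => ?_) hy (hx.mul_left (K ^ 2))
    · rw [← mul_pow] at this
      exact le_of_sq_le_sq this (by positivity)
    · rw [← mul_pow]
      exact pow_le_pow_left₀ (norm_nonneg _) (h1 p.1 p.2) 2
  · rintro ⟨m, n⟩ hp
    rcases m with _ | m
    · simp [h0]
    · exact absurd ⟨(m, n), rfl⟩ hp

/-- The weighted shift `𝓛(∂f)` is bounded by `1/√2`, not only on the basis vectors but on all
Schwartz functions; its coordinates are computed with the adjoint. -/
lemma IsDiag.norm_dz_le {f : ℝ × ℝ → ℂ} {c : ℕ → ℂ} (hf : IsMultiplier lam f)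
    (h : IsDiag hlam f c)
    (hc : ∀ m, ‖c (m + 1) - c m‖ ≤ lam / Real.sqrt (2 * (m + 1))) (ψ : Sch) :
    ‖emb (leftMul lam (dz f) ψ)‖ ≤ 1 / Real.sqrt 2 * ‖emb ψ‖ := by
  have hd := h.conj hf
  have e : ∀ m n, ⟪emb ((moyalLadder lam hlam).h m n), emb (leftMul lam (dz f) ψ)⟫_ℂ =
      ⟪emb (leftMul lam (dzb fun x => conj (f x)) ((moyalLadder lam hlam).h m n)), emb ψ⟫_ℂ := by
    intro m n
    rw [inner_leftMul hlam.ne' (hf.dz hlam.ne'), dzb_conj hf.temperate]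
  have hl : (lam : ℂ) ≠ 0 := by exact_mod_cast hlam.ne'
  have eA : ∀ m n, leftMul lam (dzb fun x => conj (f x)) ((moyalLadder lam hlam).h m n) =
      (1 / lam : ℂ) • ((moyalLadder lam hlam).A (leftMul lam (fun x => conj (f x))
        ((moyalLadder lam hlam).h m n)) - leftMul lam (fun x => conj (f x))
          ((moyalLadder lam hlam).A ((moyalLadder lam hlam).h m n))) := by
    intro m n
    rw [A_leftMul hlam hf.conj, add_sub_cancel_left, smul_smul, one_div, inv_mul_cancel₀ hl, one_smul]
  refine norm_le_of_shift (hlam := hlam) (by positivity) (fun n => ?_) fun m n => ?_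
  · rw [e, eA, hd, map_smul, Ladder.A_h_zero, ← zero_smul ℂ (0 : Sch), hf.conj.leftMul_smul hlam.ne']
    simp [emb_zero]
  · rw [e, eA, hd, map_smul, Ladder.A_h_succ, hf.conj.leftMul_smul hlam.ne', hd,
      show (1 / lam : ℂ) • (conj (c (m + 1)) • (Real.sqrt ((m + 1 : ℕ) : ℝ) : ℂ) •
        (moyalLadder lam hlam).h m n - (Real.sqrt ((m + 1 : ℕ) : ℝ) : ℂ) • conj (c m) •
        (moyalLadder lam hlam).h m n) = ((1 / lam : ℂ) * Real.sqrt ((m + 1 : ℕ) : ℝ) *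
        conj (c (m + 1) - c m)) • (moyalLadder lam hlam).h m n by rw [map_sub]; module,
      emb_smul, inner_smul_left, norm_mul]
    refine mul_le_mul_of_nonneg_right ?_ (norm_nonneg _)
    rw [RCLike.norm_conj, norm_mul, norm_mul, RCLike.norm_conj, Complex.norm_real, norm_div,
      Complex.norm_real, Real.norm_of_nonneg hlam.le, Real.norm_of_nonneg (by positivity), norm_one]
    have h5 : Real.sqrt (2 * (m + 1)) = Real.sqrt 2 * Real.sqrt ((m + 1 : ℕ) : ℝ) := by
      rw [Real.sqrt_mul (by norm_num)]; push_cast; rfl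
    have h6 := hc m
    rw [h5] at h6
    have h7 : 0 < Real.sqrt ((m + 1 : ℕ) : ℝ) := Real.sqrt_pos.2 (by positivity)
    calc _ ≤ 1 / lam * Real.sqrt ((m + 1 : ℕ) : ℝ) *
          (lam / (Real.sqrt 2 * Real.sqrt ((m + 1 : ℕ) : ℝ))) := by gcongr
      _ = _ := by field_simp

/-- A diagonal element with increments at most `λ / √(2 (m + 1))` has `‖[D, 𝓛(f)]‖ ≤ 1`. -/
theorem IsDiag.commNorm_le_one {f : ℝ × ℝ → ℂ} {c : ℕ → ℂ} (hf : IsMultiplier lam f)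
    (h : IsDiag hlam f c) (hc : ∀ m, ‖c (m + 1) - c m‖ ≤ lam / Real.sqrt (2 * (m + 1))) :
    commNorm (leftOp lam f) ≤ 1 := by
  refine iSup_le fun φ => iSup_le fun ψ => iSup_le fun hφ => iSup_le fun hψ => ?_
  rw [commForm_leftOp hlam hf, enorm_le_one_iff]
  have h1 : ‖⟪emb φ.1, emb (leftMul lam (dzb f) ψ.2)⟫_ℂ‖ ≤
      1 / Real.sqrt 2 * (‖emb φ.1‖ * ‖emb ψ.2‖) := by
    have e := inner_leftMul hlam.ne' (hf.dzb hlam.ne') φ.1 ψ.2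
    rw [← dz_conj hf.temperate] at e
    rw [e]
    refine (norm_inner_le_norm _ _).trans ?_
    rw [← mul_assoc]
    refine mul_le_mul_of_nonneg_right ((h.conj hf).norm_dz_le hf.conj (fun m => ?_) _)
      (norm_nonneg _)
    rw [← map_sub, RCLike.norm_conj]; exact hc m
  have h2 : ‖⟪emb φ.2, emb (leftMul lam (dz f) ψ.1)⟫_ℂ‖ ≤
      1 / Real.sqrt 2 * (‖emb φ.2‖ * ‖emb ψ.1‖) := by
    refine (norm_inner_le_norm _ _).trans ?_
    rw [mul_left_comm]
    exact mul_le_mul_of_nonneg_left (h.norm_dz_le hf hc _) (norm_nonneg _)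
  rw [norm_mul, norm_mul, norm_neg, Complex.norm_I, one_mul, Complex.norm_real,
    Real.norm_of_nonneg (by positivity)]
  have h3 : ‖emb φ.1‖ * ‖emb ψ.2‖ + ‖emb φ.2‖ * ‖emb ψ.1‖ ≤ 1 := by
    nlinarith [sq_nonneg (‖emb φ.1‖ - ‖emb ψ.2‖), sq_nonneg (‖emb φ.2‖ - ‖emb ψ.1‖)]
  calc _ ≤ Real.sqrt 2 * (1 / Real.sqrt 2 * (‖emb φ.1‖ * ‖emb ψ.2‖) +
        1 / Real.sqrt 2 * (‖emb φ.2‖ * ‖emb ψ.1‖)) := by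
          gcongr; exact (norm_add_le _ _).trans (add_le_add h1 h2)
    _ = ‖emb φ.1‖ * ‖emb ψ.2‖ + ‖emb φ.2‖ * ‖emb ψ.1‖ := by
      have : Real.sqrt 2 ≠ 0 := by positivity
      field_simp
    _ ≤ 1 := h3

/-- Consecutive expectation values of an element of the unit ball differ by at most
`λ / √(2 (m + 1))`. -/
lemma norm_inner_h_sub_le {f : ℝ × ℝ → ℂ} (hf : IsMultiplier lam f)
    (h1 : commNorm (leftOp lam f) ≤ 1) (m : ℕ) :
    ‖⟪emb ((moyalLadder lam hlam).h (m + 1) 0),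
          emb (leftMul lam f ((moyalLadder lam hlam).h (m + 1) 0))⟫_ℂ -
        ⟪emb ((moyalLadder lam hlam).h m 0),
          emb (leftMul lam f ((moyalLadder lam hlam).h m 0))⟫_ℂ‖ ≤
      lam / Real.sqrt (2 * (m + 1)) := by
  have e := congrArg norm (inner_h_sub hlam f hf m)
  have hn : ∀ m n, ‖emb ((moyalLadder lam hlam).h m n)‖ ≤ 1 := fun m n => by
    rw [norm_emb_h]
  have h2 := norm_inner_dz_le hlam hf h1 (hn (m + 1) 0) (hn m 0)
  rw [norm_mul, norm_mul, Complex.norm_real, Complex.norm_real, Real.norm_of_nonneg hlam.le,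
    Real.norm_of_nonneg (by positivity)] at e
  have h5 : Real.sqrt (2 * (m + 1)) = Real.sqrt 2 * Real.sqrt ((m + 1 : ℕ) : ℝ) := by
    rw [Real.sqrt_mul (by norm_num)]; push_cast; rfl
  have h7 : 0 < Real.sqrt ((m + 1 : ℕ) : ℝ) := Real.sqrt_pos.2 (by positivity)
  rw [h5, le_div_iff₀ (by positivity)]
  have h8 : lam * ‖⟪emb ((moyalLadder lam hlam).h (m + 1) 0),
      emb (leftMul lam (dz f) ((moyalLadder lam hlam).h m 0))⟫_ℂ‖ ≤ lam * (1 / Real.sqrt 2) :=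
    mul_le_mul_of_nonneg_left h2 hlam.le
  rw [← e] at h8
  have h9 : 0 < Real.sqrt 2 := by positivity
  calc _ = Real.sqrt 2 * (Real.sqrt ((m + 1 : ℕ) : ℝ) * _) := by ring
    _ ≤ Real.sqrt 2 * (lam * (1 / Real.sqrt 2)) := mul_le_mul_of_nonneg_left h8 h9.le
    _ = lam := by field_simp

/-- A diagonal element with first increment `λ / √2` has `‖[D, 𝓛(f)]‖ ≥ 1`. -/
lemma IsDiag.one_le_commNorm {f : ℝ × ℝ → ℂ} {c : ℕ → ℂ} (hf : IsMultiplier lam f)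
    (h : IsDiag hlam f c) (hc : c 1 - c 0 = (lam / Real.sqrt 2 : ℝ)) :
    1 ≤ commNorm (leftOp lam f) := by
  have hl : (lam : ℂ) ≠ 0 := by exact_mod_cast hlam.ne'
  have e := enorm_inner_dz_le hlam hf (φ := (moyalLadder lam hlam).h 1 0)
    (ψ := (moyalLadder lam hlam).h 0 0) (by rw [norm_emb_h]) (by rw [norm_emb_h])
  have e2 : (Real.sqrt 2 : ℂ) * (Real.sqrt ((0 + 1 : ℕ) : ℝ) / lam * (c (0 + 1) - c 0)) = 1 := by
    have h3 := ofReal_sqrt_two_ne_zero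
    rw [zero_add, hc]; push_cast; simp; field_simp
  rw [h.dz_h hf, emb_smul, inner_smul_right, Ladder.norm_h, mul_one, e2, enorm_one] at e
  exact e

end

/-! ### Matrix units -/

section

variable {lam : ℝ} (hlam : 0 < lam)
include hlam

lemma isMultiplier_sch (f : Sch) : IsMultiplier lam f := (isSymbol_sch f).isMultiplier hlam.ne'

lemma coe_As (f : Sch) : ((moyalLadder lam hlam).As f : ℝ × ℝ → ℂ) = fun x =>
    (1 / lam : ℂ) * (zbar x * f x) + -(lam / 2 : ℂ) * dz f x := by
  have hl : (lam : ℂ) ≠ 0 := by exact_mod_cast hlam.ne'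
  have h3 := ofReal_sqrt_two_ne_zero
  ext x
  simp only [moyalLadder, lin_apply, add_apply, smul_apply, X1_apply, X2_apply, smul_eq_mul,
    congrFun (zbar_mul_eq f) x, dz, D1_apply, D2_apply]
  field_simp
  ring

lemma coe_Cs (f : Sch) : ((moyalLadder lam hlam).Cs f : ℝ × ℝ → ℂ) = fun x =>
    (1 / lam : ℂ) * (z x * f x) + -(lam / 2 : ℂ) * dzb f x := by
  have hl : (lam : ℂ) ≠ 0 := by exact_mod_cast hlam.ne'
  have h3 := ofReal_sqrt_two_ne_zero
  ext x
  simp only [moyalLadder, lin_apply, add_apply, smul_apply, X1_apply, X2_apply, smul_eq_mul,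
    congrFun (z_mul_eq f) x, dzb, D1_apply, D2_apply]
  field_simp
  ring

omit hlam in
lemma leftMul_lin_left (hlam : lam ≠ 0) {f g : ℝ × ℝ → ℂ} (hf : IsMultiplier lam f)
    (hg : IsMultiplier lam g) (a b : ℂ) (ψ : Sch) :
    leftMul lam (fun x => a * f x + b * g x) ψ = a • leftMul lam f ψ + b • leftMul lam g ψ := by
  rw [leftMul_add_left hlam (hf.const_mul hlam a) (hg.const_mul hlam b)
    ((hf.const_mul hlam a).add hlam (hg.const_mul hlam b)), leftMul_smul_left hlam hf,
    leftMul_smul_left hlam hg]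

/-- Associativity of the Moyal product, `(z̄ ⋆ f) ⋆ ψ = z̄ ⋆ (f ⋆ ψ)`. -/
lemma leftMul_As (f ψ : Sch) : leftMul lam ((moyalLadder lam hlam).As f) ψ =
    (moyalLadder lam hlam).As (leftMul lam f ψ) := by
  have hl : (lam : ℂ) ≠ 0 := by exact_mod_cast hlam.ne'
  have hf := isMultiplier_sch hlam f
  have e := As_leftMul hlam hf ψ
  rw [coe_As, leftMul_lin_left hlam.ne' (hf.zbar_mul hlam.ne') (hf.dz hlam.ne'),
    leftMul_zbar_mul hlam hf, e]
  match_scalars <;> (field_simp; try ring)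

/-- Associativity of the Moyal product, `(f ⋆ z) ⋆ ψ = f ⋆ (z ⋆ ψ)`. -/
lemma leftMul_Cs (f ψ : Sch) : leftMul lam ((moyalLadder lam hlam).Cs f) ψ =
    leftMul lam f ((moyalLadder lam hlam).A ψ) := by
  have hl : (lam : ℂ) ≠ 0 := by exact_mod_cast hlam.ne'
  have hf := isMultiplier_sch hlam f
  have e := A_leftMul hlam hf ψ
  rw [coe_Cs, leftMul_lin_left hlam.ne' (hf.z_mul hlam.ne') (hf.dzb hlam.ne'),
    leftMul_z_mul hlam hf, e]
  match_scalars <;> (field_simp; try ring)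

omit hlam in
lemma leftMul_zero_left (ψ : Sch) : leftMul lam (0 : ℝ × ℝ → ℂ) ψ = 0 := by
  have e : moyal lam (0 : ℝ × ℝ → ℂ) ψ = (0 : Sch) := by
    ext x; simp [moyal]
  rw [leftMul, e, toSch_coe]

lemma leftMul_smul_sch (c : ℂ) (f ψ : Sch) :
    leftMul lam (c • f : Sch) ψ = c • leftMul lam f ψ := by
  rw [← leftMul_smul_left hlam.ne' (isMultiplier_sch hlam f)]; rfl

lemma leftMul_add_sch (f g ψ : Sch) :
    leftMul lam (f + g : Sch) ψ = leftMul lam f ψ + leftMul lam g ψ := by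
  rw [← leftMul_add_left hlam.ne' (isMultiplier_sch hlam f) (isMultiplier_sch hlam g)
    (isMultiplier_sch hlam (f + g))]; rfl

/-- The Wigner functions are, up to the factor `(2πθ)^(-1/2)`, matrix units. -/
lemma h_leftMul_h (i j k l : ℕ) :
    leftMul lam ((moyalLadder lam hlam).h i j) ((moyalLadder lam hlam).h k l) =
      if j = k then ((Real.sqrt (2 * (1 / lam ^ 2) / Real.pi) / 2 : ℝ) : ℂ) •
        (moyalLadder lam hlam).h i l else 0 := by
  induction i with
  | zero =>
    induction j generalizing k with
    | zero =>
      have e : ((moyalLadder lam hlam).h 0 0 : ℝ × ℝ → ℂ) = fun x =>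
          ((Real.sqrt (2 * (1 / lam ^ 2) / Real.pi) / 2 : ℝ) : ℂ) * gsym lam 1 x := by
        -- at `s = 1` the eigenvalues `((1 - s) / (1 + s)) ^ k` project onto `k = 0`
        ext x
        rw [Ladder.h_zero_zero]
        change vac _ x = _
        rw [vac, smul_apply, gaussS_apply (by positivity), gsym, smul_eq_mul]
        push_cast; ring
      rw [e, leftMul_smul_left hlam.ne' (isMultiplier_gsym hlam zero_le_one),
        leftMul_gsym_h hlam zero_le_one]
      rcases k with _ | k
      · simp
      · simp
    | succ j ih =>
      rw [Ladder.h_succ_right, leftMul_smul_sch hlam, leftMul_Cs]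
      rcases k with _ | k
      · rw [Ladder.A_h_zero, ← zero_smul ℂ (0 : Sch),
          (isMultiplier_sch hlam _).leftMul_smul hlam.ne']
        simp
      · rw [Ladder.A_h_succ, (isMultiplier_sch hlam _).leftMul_smul hlam.ne', ih]
        have h0 : (Real.sqrt ((j + 1 : ℕ) : ℝ) : ℂ) ≠ 0 := by
          exact_mod_cast (Real.sqrt_pos.2 (by positivity : (0 : ℝ) < ((j + 1 : ℕ) : ℝ))).ne'
        by_cases h : j = k
        · subst h
          rw [if_pos rfl, if_pos rfl, smul_smul, inv_mul_cancel₀ h0, one_smul]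
        · rw [if_neg h, if_neg (by omega)]; simp
  | succ i ih =>
    rw [Ladder.h_succ_left, leftMul_smul_sch hlam, leftMul_As, ih]
    split_ifs
    · rw [map_smul, Ladder.h_succ_left]; module
    · simp

/-- The Schwartz function whose left multiplication is diagonal with eigenvalues
`c 0, …, c (K - 1), 0, 0, …`. -/
def diagSch (c : ℕ → ℂ) (K : ℕ) : Sch :=
  ∑ i ∈ Finset.range K, (c i / ((Real.sqrt (2 * (1 / lam ^ 2) / Real.pi) / 2 : ℝ) : ℂ)) •
    (moyalLadder lam hlam).h i i

lemma isDiag_diagSch (c : ℕ → ℂ) (K : ℕ) :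
    IsDiag hlam (diagSch hlam c K) fun m => if m < K then c m else 0 := by
  intro m n
  induction K with
  | zero => simp [diagSch, leftMul_zero_left]
  | succ K ih =>
    rw [diagSch, Finset.sum_range_succ, leftMul_add_sch hlam, ← diagSch, ih, leftMul_smul_sch hlam,
      h_leftMul_h hlam]
    have h0 : ((Real.sqrt (2 * (1 / lam ^ 2) / Real.pi) / 2 : ℝ) : ℂ) ≠ 0 := by
      have : 0 < Real.sqrt (2 * (1 / lam ^ 2) / Real.pi) / 2 := by positivity
      exact_mod_cast this.ne'
    dsimp only
    rcases lt_trichotomy m K with h | h | h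
    · rw [if_pos h, if_neg h.ne', if_pos (by omega)]; simp
    · subst h
      rw [if_neg (lt_irrefl _), if_pos rfl, if_pos (by omega), smul_smul, div_mul_cancel₀ _ h0]
      simp
    · rw [if_neg (by omega), if_neg h.ne, if_neg (by omega)]; simp

variable {hlam}

/-- Strong convergence of diagonal operators on the Schwartz functions. -/
lemma tendsto_leftOp_of_isDiag {l : ℝ × ℝ → ℂ} (hl : IsMultiplier lam l) {c : ℕ → ℂ}
    (hc : IsDiag hlam l c) {a : ℕ → Sch} {d : ℕ → ℕ → ℂ} (ha : ∀ K, IsDiag hlam (a K) (d K))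
    (hd : ∀ K m, ‖d K m - c m‖ ≤ ‖c m‖) (ht : ∀ m, Tendsto (fun K => d K m) atTop (𝓝 (c m)))
    (ψ : Sch) : Tendsto (fun K => leftOp lam (a K) ψ) atTop (𝓝 (leftOp lam l ψ)) := by
  rw [tendsto_iff_norm_sub_tendsto_zero]
  have e : ∀ K, ‖leftOp lam (a K) ψ - leftOp lam l ψ‖ ^ 2 =
      ∑' p : ℕ × ℕ, ‖(d K p.1 - c p.1) * ⟪emb ((moyalLadder lam hlam).h p.1 p.2), emb ψ⟫_ℂ‖ ^ 2 := by
    intro K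
    rw [← (hasSum_norm_inner_sq (moyalLadder lam hlam).basis _).tsum_eq]
    refine tsum_congr fun p => ?_
    rw [Ladder.basis_apply, leftOp, leftOp, inner_sub_right,
      (ha K).inner' (isMultiplier_sch hlam _), hc.inner' hl]
    congr 2; ring
  have hs : Summable fun p : ℕ × ℕ =>
      ‖c p.1 * ⟪emb ((moyalLadder lam hlam).h p.1 p.2), emb ψ⟫_ℂ‖ ^ 2 := by
    refine (hasSum_norm_inner_sq (moyalLadder lam hlam).basis (leftOp lam l ψ)).summable.congr
      fun p => ?_
    rw [Ladder.basis_apply, leftOp, hc.inner' hl]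
  have h2 : Tendsto (fun K => ‖leftOp lam (a K) ψ - leftOp lam l ψ‖ ^ 2) atTop (𝓝 0) := by
    simp only [e]
    have := tendsto_tsum_of_dominated_convergence (𝓕 := atTop) (f := fun K (p : ℕ × ℕ) =>
      ‖(d K p.1 - c p.1) * ⟪emb ((moyalLadder lam hlam).h p.1 p.2), emb ψ⟫_ℂ‖ ^ 2)
      (g := fun _ => 0) hs (fun p => ?_) (Eventually.of_forall fun K p => ?_)
    · simpa using this
    · have h3 := (((ht p.1).sub_const (c p.1)).mul_const
        ⟪emb ((moyalLadder lam hlam).h p.1 p.2), emb ψ⟫_ℂ).norm.pow 2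
      simpa using h3
    · rw [Real.norm_of_nonneg (by positivity), norm_mul, norm_mul]
      gcongr
      exact hd K p.1
  have h3 := (Real.continuous_sqrt.tendsto 0).comp h2
  simpa [Function.comp_def, Real.sqrt_sq] using h3

end

/-! ### Elements that are optimal between all eigenstates -/

section

variable {lam : ℝ} {hlam : 0 < lam}

/-- `𝓛(∂f)` is bounded by `1/√2`, by its matrix elements with normalized `𝓛(∂f) ψ`. -/
lemma norm_dz_leftMul_le {f : ℝ × ℝ → ℂ} (hlam : 0 < lam) (hf : IsMultiplier lam f)
    (h1 : commNorm (leftOp lam f) ≤ 1) {ψ : Sch} (hψ : ‖emb ψ‖ ≤ 1) :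
    ‖emb (leftMul lam (dz f) ψ)‖ ≤ 1 / Real.sqrt 2 := by
  obtain ⟨χ, hχ⟩ : ∃ χ, χ = leftMul lam (dz f) ψ := ⟨_, rfl⟩
  rw [← hχ]
  rcases eq_or_ne ‖emb χ‖ 0 with h0 | h0
  · rw [h0]; positivity
  have h := norm_inner_dz_le hlam hf h1 (φ := ((‖emb χ‖⁻¹ : ℝ) : ℂ) • χ) (ψ := ψ)
    (by rw [emb_smul, norm_smul, Complex.norm_real, norm_inv, norm_norm, inv_mul_cancel₀ h0]) hψ
  rw [← hχ, emb_smul, inner_smul_left, inner_self_eq_norm_sq_to_K, norm_mul, RCLike.norm_conj,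
    Complex.norm_real, norm_inv, norm_norm] at h
  have h3 : ‖((‖emb χ‖ : ℝ) : ℂ) ^ 2‖ = ‖emb χ‖ ^ 2 := by
    rw [norm_pow, Complex.norm_real, norm_norm]
  calc ‖emb χ‖ = ‖emb χ‖⁻¹ * ‖emb χ‖ ^ 2 := by field_simp
    _ ≤ _ := by rw [← h3]; exact h

/-- Equality in the Cauchy-Schwarz inequality against a unit vector. -/
lemma eq_smul_of_norm_le {e y : L2} (he : ‖e‖ = 1) (h : ‖y‖ ≤ ‖⟪e, y⟫_ℂ‖) : y = ⟪e, y⟫_ℂ • e := by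
  have h1 : ‖y - ⟪e, y⟫_ℂ • e‖ ^ 2 = ‖y‖ ^ 2 - ‖⟪e, y⟫_ℂ‖ ^ 2 := by
    have h2 := norm_sub_sq (𝕜 := ℂ) y (⟪e, y⟫_ℂ • e)
    rw [inner_smul_right, ← inner_conj_symm y e, norm_smul, he, mul_one, Complex.mul_conj,
      Complex.normSq_eq_norm_sq] at h2
    rw [h2, show RCLike.re ((‖⟪e, y⟫_ℂ‖ ^ 2 : ℝ) : ℂ) = ‖⟪e, y⟫_ℂ‖ ^ 2 from Complex.ofReal_re _]; ring
  have h3 : ‖y - ⟪e, y⟫_ℂ • e‖ = 0 := by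
    have : ‖y‖ ^ 2 ≤ ‖⟪e, y⟫_ℂ‖ ^ 2 := pow_le_pow_left₀ (norm_nonneg _) h 2
    nlinarith [norm_nonneg (y - ⟪e, y⟫_ℂ • e)]
  exact sub_eq_zero.1 (norm_eq_zero.1 h3)

/-- If all consecutive differences of expectation values saturate the bound, `𝓛(∂l)` is a
weighted shift with weights of modulus `1/√2`. -/
lemma dz_h_of_saturated {l : ℝ × ℝ → ℂ} (hl : IsMultiplier lam l)
    (h1 : commNorm (leftOp lam l) ≤ 1)
    (hs : ∀ m : ℕ, ‖⟪emb ((moyalLadder lam hlam).h (m + 1) 0),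
          emb (leftMul lam l ((moyalLadder lam hlam).h (m + 1) 0))⟫_ℂ -
        ⟪emb ((moyalLadder lam hlam).h m 0),
          emb (leftMul lam l ((moyalLadder lam hlam).h m 0))⟫_ℂ‖ = lam / Real.sqrt (2 * (m + 1))) :
    ∃ g : ℕ → ℂ, (∀ m, ‖g m‖ ^ 2 = 1 / 2) ∧ ∀ m n,
      leftMul lam (dz l) ((moyalLadder lam hlam).h m n) = g m • (moyalLadder lam hlam).h (m + 1) n := by
  have hd := hl.dz hlam.ne'
  refine ⟨fun m => ⟪emb ((moyalLadder lam hlam).h (m + 1) 0),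
    emb (leftMul lam (dz l) ((moyalLadder lam hlam).h m 0))⟫_ℂ, ?_⟩
  have hg : ∀ m : ℕ, ‖⟪emb ((moyalLadder lam hlam).h (m + 1) 0),
      emb (leftMul lam (dz l) ((moyalLadder lam hlam).h m 0))⟫_ℂ‖ = 1 / Real.sqrt 2 := by
    intro m
    have e := congrArg norm (inner_h_sub hlam l hl m)
    rw [norm_mul, norm_mul, Complex.norm_real, Complex.norm_real, Real.norm_of_nonneg hlam.le,
      Real.norm_of_nonneg (by positivity), hs] at e
    have h5 : Real.sqrt (2 * (m + 1)) = Real.sqrt 2 * Real.sqrt ((m + 1 : ℕ) : ℝ) := by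
      rw [Real.sqrt_mul (by norm_num)]; push_cast; rfl
    have h7 : 0 < Real.sqrt ((m + 1 : ℕ) : ℝ) := Real.sqrt_pos.2 (by positivity)
    have h9 : 0 < Real.sqrt 2 := by positivity
    refine mul_left_cancel₀ hlam.ne' ?_
    rw [← e, h5]; field_simp
  refine ⟨fun m => ?_, fun m n => ?_⟩
  · rw [hg, div_pow, Real.sq_sqrt (by norm_num)]; norm_num
  · induction n with
    | zero =>
      -- a vector of norm at most `1/√2` with a coordinate of modulus `1/√2` has no other coordinate
      refine emb_injective ?_
      rw [emb_smul]
      refine eq_smul_of_norm_le (norm_emb_h _ _) ?_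
      rw [hg]
      exact norm_dz_leftMul_le hlam hl h1 (by rw [norm_emb_h])
    -- left multiplications commute with the right multiplication `Cs`, which raises `n`
    | succ n ih =>
      rw [Ladder.h_succ_right, hd.leftMul_smul hlam.ne', ← Cs_leftMul hlam hd, ih, map_smul,
        Ladder.h_succ_right]
      module

/-- A weighted shift `𝓛(∂l)` with weights of modulus `1/√2` solves the equation. -/
theorem isSolution_of_shift {l : ℝ × ℝ → ℂ} (hl : IsMultiplier lam l) {g : ℕ → ℂ}
    (hg : ∀ m, ‖g m‖ ^ 2 = 1 / 2) (hs : ∀ m n,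
      leftMul lam (dz l) ((moyalLadder lam hlam).h m n) = g m • (moyalLadder lam hlam).h (m + 1) n) :
    IsSolution lam l := by
  have h0 : (lam : ℂ) ≠ 0 := by exact_mod_cast hlam.ne'
  have hd := hl.dz hlam.ne'
  have hz := isMultiplier_z hlam
  have hzb := isMultiplier_zbar hlam
  -- the symbol of `∂l ⋆ z`
  obtain ⟨P, hP⟩ : ∃ P : ℝ × ℝ → ℂ, P = fun x => 1 * (z x * dz l x) +
    -(lam ^ 2 / 2 : ℂ) * dzb (dz l) x := ⟨_, rfl⟩
  have hPm : IsMultiplier lam P := by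
    rw [hP]
    exact ((hd.z_mul hlam.ne').const_mul hlam.ne' _).add hlam.ne'
      ((hd.dzb hlam.ne').const_mul hlam.ne' _)
  have hPe : ∀ ψ, leftMul lam P ψ = leftMul lam (dz l) (leftMul lam z ψ) := by
    intro ψ
    rw [hP, leftMul_lin_left hlam.ne' (hd.z_mul hlam.ne') (hd.dzb hlam.ne'), leftMul_z_mul hlam hd,
      A_leftMul hlam hd, leftMul_z hlam, hd.leftMul_smul hlam.ne']
    match_scalars <;> (field_simp; try ring)
  -- the symbol of `½ z̄ ⋆ z`
  obtain ⟨R, hR⟩ : ∃ R : ℝ × ℝ → ℂ, R = fun x => (1 / 2 : ℂ) * (z x * zbar x) +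
    -(lam ^ 2 / 4 : ℂ) * 1 := ⟨_, rfl⟩
  have hRm : IsMultiplier lam R := by
    rw [hR]
    exact ((hzb.z_mul hlam.ne').const_mul hlam.ne' _).add hlam.ne'
      ((isMultiplier_one hlam).const_mul hlam.ne' _)
  have hRe : ∀ ψ, leftMul lam R ψ =
      (lam ^ 2 / 2 : ℂ) • (moyalLadder lam hlam).As ((moyalLadder lam hlam).A ψ) := by
    intro ψ
    rw [hR, leftMul_lin_left hlam.ne' (hzb.z_mul hlam.ne') (isMultiplier_one hlam),
      leftMul_z_mul hlam hzb, one_leftMul hlam, leftMul_zbar hlam, leftMul_zbar hlam, map_smul,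
      (moyalLadder lam hlam).A_As]
    module
  -- at `m = 0` the truncated `m - 1` is immaterial, since `√m = 0`
  have hPd : IsDiag hlam P fun m => lam * Real.sqrt m * g (m - 1) := by
    intro m n
    rw [hPe, leftMul_z hlam, hd.leftMul_smul hlam.ne']
    rcases m with _ | m
    · rw [Ladder.A_h_zero, ← zero_smul ℂ (0 : Sch), hd.leftMul_smul hlam.ne']
      simp
    · rw [Ladder.A_h_succ, hd.leftMul_smul hlam.ne', hs]
      dsimp only
      rw [Nat.add_sub_cancel]
      module
  refine ⟨P, R, ⟨hd, hz, hPm, hPe⟩, ⟨hPm, hPm.conj, hRm, fun ψ => ?_⟩,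
    ⟨hzb.const_mul hlam.ne' _, hz, hRm, fun ψ => ?_⟩⟩
  · refine (moyalLadder lam hlam).ext_inner fun m n => ?_
    rw [hPd.inner' hPm, hPd.inner hPm, hRe, emb_smul, inner_smul_right,
      ← (moyalLadder lam hlam).inner_As_A, ((moyalLadder lam hlam).As_A_C_h m n).1, emb_smul,
      inner_smul_left, Complex.conj_natCast, ← mul_assoc, ← mul_assoc]
    congr 1
    rw [Complex.mul_conj, Complex.normSq_eq_norm_sq, norm_mul, norm_mul, Complex.norm_real,
      Complex.norm_real, mul_pow, mul_pow, hg, Real.norm_eq_abs, Real.norm_eq_abs, sq_abs, sq_abs,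
      Real.sq_sqrt (by positivity)]
    push_cast; ring
  · rw [leftMul_smul_left hlam.ne' hzb, hRe, leftMul_z hlam, leftMul_zbar hlam, map_smul]
    module

end

/-! ### The eigenstates in the Schrödinger representation -/

/-- Schwartz functions on the line. -/
abbrev Sch1 : Type := SchwartzMap ℝ ℂ

/-- Multiplication by the coordinate. -/
def mulX : Sch1 →ₗ[ℂ] Sch1 :=
  (SchwartzMap.smulLeftCLM ℂ (fun x : ℝ => (x : ℂ))).toLinearMap

/-- The derivative. -/
def derS : Sch1 →ₗ[ℂ] Sch1 := (SchwartzMap.derivCLM ℂ ℂ).toLinearMap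

lemma mulX_apply (φ : Sch1) (x : ℝ) : mulX φ x = (x : ℂ) * φ x := by
  have h : (fun x : ℝ => (x : ℂ)).HasTemperateGrowth := Complex.ofRealCLM.hasTemperateGrowth
  simp [mulX, SchwartzMap.smulLeftCLM_apply_apply h]

lemma hasDerivAt_sch1 (φ : Sch1) (x : ℝ) : HasDerivAt φ (derS φ x) x := by
  have h := (φ.differentiableAt (x := x)).hasDerivAt
  exact h

/-- The phase of the Weyl operators. -/
def weyl (lam : ℝ) (p : ℝ × (ℝ × ℝ)) : ℂ :=
  Complex.exp ((Complex.I / ((lam ^ 2 : ℝ) : ℂ)) * ((p.2.1 * (p.1 + p.2.2 / 2) : ℝ) : ℂ))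

lemma norm_weyl (lam : ℝ) (p : ℝ × (ℝ × ℝ)) : ‖weyl lam p‖ = 1 := by
  have : (Complex.I / ((lam ^ 2 : ℝ) : ℂ)) * ((p.2.1 * (p.1 + p.2.2 / 2) : ℝ) : ℂ) =
      ((p.2.1 * (p.1 + p.2.2 / 2) / lam ^ 2 : ℝ) : ℂ) * Complex.I := by
    push_cast; ring
  rw [weyl, this, Complex.norm_exp_ofReal_mul_I]

/-- The integrand of the Weyl transform. -/
def tker (lam : ℝ) (F : Sch) (φ ψ : Sch1) (p : ℝ × (ℝ × ℝ)) : ℂ :=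
  φ p.1 * F p.2 * weyl lam p * ψ (p.1 + p.2.2)

/-- The matrix element `∫∫ φ(x) F(k) exp((i/θ) k₁ (x + k₂/2)) ψ(x + k₂) dk dx`. -/
def tform (lam : ℝ) (F : Sch) (φ ψ : Sch1) : ℂ := ∫ p, tker lam F φ ψ p

lemma integrable_tker (lam : ℝ) (F : Sch) (φ ψ : Sch1) : Integrable (tker lam F φ ψ) := by
  obtain ⟨C, hC⟩ := ψ.decay 0 0
  have h : Integrable (fun p : ℝ × (ℝ × ℝ) => φ p.1 * F p.2) :=
    (φ.integrable (μ := volume)).mul_prod (sch_integrable F)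
  have h2 : Integrable (fun p : ℝ × (ℝ × ℝ) => φ p.1 * F p.2 * weyl lam p) :=
    h.mul_bdd (c := 1) (Continuous.aestronglyMeasurable (by unfold weyl; fun_prop))
      (Eventually.of_forall fun p => (norm_weyl lam p).le)
  refine h2.mul_bdd (c := C) (Continuous.aestronglyMeasurable (by fun_prop))
    (Eventually.of_forall fun p => ?_)
  simpa using hC.2 (p.1 + p.2.2)

/-- The integral of a directional derivative vanishes. -/
lemma integral_hasLineDerivAt_eq_zero {H H' : ℝ × (ℝ × ℝ) → ℂ} {v : ℝ × (ℝ × ℝ)}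
    (hH : Integrable H) (hH' : Integrable H') (hd : ∀ x, HasLineDerivAt ℝ H (H' x) x v) :
    ∫ x, H' x = 0 := by
  have : (volume : Measure (ℝ × (ℝ × ℝ))).IsAddHaarMeasure :=
    Measure.prod.instIsAddHaarMeasure (volume : Measure ℝ) (volume : Measure (ℝ × ℝ))
  have h := integral_bilinear_hasLineDerivAt_right_eq_neg_left_of_integrable (μ := volume)
    (f := H) (f' := H') (g := fun _ => (1 : ℂ)) (g' := fun _ => 0) (v := v)
    (B := ContinuousLinearMap.mul ℝ ℂ) (by simpa using hH') (by simp) (by simpa using hH)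
    (fun x _ => hd x) fun x _ => by simp [HasLineDerivAt, hasDerivAt_const]
  simpa using h.symm

/-- The relations between matrix elements given by integration by parts in the direction
`(a, (b, c))`. -/
lemma tform_parts (lam : ℝ) (F : Sch) (φ ψ : Sch1) (a b c : ℝ) :
    a * tform lam F (derS φ) ψ + b * tform lam (D1 F) φ ψ + c * tform lam (D2 F) φ ψ +
      Complex.I / lam ^ 2 * (b * (tform lam F (mulX φ) ψ + 1 / 2 * tform lam (X2 F) φ ψ) +
        (a + c / 2) * tform lam (X1 F) φ ψ) + (a + c) * tform lam F φ (derS ψ) = 0 := by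
  have i := integrable_tker lam
  have i1 := i F (derS φ) ψ
  have i2 := i (D1 F) φ ψ
  have i3 := i (D2 F) φ ψ
  have i4 := i F (mulX φ) ψ
  have i5 := i (X2 F) φ ψ
  have i6 := i (X1 F) φ ψ
  have i7 := i F φ (derS ψ)
  have e : ∀ p : ℝ × (ℝ × ℝ), HasLineDerivAt ℝ (tker lam F φ ψ)
      (a * tker lam F (derS φ) ψ p + b * tker lam (D1 F) φ ψ p + c * tker lam (D2 F) φ ψ p +
      Complex.I / lam ^ 2 * (b * (tker lam F (mulX φ) ψ p + 1 / 2 * tker lam (X2 F) φ ψ p) +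
        (a + c / 2) * tker lam (X1 F) φ ψ p) + (a + c) * tker lam F φ (derS ψ) p) p (a, (b, c)) := by
    rintro ⟨x, k⟩
    have hl : ∀ y d : ℝ, HasDerivAt (fun t : ℝ => y + t * d) d 0 := fun y d => by
      simpa using ((hasDerivAt_id (0 : ℝ)).mul_const d).const_add y
    have h1 : HasDerivAt (fun t : ℝ => φ (x + t * a)) (a * derS φ x) 0 := by
      have := (hasDerivAt_sch1 φ (x + 0 * a)).scomp (0 : ℝ) (hl x a)
      simpa [Function.comp_def] using this
    have h2 : HasDerivAt (fun t : ℝ => F (k + t • (b, c))) (b * D1 F k + c * D2 F k) 0 := by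
      have := (hasFDerivAt_sch F k).hasLineDerivAt (b, c)
      simpa [HasLineDerivAt] using this
    have h3 : HasDerivAt (fun t : ℝ => ψ (x + k.2 + t * (a + c))) ((a + c) * derS ψ (x + k.2)) 0 := by
      have := (hasDerivAt_sch1 ψ (x + k.2 + 0 * (a + c))).scomp (0 : ℝ) (hl (x + k.2) (a + c))
      simpa [Function.comp_def] using this
    have h4 : HasDerivAt (fun t : ℝ => Complex.exp ((Complex.I / ((lam ^ 2 : ℝ) : ℂ)) *
        (((k.1 + t * b) * ((x + t * a) + (k.2 + t * c) / 2) : ℝ) : ℂ)))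
        (weyl lam (x, k) * (Complex.I / lam ^ 2 * (b * (x + k.2 / 2) + k.1 * (a + c / 2)))) 0 := by
      have h5 := ((hl k.1 b).mul ((hl x a).add ((hl k.2 c).div_const 2))).ofReal_comp.const_mul
        (Complex.I / ((lam ^ 2 : ℝ) : ℂ))
      have h6 := h5.cexp
      refine h6.congr_deriv ?_
      simp [weyl]
    have h := ((h1.mul h2).mul h4).mul h3
    have hf : (fun t : ℝ => tker lam F φ ψ ((x, k) + t • (a, (b, c)))) = fun t =>
        φ (x + t * a) * F (k + t • (b, c)) * Complex.exp ((Complex.I / ((lam ^ 2 : ℝ) : ℂ)) *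
        (((k.1 + t * b) * ((x + t * a) + (k.2 + t * c) / 2) : ℝ) : ℂ)) *
        ψ (x + k.2 + t * (a + c)) := by
      funext t
      have : x + t * a + (k.2 + t * c) = x + k.2 + t * (a + c) := by ring
      simp only [tker, weyl, Prod.fst_add, Prod.snd_add, Prod.smul_mk, smul_eq_mul, this]
    change HasDerivAt _ _ 0
    rw [hf]
    refine h.congr_deriv ?_
    simp only [Pi.mul_apply, zero_mul, add_zero, zero_smul, tker, mulX_apply, X1_apply, X2_apply]
    rw [← show weyl lam (x, k) = Complex.exp ((Complex.I / ((lam ^ 2 : ℝ) : ℂ)) *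
      ((k.1 * (x + k.2 / 2) : ℝ) : ℂ)) from rfl]
    ring
  have h := integral_hasLineDerivAt_eq_zero (i F φ ψ) ?_ e
  · rw [← h]
    simp only [tform]
    rw [integral_add, integral_add, integral_add, integral_add, integral_const_mul,
      integral_const_mul, integral_const_mul, integral_const_mul, integral_const_mul, integral_add,
      integral_const_mul, integral_const_mul, integral_add, integral_const_mul]
    all_goals fun_prop (disch := assumption)
  · exact ((((((i F (derS φ) ψ).const_mul _).add ((i (D1 F) φ ψ).const_mul _)).add
      ((i (D2 F) φ ψ).const_mul _)).add (((((i F (mulX φ) ψ).add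
        ((i (X2 F) φ ψ).const_mul _)).const_mul _).add ((i (X1 F) φ ψ).const_mul _)).const_mul _)).add
      ((i F φ (derS ψ)).const_mul _))

section

variable (lam : ℝ)

lemma tform_add_fst (F G : Sch) (φ ψ : Sch1) :
    tform lam (F + G) φ ψ = tform lam F φ ψ + tform lam G φ ψ := by
  rw [tform, tform, tform, ← integral_add (integrable_tker lam F φ ψ) (integrable_tker lam G φ ψ)]
  congr 1; ext p; simp only [tker, add_apply]; ring

lemma tform_smul_fst (c : ℂ) (F : Sch) (φ ψ : Sch1) :
    tform lam (c • F) φ ψ = c * tform lam F φ ψ := by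
  rw [tform, tform, ← integral_const_mul]
  congr 1; ext p; simp only [tker, smul_apply, smul_eq_mul]; ring

lemma tform_sub_snd (F : Sch) (φ χ ψ : Sch1) :
    tform lam F (φ - χ) ψ = tform lam F φ ψ - tform lam F χ ψ := by
  rw [tform, tform, tform, ← integral_sub (integrable_tker lam F φ ψ) (integrable_tker lam F χ ψ)]
  congr 1; ext p; simp only [tker, sub_apply]; ring

lemma tform_smul_snd (c : ℂ) (F : Sch) (φ ψ : Sch1) :
    tform lam F (c • φ) ψ = c * tform lam F φ ψ := by
  rw [tform, tform, ← integral_const_mul]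
  congr 1; ext p; simp only [tker, smul_apply, smul_eq_mul]; ring

lemma tform_sub_thd (F : Sch) (φ ψ χ : Sch1) :
    tform lam F φ (ψ - χ) = tform lam F φ ψ - tform lam F φ χ := by
  rw [tform, tform, tform, ← integral_sub (integrable_tker lam F φ ψ) (integrable_tker lam F φ χ)]
  congr 1; ext p; simp only [tker, sub_apply]; ring

lemma tform_smul_thd (c : ℂ) (F : Sch) (φ ψ : Sch1) :
    tform lam F φ (c • ψ) = c * tform lam F φ ψ := by
  rw [tform, tform, ← integral_const_mul]
  congr 1; ext p; simp only [tker, smul_apply, smul_eq_mul]; ring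

/-- The multiplication operator moves from the ket to the bra across the Weyl operators, which
translate by `k₂`. -/
lemma tform_mulX (F : Sch) (φ ψ : Sch1) :
    tform lam F φ (mulX ψ) = tform lam F (mulX φ) ψ + tform lam (X2 F) φ ψ := by
  rw [tform, tform, tform, ← integral_add (integrable_tker lam F (mulX φ) ψ)
    (integrable_tker lam (X2 F) φ ψ)]
  congr 1; ext p; simp only [tker, mulX_apply, X2_apply]; push_cast; ring

/-- The map `(k₁, k₂) ↦ (-k₂/2, k₁/2)` that turns the symplectic Fourier transform into the Fourier
transform. -/
def rotEquiv : (ℝ × ℝ) ≃L[ℝ] (ℝ × ℝ) :=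
  ContinuousLinearEquiv.equivOfInverse
    (((-1 / 2 : ℝ) • ContinuousLinearMap.snd ℝ ℝ ℝ).prod
      ((1 / 2 : ℝ) • ContinuousLinearMap.fst ℝ ℝ ℝ))
    (((2 : ℝ) • ContinuousLinearMap.snd ℝ ℝ ℝ).prod ((-2 : ℝ) • ContinuousLinearMap.fst ℝ ℝ ℝ))
    (fun x => by ext <;> (simp; try ring)) fun x => by ext <;> (simp; try ring)

lemma rotEquiv_apply (k : ℝ × ℝ) : rotEquiv k = (-1 / 2 * k.2, 1 / 2 * k.1) := by
  simp [rotEquiv, ContinuousLinearEquiv.equivOfInverse]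

/-- The Fourier transform of a Schwartz function, as a Schwartz function. -/
def fhatS (f : Sch) : Sch :=
  ((1 / (2 * Real.pi * lam ^ 2) ^ 2 : ℝ) : ℂ) •
    SchwartzMap.compCLMOfContinuousLinearEquiv ℂ rotEquiv (sft lam f)

variable {lam}

lemma fhatS_apply (hlam : lam ≠ 0) (f : Sch) (k : ℝ × ℝ) : fhatS lam f k =
    ((1 / (2 * Real.pi * lam ^ 2) ^ 2 : ℝ) : ℂ) * sftFun lam f (rotEquiv k) := by
  rw [fhatS, smul_apply, smul_eq_mul, SchwartzMap.compCLMOfContinuousLinearEquiv_apply,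
    Function.comp_apply, sft_apply hlam]

lemma fhatS_eq_fhat (hlam : lam ≠ 0) (f : Sch) (k : ℝ × ℝ) : fhatS lam f k = fhat lam f k := by
  rw [fhatS_apply hlam, fhat, sftFun]
  congr 2; ext x
  rw [osc, rotEquiv_apply]
  congr 2; push_cast; ring

lemma X1_fhatS (hlam : lam ≠ 0) (f : Sch) :
    X1 (fhatS lam f) = (-Complex.I * lam ^ 2) • fhatS lam (D1 f) := by
  have hl : (lam : ℂ) ≠ 0 := by exact_mod_cast hlam
  ext k
  rw [X1_apply, smul_apply, fhatS_apply hlam, fhatS_apply hlam, sftFun_D1, rotEquiv_apply, smul_eq_mul]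
  push_cast; field_simp; rw [Complex.I_sq]; ring

lemma X2_fhatS (hlam : lam ≠ 0) (f : Sch) :
    X2 (fhatS lam f) = (-Complex.I * lam ^ 2) • fhatS lam (D2 f) := by
  have hl : (lam : ℂ) ≠ 0 := by exact_mod_cast hlam
  ext k
  rw [X2_apply, smul_apply, fhatS_apply hlam, fhatS_apply hlam, sftFun_D2, rotEquiv_apply, smul_eq_mul]
  push_cast; field_simp; rw [Complex.I_sq]; ring

lemma hasFDerivAt_fhatS (hlam : lam ≠ 0) (f : Sch) (k : ℝ × ℝ) :
    HasFDerivAt (fhatS lam f) (pd (-(Complex.I / lam ^ 2) * fhatS lam (X1 f) k)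
      (-(Complex.I / lam ^ 2) * fhatS lam (X2 f) k)) k := by
  have h := ((hasFDerivAt_sftFun lam f (rotEquiv k)).comp k
    (rotEquiv : (ℝ × ℝ) →L[ℝ] (ℝ × ℝ)).hasFDerivAt).const_mul
      ((1 / (2 * Real.pi * lam ^ 2) ^ 2 : ℝ) : ℂ)
  rw [show (fhatS lam f : ℝ × ℝ → ℂ) = fun k => ((1 / (2 * Real.pi * lam ^ 2) ^ 2 : ℝ) : ℂ) *
    (sftFun lam f ∘ rotEquiv) k from funext (fhatS_apply hlam f)]
  refine h.congr_fderiv (pd_ext ?_ ?_)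
  · rw [fhatS_apply hlam]
    simp only [sftFun_smul, smul_apply, ContinuousLinearMap.comp_apply,
      ContinuousLinearEquiv.coe_coe, pd_apply, rotEquiv_apply, smul_eq_mul]
    push_cast; ring
  · rw [fhatS_apply hlam]
    simp only [sftFun_smul, smul_apply, ContinuousLinearMap.comp_apply,
      ContinuousLinearEquiv.coe_coe, pd_apply, rotEquiv_apply, smul_eq_mul]
    push_cast; ring

lemma D1_fhatS (hlam : lam ≠ 0) (f : Sch) :
    D1 (fhatS lam f) = (-(Complex.I / lam ^ 2)) • fhatS lam (X1 f) := by
  ext k; rw [D1_eq_of_hasFDerivAt (hasFDerivAt_fhatS hlam f k)]; rfl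

lemma D2_fhatS (hlam : lam ≠ 0) (f : Sch) :
    D2 (fhatS lam f) = (-(Complex.I / lam ^ 2)) • fhatS lam (X2 f) := by
  ext k; rw [D2_eq_of_hasFDerivAt (hasFDerivAt_fhatS hlam f k)]; rfl

lemma fhatS_add (hlam : lam ≠ 0) (f g : Sch) : fhatS lam (f + g) = fhatS lam f + fhatS lam g := by
  rw [fhatS, fhatS, fhatS, sft_add hlam, map_add, smul_add]

lemma fhatS_smul (hlam : lam ≠ 0) (c : ℂ) (f : Sch) : fhatS lam (c • f) = c • fhatS lam f := by
  rw [fhatS, fhatS, sft_smul hlam, map_smul, smul_comm]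

variable (lam) in
/-- The creation operator `(x - θ d/dx) / (√2 λ)` on the line. -/
def raise (φ : Sch1) : Sch1 :=
  (1 / (Real.sqrt 2 * lam) : ℂ) • (mulX φ - (lam ^ 2 : ℂ) • derS φ)

/-- The matrix element of the Weyl transform of `f`, rewritten for each of the first order
operators on `f`. -/
lemma tform_fhatS_rules (hlam : lam ≠ 0) (f : Sch) (φ ψ : Sch1) :
    tform lam (fhatS lam (X1 f)) φ ψ = tform lam (fhatS lam f) (mulX φ) ψ -
      Complex.I * lam ^ 2 / 2 * tform lam (fhatS lam (D2 f)) φ ψ ∧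
    tform lam (fhatS lam (X2 f)) φ ψ = -(Complex.I * lam ^ 2 / 2) *
      tform lam (fhatS lam (D1 f)) φ ψ - Complex.I * lam ^ 2 * tform lam (fhatS lam f) φ (derS ψ) ∧
    tform lam (fhatS lam f) (derS φ) ψ = -tform lam (fhatS lam (D1 f)) φ ψ -
      tform lam (fhatS lam f) φ (derS ψ) ∧
    tform lam (fhatS lam f) φ (mulX ψ) = tform lam (fhatS lam f) (mulX φ) ψ -
      Complex.I * lam ^ 2 * tform lam (fhatS lam (D2 f)) φ ψ := by
  have hl : (lam : ℂ) ≠ 0 := by exact_mod_cast hlam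
  have h1 := tform_parts lam (fhatS lam f) φ ψ 0 1 0
  have h2 := tform_parts lam (fhatS lam f) φ ψ 0 0 1
  have h3 := tform_parts lam (fhatS lam f) φ ψ 1 0 0
  have h4 := tform_mulX lam (fhatS lam f) φ ψ
  rw [D1_fhatS hlam, D2_fhatS hlam, X1_fhatS hlam, X2_fhatS hlam] at h1 h2 h3
  rw [X2_fhatS hlam] at h4
  simp only [tform_smul_fst, Complex.ofReal_zero, Complex.ofReal_one, zero_mul, one_mul, zero_add,
    add_zero, zero_div] at h1 h2 h3 h4
  obtain ⟨j, hj⟩ : ∃ j, j = Complex.I / (lam : ℂ) ^ 2 := ⟨_, rfl⟩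
  have hj2 : j * (Complex.I * lam ^ 2) = -1 := by
    rw [hj]; field_simp; exact Complex.I_sq
  rw [← hj] at h1 h2 h3
  refine ⟨?_, ?_, ?_, ?_⟩
  · linear_combination (Complex.I * lam ^ 2) * h1 - (tform lam (fhatS lam (X1 f)) φ ψ * -1 +
      (tform lam (fhatS lam f) (mulX φ) ψ - Complex.I * lam ^ 2 / 2 *
        tform lam (fhatS lam (D2 f)) φ ψ)) * hj2
  · linear_combination (Complex.I * lam ^ 2) * h2 - (tform lam (fhatS lam (X2 f)) φ ψ * -1 -
      Complex.I * lam ^ 2 / 2 * tform lam (fhatS lam (D1 f)) φ ψ) * hj2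
  · linear_combination h3 + tform lam (fhatS lam (D1 f)) φ ψ * hj2
  · rw [h4]; ring

end

section

variable {lam : ℝ} (hlam : 0 < lam)

lemma moyalLadder_A_apply (f : Sch) : (moyalLadder lam hlam).A f =
    (1 / (Real.sqrt 2 * lam) : ℂ) • (X1 f + Complex.I • X2 f +
      (lam ^ 2 / 2 : ℂ) • (D1 f + Complex.I • D2 f)) := by
  have hl : (lam : ℂ) ≠ 0 := by exact_mod_cast hlam.ne'
  have h3 := ofReal_sqrt_two_ne_zero
  simp only [moyalLadder, lin_apply]
  match_scalars <;> field_simp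

lemma moyalLadder_C_apply (f : Sch) : (moyalLadder lam hlam).C f =
    (1 / (Real.sqrt 2 * lam) : ℂ) • (X1 f + -Complex.I • X2 f +
      (lam ^ 2 / 2 : ℂ) • (D1 f + -Complex.I • D2 f)) := by
  have hl : (lam : ℂ) ≠ 0 := by exact_mod_cast hlam.ne'
  have h3 := ofReal_sqrt_two_ne_zero
  simp only [moyalLadder, lin_apply]
  match_scalars <;> field_simp

/-- Replacing `f` by `A f` amounts to raising the bra. -/
lemma tform_fhatS_A (f : Sch) (φ ψ : Sch1) :
    tform lam (fhatS lam ((moyalLadder lam hlam).A f)) φ ψ =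
      tform lam (fhatS lam f) (raise lam φ) ψ := by
  obtain ⟨h1, h2, h3, -⟩ := tform_fhatS_rules hlam.ne' f φ ψ
  simp only [moyalLadder_A_apply, fhatS_add hlam.ne', fhatS_smul hlam.ne', tform_add_fst,
    tform_smul_fst, raise, tform_smul_snd, tform_sub_snd]
  rw [h1, h2, h3]
  linear_combination (-(lam ^ 2 / 2 * tform lam (fhatS lam (D1 f)) φ ψ +
    lam ^ 2 * tform lam (fhatS lam f) φ (derS ψ)) * (1 / (Real.sqrt 2 * lam) : ℂ)) * Complex.I_sq

/-- Replacing `f` by `C f` amounts to raising the ket. -/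
lemma tform_fhatS_C (f : Sch) (φ ψ : Sch1) :
    tform lam (fhatS lam ((moyalLadder lam hlam).C f)) φ ψ =
      tform lam (fhatS lam f) φ (raise lam ψ) := by
  obtain ⟨h1, h2, -, h4⟩ := tform_fhatS_rules hlam.ne' f φ ψ
  simp only [moyalLadder_C_apply, fhatS_add hlam.ne', fhatS_smul hlam.ne', tform_add_fst,
    tform_smul_fst, raise, tform_smul_thd, tform_sub_thd]
  rw [h1, h2, h4]
  linear_combination ((lam ^ 2 / 2 * tform lam (fhatS lam (D1 f)) φ ψ +
    lam ^ 2 * tform lam (fhatS lam f) φ (derS ψ)) * (1 / (Real.sqrt 2 * lam) : ℂ)) * Complex.I_sq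

lemma coe_A (f : Sch) : ((moyalLadder lam hlam).A f : ℝ × ℝ → ℂ) = fun x =>
    (1 / lam : ℂ) * (z x * f x) + (lam / 2 : ℂ) * dzb f x := by
  have hl : (lam : ℂ) ≠ 0 := by exact_mod_cast hlam.ne'
  have h3 := ofReal_sqrt_two_ne_zero
  ext x
  simp only [moyalLadder, lin_apply, add_apply, smul_apply, X1_apply, X2_apply, smul_eq_mul,
    congrFun (z_mul_eq f) x, dzb, D1_apply, D2_apply]
  field_simp
  ring

lemma coe_C (f : Sch) : ((moyalLadder lam hlam).C f : ℝ × ℝ → ℂ) = fun x =>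
    (1 / lam : ℂ) * (zbar x * f x) + (lam / 2 : ℂ) * dz f x := by
  have hl : (lam : ℂ) ≠ 0 := by exact_mod_cast hlam.ne'
  have h3 := ofReal_sqrt_two_ne_zero
  ext x
  simp only [moyalLadder, lin_apply, add_apply, smul_apply, X1_apply, X2_apply, smul_eq_mul,
    congrFun (zbar_mul_eq f) x, dz, D1_apply, D2_apply]
  field_simp
  ring

/-- Associativity of the Moyal product, `(z ⋆ f) ⋆ ψ = z ⋆ (f ⋆ ψ)`. -/
lemma leftMul_A (f ψ : Sch) : leftMul lam ((moyalLadder lam hlam).A f) ψ =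
    (moyalLadder lam hlam).A (leftMul lam f ψ) := by
  have hl : (lam : ℂ) ≠ 0 := by exact_mod_cast hlam.ne'
  have hf := isMultiplier_sch hlam f
  have e := A_leftMul hlam hf ψ
  rw [coe_A, leftMul_lin_left hlam.ne' (hf.z_mul hlam.ne') (hf.dzb hlam.ne'),
    leftMul_z_mul hlam hf, e]
  match_scalars <;> (field_simp; try ring)

/-- Associativity of the Moyal product, `(f ⋆ z̄) ⋆ ψ = f ⋆ (z̄ ⋆ ψ)`. -/
lemma leftMul_C (f ψ : Sch) : leftMul lam ((moyalLadder lam hlam).C f) ψ =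
    leftMul lam f ((moyalLadder lam hlam).As ψ) := by
  have hl : (lam : ℂ) ≠ 0 := by exact_mod_cast hlam.ne'
  have hf := isMultiplier_sch hlam f
  have e := As_leftMul hlam hf ψ
  rw [coe_C, leftMul_lin_left hlam.ne' (hf.zbar_mul hlam.ne') (hf.dz hlam.ne'),
    leftMul_zbar_mul hlam hf, e]
  match_scalars <;> (field_simp; try ring)

end

/-- The restriction of a Schwartz function on the plane to the first axis. -/
def axisS (ψ : Sch) : Sch1 :=
  SchwartzMap.compCLMOfAntilipschitz ℂ (K := 1) (g := fun x : ℝ => (x, (0 : ℝ)))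
    (ContinuousLinearMap.inl ℝ ℝ ℝ).hasTemperateGrowth
    (Isometry.antilipschitz (Isometry.of_dist_eq fun x y => by simp [Prod.dist_eq])) ψ

lemma axisS_apply (ψ : Sch) (x : ℝ) : axisS ψ x = ψ (x, 0) := rfl

/-- The eigenfunctions of the oscillator, as Schwartz functions, obtained from the Gaussian by the
creation operator. -/
def eigS (lam : ℝ) : ℕ → Sch1
  | 0 => ((1 / Real.sqrt (lam * Real.sqrt Real.pi) : ℝ) : ℂ) • axisS (gaussS (1 / (2 * lam ^ 2)))
  | m + 1 => ((Real.sqrt ((m + 1 : ℕ) : ℝ))⁻¹ : ℂ) • raise lam (eigS lam m)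

lemma eigS_zero_apply {lam : ℝ} (hlam : 0 < lam) (x : ℝ) : eigS lam 0 x =
    ((1 / Real.sqrt (lam * Real.sqrt Real.pi) : ℝ) : ℂ) *
      ((Real.exp (-x ^ 2 / (2 * lam ^ 2)) : ℝ) : ℂ) := by
  rw [eigS, smul_apply, smul_eq_mul, axisS_apply, gaussS_apply (by positivity)]
  congr 3
  ring

/-- The creation operator implements the recursion of the Hermite polynomials. -/
lemma eigS_apply {lam : ℝ} (hlam : 0 < lam) (m : ℕ) (x : ℝ) : eigS lam m x = eigenfun lam m x := by
  induction m generalizing x with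
  | zero =>
    rw [eigS_zero_apply hlam, eigenfun, ← Complex.ofReal_mul]
    congr 1
    simp
    ring
  | succ m ih =>
    obtain ⟨p, hp⟩ : ∃ p, p = Polynomial.hermite m := ⟨_, rfl⟩
    have hN : 0 < Real.sqrt ((m.factorial : ℝ) * lam * Real.sqrt Real.pi) := by
      have := Real.sqrt_pos.2 Real.pi_pos
      positivity
    have hN1 : Real.sqrt (((m + 1).factorial : ℝ) * lam * Real.sqrt Real.pi) =
        Real.sqrt ((m + 1 : ℕ) : ℝ) * Real.sqrt ((m.factorial : ℝ) * lam * Real.sqrt Real.pi) := by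
      rw [← Real.sqrt_mul (by positivity), Nat.factorial_succ]; push_cast; ring_nf
    have hm : (0 : ℝ) < Real.sqrt ((m + 1 : ℕ) : ℝ) := Real.sqrt_pos.2 (by positivity)
    have h2 : (0 : ℝ) < Real.sqrt 2 := by positivity
    have hs2 : Real.sqrt 2 ^ 2 = 2 := Real.sq_sqrt (by norm_num)
    have hd : HasDerivAt (eigS lam m) ((((Polynomial.aeval (Real.sqrt 2 * x / lam)
        (Polynomial.derivative p) : ℝ) * (Real.sqrt 2 / lam) *
        Real.exp (-x ^ 2 / (2 * lam ^ 2)) + (Polynomial.aeval (Real.sqrt 2 * x / lam) p : ℝ) *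
        (Real.exp (-x ^ 2 / (2 * lam ^ 2)) * (-(2 * x) / (2 * lam ^ 2)))) /
        Real.sqrt ((m.factorial : ℝ) * lam * Real.sqrt Real.pi) : ℝ) : ℂ) x := by
      rw [show (eigS lam m : ℝ → ℂ) = eigenfun lam m from funext ih]
      have a1 : HasDerivAt (fun x : ℝ => Real.sqrt 2 * x / lam) (Real.sqrt 2 / lam) x := by
        simpa using ((hasDerivAt_id x).const_mul (Real.sqrt 2)).div_const lam
      have a2 : HasDerivAt (fun x : ℝ => Real.exp (-x ^ 2 / (2 * lam ^ 2)))
          (Real.exp (-x ^ 2 / (2 * lam ^ 2)) * (-(2 * x) / (2 * lam ^ 2))) x := by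
        have := (((hasDerivAt_pow 2 x).neg).div_const (2 * lam ^ 2)).exp
        simpa using this
      have a3 : HasDerivAt (fun x : ℝ => (Polynomial.aeval (Real.sqrt 2 * x / lam) p : ℝ))
          ((Polynomial.aeval (Real.sqrt 2 * x / lam) (Polynomial.derivative p) : ℝ) *
            (Real.sqrt 2 / lam)) x :=
        HasDerivAt.comp (h₂ := fun y : ℝ => (Polynomial.aeval y p : ℝ)) x
          (p.hasDerivAt_aeval (Real.sqrt 2 * x / lam)) a1
      rw [hp] at a3 ⊢
      exact ((a3.mul a2).div_const _).ofReal_comp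
    have hd' := hd.unique (hasDerivAt_sch1 (eigS lam m) x)
    rw [eigS, smul_apply, smul_eq_mul, raise, smul_apply, smul_eq_mul, sub_apply, smul_apply,
      smul_eq_mul, mulX_apply, ← hd', ih, eigenfun, eigenfun, hN1, Polynomial.hermite_succ, ← hp]
    simp only [map_sub, map_mul, Polynomial.aeval_X]
    rw [← Complex.ofReal_inv]
    norm_cast
    field_simp
    ring_nf
    rw [hs2]
    ring

section

variable {lam : ℝ} (hlam : 0 < lam)

include hlam in
/-- The Weyl operators in the ground state. -/
lemma integral_weyl_eigS_zero (k : ℝ × ℝ) :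
    ∫ x, eigS lam 0 x * weyl lam (x, k) * eigS lam 0 (x + k.2) =
      Complex.exp (-((1 / (4 * lam ^ 2) : ℝ) : ℂ) * (k.1 ^ 2 + k.2 ^ 2)) := by
  have hl : (lam : ℂ) ≠ 0 := by exact_mod_cast hlam.ne'
  have hc : (1 / Real.sqrt (lam * Real.sqrt Real.pi)) ^ 2 * (lam * Real.sqrt Real.pi) = 1 := by
    have := Real.sqrt_pos.2 Real.pi_pos
    rw [div_pow, Real.sq_sqrt (by positivity)]; field_simp
  obtain ⟨c, hc'⟩ : ∃ c, c = 1 / Real.sqrt (lam * Real.sqrt Real.pi) := ⟨_, rfl⟩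
  have e : ∀ x : ℝ, eigS lam 0 x * weyl lam (x, k) * eigS lam 0 (x + k.2) =
      (c : ℂ) ^ 2 * Complex.exp (-((1 / lam ^ 2 : ℝ) : ℂ) * x ^ 2 +
        ((-k.2 + Complex.I * k.1) / lam ^ 2) * x +
        (-k.2 ^ 2 + Complex.I * k.1 * k.2) / (2 * lam ^ 2)) := by
    intro x
    rw [eigS_zero_apply hlam, eigS_zero_apply hlam, weyl, ← hc', Complex.ofReal_exp,
      Complex.ofReal_exp]
    rw [show ∀ a b d : ℂ, c * a * b * (c * d) = c ^ 2 * (a * b * d) by intros; ring,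
      ← Complex.exp_add, ← Complex.exp_add]
    congr 2
    push_cast
    field_simp
    ring
  simp_rw [e]
  have hb : 0 < 1 / lam ^ 2 := by positivity
  rw [integral_const_mul, integral_cexp_quadratic (by rw [Complex.neg_re, Complex.ofReal_re]; linarith)]
  have h1 : ((Real.pi : ℂ) / -(-((1 / lam ^ 2 : ℝ) : ℂ))) ^ (1 / 2 : ℂ) =
      ((lam * Real.sqrt Real.pi : ℝ) : ℂ) := by
    rw [show (Real.pi : ℂ) / -(-((1 / lam ^ 2 : ℝ) : ℂ)) = ((Real.pi * lam ^ 2 : ℝ) : ℂ) by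
      push_cast; field_simp, show (1 / 2 : ℂ) = ((1 / 2 : ℝ) : ℂ) by push_cast; rfl,
      ← Complex.ofReal_cpow (by positivity), ← Real.sqrt_eq_rpow, Real.sqrt_mul (by positivity),
      Real.sqrt_sq hlam.le, mul_comm]
  rw [h1, ← mul_assoc, ← Complex.ofReal_pow, ← Complex.ofReal_mul, hc', hc, Complex.ofReal_one,
    one_mul]
  congr 1
  push_cast
  field_simp
  ring_nf
  rw [Complex.I_sq]
  ring

include hlam in
/-- The expectation value of the Weyl transform of `f` in the ground state. -/
lemma tform_eigS_zero (f : Sch) : tform lam (fhatS lam f) (eigS lam 0) (eigS lam 0) =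
    (1 / (Real.pi * lam ^ 2) : ℂ) * ∫ x, f x * gaussS (1 / lam ^ 2) x := by
  have hl : (lam : ℂ) ≠ 0 := by exact_mod_cast hlam.ne'
  have hpi : (Real.pi : ℂ) ≠ 0 := by exact_mod_cast Real.pi_ne_zero
  have hb : 0 < 1 / (4 * lam ^ 2) := by positivity
  have h1 : tform lam (fhatS lam f) (eigS lam 0) (eigS lam 0) =
      ∫ k, fhatS lam f k * gaussS (1 / (4 * lam ^ 2)) k := by
    rw [tform]
    have := integral_prod_symm (μ := (volume : Measure ℝ)) (ν := (volume : Measure (ℝ × ℝ))) _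
      (integrable_tker lam (fhatS lam f) (eigS lam 0) (eigS lam 0))
    refine this.trans (integral_congr_ae (Eventually.of_forall fun k => ?_))
    dsimp only
    rw [gaussS_apply hb, Complex.ofReal_exp]
    push_cast
    have h := integral_weyl_eigS_zero hlam k
    push_cast at h
    rw [← h, ← integral_const_mul]
    congr 1; ext x; rw [tker]; ring
  obtain ⟨E, hE⟩ : ∃ E : ℝ × ℝ → ℝ × ℝ → ℂ, ∀ k x, E k x = Complex.exp
      (-(Complex.I / ((lam ^ 2 : ℝ) : ℂ)) * ((k.1 * x.1 + k.2 * x.2 : ℝ) : ℂ)) := ⟨_, fun _ _ => rfl⟩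
  have hEn : ∀ k x, ‖E k x‖ = 1 := fun k x => by
    rw [hE, show -(Complex.I / ((lam ^ 2 : ℝ) : ℂ)) * ((k.1 * x.1 + k.2 * x.2 : ℝ) : ℂ) =
      ((-(k.1 * x.1 + k.2 * x.2) / lam ^ 2 : ℝ) : ℂ) * Complex.I by push_cast; ring,
      Complex.norm_exp_ofReal_mul_I]
  have hint : Integrable (fun p : (ℝ × ℝ) × (ℝ × ℝ) =>
      gaussS (1 / (4 * lam ^ 2)) p.1 * f p.2 * E p.1 p.2) (volume.prod volume) := by
    refine ((sch_integrable _).mul_prod (sch_integrable f)).mul_bdd (c := 1)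
      (Continuous.aestronglyMeasurable ?_) (Eventually.of_forall fun p => (hEn _ _).le)
    simp only [hE]; fun_prop
  have h2 : ∀ k, fhatS lam f k * gaussS (1 / (4 * lam ^ 2)) k =
      ((1 / (2 * Real.pi * lam ^ 2) ^ 2 : ℝ) : ℂ) *
        ∫ x, gaussS (1 / (4 * lam ^ 2)) k * f x * E k x := by
    intro k
    rw [fhatS_eq_fhat hlam.ne', fhat, mul_assoc, mul_comm (∫ x, _) (gaussS _ k),
      ← integral_const_mul]
    simp only [hE, mul_assoc]
  have h3 : ∀ x, ∫ k, gaussS (1 / (4 * lam ^ 2)) k * f x * E k x =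
      (4 * Real.pi * lam ^ 2 : ℂ) * (f x * gaussS (1 / lam ^ 2) x) := by
    intro x
    have e : ∀ k, gaussS (1 / (4 * lam ^ 2)) k * f x * E k x = f x *
        Complex.exp (-((1 / (4 * lam ^ 2) : ℝ) : ℂ) * (k.1 ^ 2 + k.2 ^ 2) +
          (-(Complex.I / lam ^ 2) * x.1) * k.1 + (-(Complex.I / lam ^ 2) * x.2) * k.2) := by
      intro k
      rw [gaussS_apply hb, Complex.ofReal_exp, hE, mul_comm _ (f x), mul_assoc, ← Complex.exp_add]
      congr 2; push_cast; ring
    simp_rw [e]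
    rw [integral_const_mul, integral_cexp_plane hb, gaussS_apply (by positivity),
      Complex.ofReal_exp]
    have : ((-(Complex.I / lam ^ 2) * x.1) ^ 2 + (-(Complex.I / lam ^ 2) * x.2) ^ 2 : ℂ) /
        (4 * ((1 / (4 * lam ^ 2) : ℝ) : ℂ)) = ((-(1 / lam ^ 2) * (x.1 ^ 2 + x.2 ^ 2) : ℝ) : ℂ) := by
      push_cast; field_simp; rw [Complex.I_sq]; ring
    rw [this]
    push_cast; field_simp
  rw [h1]
  simp_rw [h2]
  rw [integral_const_mul, integral_integral_swap hint]
  simp_rw [h3]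
  rw [integral_const_mul]
  push_cast; field_simp; ring

/-- The vacuum expectation value of a left multiplication. -/
lemma inner_vac_leftMul (f : Sch) :
    ⟪emb ((moyalLadder lam hlam).h 0 0), emb (leftMul lam f ((moyalLadder lam hlam).h 0 0))⟫_ℂ =
      (1 / (Real.pi * lam ^ 2) : ℂ) * ∫ x, f x * gaussS (1 / lam ^ 2) x := by
  have hl : (lam : ℂ) ≠ 0 := by exact_mod_cast hlam.ne'
  have hpi : (Real.pi : ℂ) ≠ 0 := by exact_mod_cast Real.pi_ne_zero
  have hb : 0 < 1 / lam ^ 2 := by positivity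
  have hf := isMultiplier_sch hlam f
  have hN : ((Real.sqrt (2 * (1 / lam ^ 2) / Real.pi) : ℝ) : ℂ) *
      ((Real.sqrt (2 * (1 / lam ^ 2) / Real.pi) : ℝ) : ℂ) = 2 / (Real.pi * lam ^ 2) := by
    rw [← Complex.ofReal_mul, Real.mul_self_sqrt (by positivity)]; push_cast; field_simp
  have e0 : (moyalLadder lam hlam).h 0 0 = vac (1 / lam ^ 2) := by
    simp [Ladder.h, moyalLadder]
  have e1 : ∀ x, conj (gaussS (1 / lam ^ 2) x) * leftMul lam f (gaussS (1 / lam ^ 2)) x =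
      mconst lam * (gaussS (1 / lam ^ 2) x *
        twist lam f ((Real.pi * lam ^ 2 : ℂ) • gaussS (1 / lam ^ 2)) x) := by
    intro x
    rw [hf.leftMul_apply, moyal_eq hlam.ne', show sft lam (gaussS (1 / lam ^ 2)) =
      (Real.pi * lam ^ 2 : ℂ) • gaussS (1 / lam ^ 2) by ext u; rw [sft_gaussS hlam]; rfl,
      show conj (gaussS (1 / lam ^ 2) x) = gaussS (1 / lam ^ 2) x by
        rw [gaussS_apply hb, Complex.conj_ofReal]]
    ring
  have e2 : ∀ y, ∫ x, gaussS (1 / lam ^ 2) x *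
      (((Real.pi * lam ^ 2 : ℂ) • gaussS (1 / lam ^ 2) : Sch) (y - x) * osc lam y x) =
      (Real.pi * lam ^ 2) ^ 2 / 2 * gaussS (1 / lam ^ 2) y := by
    intro y
    have e : ∀ x, gaussS (1 / lam ^ 2) x *
        (((Real.pi * lam ^ 2 : ℂ) • gaussS (1 / lam ^ 2) : Sch) (y - x) * osc lam y x) =
        (Real.pi * lam ^ 2 * gaussS (1 / lam ^ 2) y) *
          Complex.exp (-((2 / lam ^ 2 : ℝ) : ℂ) * (x.1 ^ 2 + x.2 ^ 2) +
            (2 / lam ^ 2 * (y.1 + Complex.I * y.2)) * x.1 +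
            (2 / lam ^ 2 * (y.2 - Complex.I * y.1)) * x.2) := by
      intro x
      rw [smul_apply, smul_eq_mul, gaussS_apply hb, gaussS_apply hb, gaussS_apply hb,
        Complex.ofReal_exp, Complex.ofReal_exp, Complex.ofReal_exp, osc,
        show ∀ a b c d : ℂ, a * (b * c * d) = b * (a * c * d) by intros; ring, mul_assoc _ _
          (Complex.exp (_ + _)), ← Complex.exp_add, ← Complex.exp_add, ← Complex.exp_add]
      congr 2
      simp only [Prod.fst_sub, Prod.snd_sub]
      push_cast
      field_simp
      ring
    simp_rw [e]
    rw [integral_const_mul, integral_cexp_plane (by positivity)]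
    have : ((2 / lam ^ 2 * (y.1 + Complex.I * y.2)) ^ 2 +
        (2 / lam ^ 2 * (y.2 - Complex.I * y.1)) ^ 2 : ℂ) = 0 := by
      ring_nf; rw [Complex.I_sq]; ring
    rw [this, zero_div, Complex.exp_zero]
    push_cast; field_simp
  rw [e0, vac, hf.leftMul_smul hlam.ne', emb_smul, emb_smul, inner_smul_left, inner_smul_right,
    Complex.conj_ofReal, ← mul_assoc, hN, inner_emb]
  simp_rw [e1]
  rw [integral_const_mul, integral_mul_twist (polyGrowth_of_temperate hf.temperate)]
  simp_rw [e2]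
  have e3 : ∀ y, f y * ((Real.pi * lam ^ 2 : ℂ) ^ 2 / 2 * gaussS (1 / lam ^ 2) y) =
      (Real.pi * lam ^ 2 : ℂ) ^ 2 / 2 * (f y * gaussS (1 / lam ^ 2) y) := fun y => by ring
  simp_rw [e3]
  rw [integral_const_mul, mconst]
  push_cast; field_simp

end

/-- The value of the eigenstate `ω_m` on `f` is the matrix element of `𝓛(f)` in `h_{m0}`. -/
theorem omega_eq {lam : ℝ} (hlam : 0 < lam) (m : ℕ) (f : Sch) : omega lam m f =
    ⟪emb ((moyalLadder lam hlam).h m 0), emb (leftMul lam f ((moyalLadder lam hlam).h m 0))⟫_ℂ := by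
  have h1 : omega lam m f = tform lam (fhatS lam f) (eigS lam m) (eigS lam m) := by
    have := integral_prod (μ := (volume : Measure ℝ)) (ν := (volume : Measure (ℝ × ℝ))) _
      (integrable_tker lam (fhatS lam f) (eigS lam m) (eigS lam m))
    refine Eq.trans ?_ this.symm
    rw [omega]
    congr 1; ext x
    rw [schrodinger, ← integral_const_mul]
    congr 1; ext k
    rw [tker, weyl, eigS_apply hlam, eigS_apply hlam, fhatS_eq_fhat hlam.ne', eigenfun,
      Complex.conj_ofReal]
    ring
  rw [h1]
  clear h1
  induction m generalizing f with
  | zero => rw [tform_eigS_zero hlam, inner_vac_leftMul]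
  | succ m ih =>
    have h2 : tform lam (fhatS lam f) (eigS lam (m + 1)) (eigS lam (m + 1)) =
        ((Real.sqrt ((m + 1 : ℕ) : ℝ))⁻¹ : ℂ) * ((Real.sqrt ((m + 1 : ℕ) : ℝ))⁻¹ : ℂ) *
          tform lam (fhatS lam ((moyalLadder lam hlam).A ((moyalLadder lam hlam).C f)))
            (eigS lam m) (eigS lam m) := by
      rw [tform_fhatS_A, tform_fhatS_C, eigS, tform_smul_snd, tform_smul_thd, mul_assoc]
    rw [h2, ih, leftMul_A, leftMul_C, ← Ladder.inner_As, Ladder.As_h,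
      (isMultiplier_sch hlam f).leftMul_smul hlam.ne', emb_smul, emb_smul, inner_smul_left,
      inner_smul_right, Complex.conj_ofReal]
    have h0 : (Real.sqrt ((m + 1 : ℕ) : ℝ) : ℂ) ≠ 0 := by
      exact_mod_cast (Real.sqrt_pos.2 (by positivity)).ne'
    field_simp

/-! ### Superpositions of Gaussian symbols -/

lemma norm_gsym {lam s : ℝ} (hs : 0 ≤ s) (x : ℝ × ℝ) :
    ‖gsym lam s x‖ = (1 + s) * Real.exp (-(s / lam ^ 2) * (x.1 ^ 2 + x.2 ^ 2)) := by
  rw [gsym, norm_mul, Complex.norm_real, Real.norm_of_nonneg (Real.exp_nonneg _),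
    show (1 + s : ℂ) = ((1 + s : ℝ) : ℂ) by push_cast; rfl, Complex.norm_real,
    Real.norm_of_nonneg (by positivity)]

lemma norm_gsym_le_two {lam s : ℝ} (hs : 0 ≤ s) (hs1 : s ≤ 1) (x : ℝ × ℝ) :
    ‖gsym lam s x‖ ≤ 2 := by
  rw [norm_gsym hs]
  have h : Real.exp (-(s / lam ^ 2) * (x.1 ^ 2 + x.2 ^ 2)) ≤ 1 := by
    rw [Real.exp_le_one_iff, neg_mul, neg_nonpos]; positivity
  calc (1 + s) * Real.exp (-(s / lam ^ 2) * (x.1 ^ 2 + x.2 ^ 2)) ≤ (1 + s) * 1 := by gcongr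
    _ ≤ 2 := by linarith

lemma sq_add_sq_le (x : ℝ × ℝ) : x.1 ^ 2 + x.2 ^ 2 ≤ 2 * (1 + ‖x‖) ^ 2 := by
  have h1 : x.1 ^ 2 ≤ ‖x‖ ^ 2 := sq_le_sq' (neg_le_of_abs_le (norm_fst_le x))
    (le_of_abs_le (norm_fst_le x))
  have h2 : x.2 ^ 2 ≤ ‖x‖ ^ 2 := sq_le_sq' (neg_le_of_abs_le (norm_snd_le x))
    (le_of_abs_le (norm_snd_le x))
  nlinarith [norm_nonneg x]

lemma one_add_norm_sq_le (x : ℝ × ℝ) : (1 + ‖x‖) ^ 2 ≤ 2 * (1 + (x.1 ^ 2 + x.2 ^ 2)) := by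
  have h : ‖x‖ ^ 2 ≤ x.1 ^ 2 + x.2 ^ 2 := by
    rw [Prod.norm_def]
    rcases max_choice ‖x.1‖ ‖x.2‖ with h | h <;>
      rw [h, Real.norm_eq_abs, sq_abs] <;> nlinarith [sq_nonneg x.1, sq_nonneg x.2]
  nlinarith [sq_nonneg (1 - ‖x‖)]

/-- The difference `1 - G_s` is of first order in `s`, at the price of quadratic growth. -/
lemma norm_one_sub_gsym_le {lam s : ℝ} (hlam : 0 < lam) (hs : 0 ≤ s) (x : ℝ × ℝ) :
    ‖1 - gsym lam s x‖ ≤ (1 + 2 / lam ^ 2) * (1 + ‖x‖) ^ 2 * s := by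
  obtain ⟨v, hv⟩ : ∃ v, v = s / lam ^ 2 * (x.1 ^ 2 + x.2 ^ 2) := ⟨_, rfl⟩
  have hv0 : 0 ≤ v := by rw [hv]; positivity
  have e : 1 - gsym lam s x = ((1 - (1 + s) * Real.exp (-v) : ℝ) : ℂ) := by
    rw [gsym, hv]; push_cast; ring_nf
  have h1 : Real.exp (-v) ≤ 1 := by rw [Real.exp_le_one_iff]; linarith
  have h2 : 1 - v ≤ Real.exp (-v) := by linarith [Real.add_one_le_exp (-v)]
  have h3 : 0 < Real.exp (-v) := Real.exp_pos _
  rw [e, Complex.norm_real, Real.norm_eq_abs]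
  have h4 : |1 - (1 + s) * Real.exp (-v)| ≤ s + v := by
    rw [abs_le]; constructor <;> nlinarith
  have h5 : v ≤ 2 / lam ^ 2 * (1 + ‖x‖) ^ 2 * s := by
    have := mul_le_mul_of_nonneg_left (sq_add_sq_le x) (by positivity : 0 ≤ s / lam ^ 2)
    rw [hv]; refine this.trans_eq ?_; ring
  have h6 : s ≤ (1 + ‖x‖) ^ 2 * s :=
    le_mul_of_one_le_left hs (one_le_pow₀ (by linarith [norm_nonneg x]))
  linarith

/-- The power `sᵏ` compensates the growth of a monomial of degree `2k`, up to a quadratic factor. -/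
lemma exists_norm_monomial_gsym_le {lam : ℝ} (hlam : 0 < lam) (n a b : ℕ) (hab : a + b ≤ 2 * (n + 1)) :
    ∃ C : ℝ, ∀ s : ℝ, 0 ≤ s → s ≤ 1 → ∀ x : ℝ × ℝ,
      ‖(x.1 : ℂ) ^ a * (x.2 : ℂ) ^ b * ((s : ℂ) ^ (n + 1) * gsym lam s x)‖ ≤
        C * (1 + ‖x‖) ^ 2 * s := by
  obtain ⟨β, hβ⟩ : ∃ β : ℝ, β = 1 / lam ^ 2 := ⟨_, rfl⟩
  have hβ0 : 0 < β := by rw [hβ]; positivity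
  refine ⟨2 * (2 ^ n * (n.factorial / β ^ n * Real.exp β)), fun s hs hs1 x => ?_⟩
  obtain ⟨q, hq⟩ : ∃ q, q = x.1 ^ 2 + x.2 ^ 2 := ⟨_, rfl⟩
  have hq0 : 0 ≤ q := by rw [hq]; positivity
  have h1 : ‖(x.1 : ℂ) ^ a * (x.2 : ℂ) ^ b‖ ≤ (1 + ‖x‖) ^ 2 * (2 * (1 + q)) ^ n := by
    have h11 : (1 : ℝ) ≤ 1 + ‖x‖ := by linarith [norm_nonneg x]
    rw [norm_mul, norm_pow, norm_pow, Complex.norm_real, Complex.norm_real]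
    calc ‖x.1‖ ^ a * ‖x.2‖ ^ b ≤ (1 + ‖x‖) ^ a * (1 + ‖x‖) ^ b := by
          gcongr
          · linarith [norm_fst_le x]
          · linarith [norm_snd_le x]
      _ = (1 + ‖x‖) ^ (a + b) := by rw [pow_add]
      _ ≤ (1 + ‖x‖) ^ (2 * (n + 1)) := pow_le_pow_right₀ h11 hab
      _ = (1 + ‖x‖) ^ 2 * ((1 + ‖x‖) ^ 2) ^ n := by rw [pow_mul, pow_succ']
      _ ≤ _ := by gcongr; rw [hq]; exact one_add_norm_sq_le x
  have h2 : (s * (1 + q)) ^ n * Real.exp (-(β * (s * q))) ≤ n.factorial / β ^ n * Real.exp β := by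
    have h3 := Real.pow_div_factorial_le_exp (β * (1 + s * q)) (by positivity) n
    rw [div_le_iff₀ (by positivity), mul_pow] at h3
    have h4 : (s * (1 + q)) ^ n ≤ (1 + s * q) ^ n := by gcongr; linarith
    have h5 : Real.exp (β * (1 + s * q)) * Real.exp (-(β * (s * q))) = Real.exp β := by
      rw [← Real.exp_add]; congr 1; ring
    have h6 : (1 + s * q) ^ n ≤ n.factorial / β ^ n * Real.exp (β * (1 + s * q)) := by
      rw [div_mul_eq_mul_div, le_div_iff₀ (by positivity)]; linarith
    calc _ ≤ n.factorial / β ^ n * Real.exp (β * (1 + s * q)) * Real.exp (-(β * (s * q))) := by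
          gcongr; exact h4.trans h6
      _ = _ := by rw [mul_assoc, h5]
  have h7 : ‖(s : ℂ) ^ (n + 1) * gsym lam s x‖ =
      s ^ (n + 1) * ((1 + s) * Real.exp (-(β * (s * q)))) := by
    rw [norm_mul, norm_pow, Complex.norm_real, Real.norm_of_nonneg hs, norm_gsym hs, hβ, hq]
    congr 4; ring
  rw [norm_mul, h7]
  calc _ ≤ (1 + ‖x‖) ^ 2 * (2 * (1 + q)) ^ n * (s ^ (n + 1) * ((1 + s) *
        Real.exp (-(β * (s * q))))) := by gcongr
    _ = (1 + s) * (2 ^ n * ((s * (1 + q)) ^ n * Real.exp (-(β * (s * q))))) *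
        (1 + ‖x‖) ^ 2 * s := by rw [mul_pow, mul_pow]; ring
    _ ≤ 2 * (2 ^ n * (n.factorial / β ^ n * Real.exp β)) * (1 + ‖x‖) ^ 2 * s := by
        gcongr; linarith

section

/-- The superposition `∫ (1 - G_{S(t)}) dμ(t)` of Gaussian symbols. -/
def mixSym (lam : ℝ) (μ : Measure ℝ) (S : ℝ → ℝ) (x : ℝ × ℝ) : ℂ :=
  ∫ t, (1 - gsym lam (S t) x) ∂μ

/-- The moments `∫ S(t)ⁿ⁺¹ G_{S(t)} dμ(t)`, in terms of which the derivatives of a superposition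
are expressed. -/
def mixMoment (lam : ℝ) (μ : Measure ℝ) (S : ℝ → ℝ) (n : ℕ) (x : ℝ × ℝ) : ℂ :=
  ∫ t, (S t : ℂ) ^ (n + 1) * gsym lam (S t) x ∂μ

variable {lam : ℝ} (hlam : 0 < lam) {μ : Measure ℝ} {S : ℝ → ℝ} (hS : Measurable S)
  (h01 : ∀ᵐ t ∂μ, 0 ≤ S t ∧ S t ≤ 1) (hi : Integrable S μ)

include hS in
lemma measurable_gsym_comp (x : ℝ × ℝ) : Measurable fun t => gsym lam (S t) x := by
  have h : Continuous fun s => gsym lam s x := by unfold gsym; fun_prop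
  exact h.measurable.comp hS

lemma norm_pow_mul_gsym_le {s : ℝ} (hs : 0 ≤ s) (hs1 : s ≤ 1) (n : ℕ) (x : ℝ × ℝ) :
    ‖(s : ℂ) ^ (n + 1) * gsym lam s x‖ ≤ 2 * s := by
  rw [norm_mul, norm_pow, Complex.norm_real, Real.norm_of_nonneg hs, mul_comm]
  gcongr
  · exact norm_gsym_le_two hs hs1 x
  · exact (pow_le_pow_of_le_one hs hs1 (by omega : 1 ≤ n + 1)).trans_eq (pow_one s)

include hS h01 hi in
lemma integrable_moment (n : ℕ) (x : ℝ × ℝ) :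
    Integrable (fun t => (S t : ℂ) ^ (n + 1) * gsym lam (S t) x) μ := by
  refine (hi.const_mul 2).mono' ?_ (h01.mono fun _ ht => norm_pow_mul_gsym_le ht.1 ht.2 n x)
  exact (((Complex.measurable_ofReal.comp hS).pow_const _).mul
    (measurable_gsym_comp hS x)).aestronglyMeasurable

include hlam hS h01 hi in
lemma integrable_one_sub_gsym (x : ℝ × ℝ) : Integrable (fun t => 1 - gsym lam (S t) x) μ :=
  (hi.const_mul _).mono' (measurable_const.sub (measurable_gsym_comp hS x)).aestronglyMeasurable
    (h01.mono fun _ ht => norm_one_sub_gsym_le hlam ht.1 x)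

/-- Differentiation under the integral sign for functions of `t` times Gaussian symbols. -/
lemma hasFDerivAt_integral_gsym (hS : Measurable S) (h01 : ∀ᵐ t ∂μ, 0 ≤ S t ∧ S t ≤ 1)
    (hi : Integrable S μ) {F : ℝ × ℝ → ℝ → ℂ} (n : ℕ) (c : ℂ)
    (hF : ∀ x, Integrable (F x) μ)
    (hd : ∀ t x, HasFDerivAt (fun x => F x t)
      (pd (c * x.1 * ((S t : ℂ) ^ (n + 1) * gsym lam (S t) x))
        (c * x.2 * ((S t : ℂ) ^ (n + 1) * gsym lam (S t) x))) x) (x : ℝ × ℝ) :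
    HasFDerivAt (fun x => ∫ t, F x t ∂μ)
      (pd (c * x.1 * mixMoment lam μ S n x) (c * x.2 * mixMoment lam μ S n x)) x := by
  have hm := fun x => (integrable_moment (lam := lam) hS h01 hi n x).aestronglyMeasurable
  have h := hasFDerivAt_integral_pd (F := F) (x₀ := x) (s := Metric.ball x 1)
    (a := fun x t => c * x.1 * ((S t : ℂ) ^ (n + 1) * gsym lam (S t) x))
    (b := fun x t => c * x.2 * ((S t : ℂ) ^ (n + 1) * gsym lam (S t) x))
    (bound := fun t => 2 * (‖c‖ * (1 + ‖x‖)) * (2 * S t))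
    (Metric.ball_mem_nhds x one_pos) (fun x => (hF x).aestronglyMeasurable) (hF x)
    ((hm x).const_mul _) ((hm x).const_mul _) (h01.mono fun t ht y hy => ?_)
    ((hi.const_mul 2).const_mul _) (Eventually.of_forall fun t y _ => hd t y)
  · simpa only [integral_const_mul, mixMoment] using h
  · have hy' : ‖y‖ ≤ 1 + ‖x‖ := by
      rw [Metric.mem_ball, dist_eq_norm] at hy
      linarith [norm_sub_norm_le y x]
    have k := norm_pow_mul_gsym_le (lam := lam) ht.1 ht.2 n y
    have k1 := norm_fst_le y
    have k2 := norm_snd_le y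
    rw [norm_mul (c * _), norm_mul (c * _), norm_mul c, norm_mul c, Complex.norm_real,
      Complex.norm_real, ← add_mul, ← mul_add]
    have : ‖c‖ * (‖y.1‖ + ‖y.2‖) ≤ 2 * (‖c‖ * (1 + ‖x‖)) := by
      nlinarith [norm_nonneg c]
    gcongr

include hS h01 hi in
lemma hasFDerivAt_mixMoment (n : ℕ) (x : ℝ × ℝ) : HasFDerivAt (mixMoment lam μ S n)
    (pd (-2 / lam ^ 2 * x.1 * mixMoment lam μ S (n + 1) x)
      (-2 / lam ^ 2 * x.2 * mixMoment lam μ S (n + 1) x)) x := by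
  refine hasFDerivAt_integral_gsym hS h01 hi (n + 1) _ (integrable_moment hS h01 hi n)
    (fun t x => ?_) x
  exact ((hasFDerivAt_gsym lam (S t) x).pd_const_mul _).pd_congr (by ring) (by ring)

include hlam hS h01 hi in
lemma hasFDerivAt_mixSym (x : ℝ × ℝ) : HasFDerivAt (mixSym lam μ S)
    (pd (2 / lam ^ 2 * x.1 * mixMoment lam μ S 0 x)
      (2 / lam ^ 2 * x.2 * mixMoment lam μ S 0 x)) x := by
  refine hasFDerivAt_integral_gsym hS h01 hi 0 _ (integrable_one_sub_gsym hlam hS h01 hi)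
    (fun t x => ?_) x
  refine ((hasFDerivAt_gsym lam (S t) x).pd_const_mul (-1)).const_add 1
    |>.congr_fderiv ?_ |>.congr_of_eventuallyEq
    (Eventually.of_forall fun y => by simp; ring)
  congr 1 <;> ring

include hlam hS h01 hi in
/-- The derivatives of a superposition are combinations of moments times monomials, all of at most
quadratic growth, because each additional power of a coordinate comes with a sufficient power of
the parameter. -/
theorem isSymbol_mixSym : IsSymbol 2 (mixSym lam μ S) := by
  obtain ⟨K, hK⟩ : ∃ K : ℕ → ℕ → ℕ → ℝ × ℝ → ℂ, ∀ n a b, K n a b = fun x : ℝ × ℝ =>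
    (x.1 : ℂ) ^ a * (x.2 : ℂ) ^ b * mixMoment lam μ S n x := ⟨_, fun _ _ _ => rfl⟩
  obtain ⟨T, hT⟩ : ∃ T : Set (ℝ × ℝ → ℂ), T = {F | F = mixSym lam μ S ∨
    ∃ n a b : ℕ, a + b ≤ 2 * (n + 1) ∧ F = K n a b} := ⟨_, rfl⟩
  have hKT : ∀ n a b : ℕ, a + b ≤ 2 * (n + 1) → K n a b ∈ Submodule.span ℂ T := fun n a b h =>
    Submodule.subset_span (by rw [hT]; exact Or.inr ⟨n, a, b, h, rfl⟩)
  refine isSymbol_of_mem_span (S := T) ?_ ?_ (Submodule.subset_span (by rw [hT]; exact Or.inl rfl))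
  · rw [hT]
    rintro F (rfl | ⟨n, a, b, hab, rfl⟩)
    · rw [← hT]
      refine ⟨(2 / lam ^ 2 : ℂ) • K 0 1 0, Submodule.smul_mem _ _ (hKT _ _ _ (by omega)),
        (2 / lam ^ 2 : ℂ) • K 0 0 1, Submodule.smul_mem _ _ (hKT _ _ _ (by omega)), fun x => ?_⟩
      refine (hasFDerivAt_mixSym hlam hS h01 hi x).pd_congr ?_ ?_ <;>
      · simp only [hK, Pi.smul_apply, smul_eq_mul]; ring
    · rw [← hT]
      refine ⟨(a : ℂ) • K n (a - 1) b + (-2 / lam ^ 2 : ℂ) • K (n + 1) (a + 1) b,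
        add_mem (Submodule.smul_mem _ _ (hKT _ _ _ (by omega)))
          (Submodule.smul_mem _ _ (hKT _ _ _ (by omega))),
        (b : ℂ) • K n a (b - 1) + (-2 / lam ^ 2 : ℂ) • K (n + 1) a (b + 1),
        add_mem (Submodule.smul_mem _ _ (hKT _ _ _ (by omega)))
          (Submodule.smul_mem _ _ (hKT _ _ _ (by omega))), fun x => ?_⟩
      have p1 : HasFDerivAt (fun x : ℝ × ℝ => (x.1 : ℂ) ^ a) (pd (a * (x.1 : ℂ) ^ (a - 1)) 0) x := by
        refine ((hasDerivAt_pow a (x.1 : ℂ)).comp_hasFDerivAt x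
          (hasFDerivAt_ofReal_fst x)).congr_fderiv ?_
        rw [smul_pd]; simp
      have p2 : HasFDerivAt (fun x : ℝ × ℝ => (x.2 : ℂ) ^ b) (pd 0 (b * (x.2 : ℂ) ^ (b - 1))) x := by
        refine ((hasDerivAt_pow b (x.2 : ℂ)).comp_hasFDerivAt x
          (hasFDerivAt_ofReal_snd x)).congr_fderiv ?_
        rw [smul_pd]; simp
      rw [hK]
      refine ((p1.pd_mul p2).pd_mul (hasFDerivAt_mixMoment hS h01 hi n x)).pd_congr ?_ ?_ <;>
      · simp only [hK, Pi.add_apply, Pi.smul_apply, smul_eq_mul]; ring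
  · rw [hT]
    rintro F (rfl | ⟨n, a, b, hab, rfl⟩)
    · refine ⟨(1 + 2 / lam ^ 2) * ∫ t, S t ∂μ, fun x => ?_⟩
      refine (norm_integral_le_of_norm_le (hi.const_mul _)
        (h01.mono fun _ ht => norm_one_sub_gsym_le hlam ht.1 x)).trans_eq ?_
      rw [integral_const_mul]; ring
    · obtain ⟨C, hC⟩ := exists_norm_monomial_gsym_le hlam n a b hab
      refine ⟨C * ∫ t, S t ∂μ, fun x => ?_⟩
      rw [hK]
      dsimp only
      rw [mixMoment, ← integral_const_mul]
      refine (norm_integral_le_of_norm_le (hi.const_mul _)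
        (h01.mono fun t ht => hC (S t) ht.1 ht.2 x)).trans_eq ?_
      rw [integral_const_mul]; ring

include hS h01 hi in
/-- The left multiplication by a superposition of Gaussian symbols is diagonal, the eigenvalues
being the superpositions of the eigenvalues. -/
theorem isDiag_mixSym [SFinite μ] : IsDiag hlam (mixSym lam μ S) fun m =>
    ∫ t, (1 - (((1 - S t) / (1 + S t)) ^ m : ℂ)) ∂μ := by
  -- Fubini in the formula of the Moyal product
  intro m n
  have hl := (isSymbol_mixSym hlam hS h01 hi).isMultiplier hlam.ne'
  ext x
  obtain ⟨ψ, hψ⟩ : ∃ ψ, ψ = (moyalLadder lam hlam).h m n := ⟨_, rfl⟩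
  obtain ⟨Φ, hΦ⟩ : ∃ Φ, Φ = sft lam ψ := ⟨_, rfl⟩
  have hone : mconst lam * ∫ u, Φ u * osc lam u x = ψ x := by
    have := (isMultiplier_one hlam).leftMul_apply ψ x
    rw [one_leftMul hlam, moyal_eq hlam.ne', twist, ← hΦ] at this
    simpa using this.symm
  have hint : ∀ f : ℝ × ℝ → ℂ, IsMultiplier lam f →
      Integrable fun u => f (x + u) * Φ u * osc lam u x := fun f hf =>
    integrable_mul_osc ((polyGrowth_of_temperate hf.temperate).integrable_shift Φ x) x
  have hg : ∀ᵐ t ∂μ, mconst lam * ∫ u, (1 - gsym lam (S t) (x + u)) * (Φ u * osc lam u x) =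
      (1 - (((1 - S t) / (1 + S t)) ^ m : ℂ)) * ψ x := by
    filter_upwards [h01] with t ht
    have hm := isMultiplier_gsym hlam ht.1
    have e1 := hm.leftMul_apply ψ x
    rw [hψ, leftMul_gsym_h hlam ht.1, ← hψ, moyal_eq hlam.ne', twist, ← hΦ, smul_apply,
      smul_eq_mul] at e1
    have e2 := hint _ hm
    have e3 := hint _ (isMultiplier_one hlam)
    have e4 : ∀ u, (1 - gsym lam (S t) (x + u)) * (Φ u * osc lam u x) =
      1 * Φ u * osc lam u x - gsym lam (S t) (x + u) * Φ u * osc lam u x := fun u => by ring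
    simp_rw [e4]
    rw [integral_sub e3 e2, mul_sub, ← e1, sub_mul, ← hone]
    simp only [one_mul]
  have hswap : ∫ u : ℝ × ℝ, ∫ t, (1 - gsym lam (S t) (x + u)) * (Φ u * osc lam u x) ∂μ =
      ∫ t, (∫ u : ℝ × ℝ, (1 - gsym lam (S t) (x + u)) * (Φ u * osc lam u x)) ∂μ := by
    refine integral_integral_swap ?_
    have hb : Integrable (fun p : (ℝ × ℝ) × ℝ => (1 + 2 / lam ^ 2) * (1 + ‖x‖) ^ 2 *
        ((1 + ‖p.1‖) ^ 2 * ‖Φ p.1‖) * S p.2) (volume.prod μ) :=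
      ((integrable_one_add_norm_pow_mul Φ 2).const_mul _).mul_prod hi
    refine hb.mono' (Measurable.aestronglyMeasurable ?_) ?_
    · have hc : Continuous fun q : ℝ × (ℝ × ℝ) => gsym lam q.1 q.2 := by unfold gsym; fun_prop
      have h1 : Measurable fun p : (ℝ × ℝ) × ℝ => gsym lam (S p.2) (x + p.1) :=
        hc.measurable.comp ((hS.comp measurable_snd).prodMk (measurable_const.add measurable_fst))
      have h2 : Continuous fun u : ℝ × ℝ => Φ u * osc lam u x :=
        Φ.continuous.mul (continuous_osc_left lam x)
      exact (measurable_const.sub h1).mul (h2.measurable.comp measurable_fst)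
    · filter_upwards [Measure.quasiMeasurePreserving_snd.ae h01] with p hp
      have e1 := norm_one_sub_gsym_le hlam hp.1 (x + p.1)
      have e2 := one_add_norm_add_pow_le x p.1 2
      have e3 := hp.1
      rw [Function.uncurry, norm_mul, norm_mul, norm_osc, mul_one]
      calc _ ≤ (1 + 2 / lam ^ 2) * ((1 + ‖x‖) ^ 2 * (1 + ‖p.1‖) ^ 2) * S p.2 * ‖Φ p.1‖ := by
            gcongr; exact e1.trans (by gcongr)
        _ = _ := by ring
  rw [hl.leftMul_apply, moyal_eq hlam.ne', twist, smul_apply, smul_eq_mul, ← hψ, ← hΦ,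
    ← integral_mul_const, ← integral_congr_ae hg, integral_const_mul, ← hswap]
  congr 2; ext u
  rw [mixSym, ← integral_mul_const, ← integral_mul_const]
  congr 1; ext t; ring

end

/-! ### The optimal element -/

/-- The measure `λ / √(2π) t^(-1/2) / (exp t - 1) dt` on the half-line. -/
def optMeasure (lam : ℝ) : Measure ℝ :=
  (volume.restrict (Set.Ioi 0)).withDensity fun t => ENNReal.ofReal
    (lam / Real.sqrt (2 * Real.pi) * (t ^ (-(1 / 2) : ℝ) / (Real.exp t - 1)))

/-- `tanh (t/2)`: the parameter at which the Gaussian symbol has eigenvalues `exp(-m t)`. -/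
def optParam (t : ℝ) : ℝ := (1 - Real.exp (-t)) / (1 + Real.exp (-t))

/-- The optimal element: its eigenvalues are obtained from
`(m + 1)^(-1/2) = π^(-1/2) ∫ t^(-1/2) exp(-(m + 1) t) dt` by summation of the geometric series. -/
def optSym (lam : ℝ) : ℝ × ℝ → ℂ := mixSym lam (optMeasure lam) optParam

section

variable {lam : ℝ} (hlam : 0 < lam)

instance : SFinite (optMeasure lam) := by unfold optMeasure; infer_instance

lemma measurable_optParam : Measurable optParam := by unfold optParam; fun_prop

lemma optParam_ratio (t : ℝ) : (1 - optParam t) / (1 + optParam t) = Real.exp (-t) := by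
  have h := Real.exp_pos (-t)
  have h1 : 1 + Real.exp (-t) ≠ 0 := by positivity
  rw [optParam]; field_simp; ring

lemma ae_optMeasure {p : ℝ → Prop} (h : ∀ t, 0 < t → p t) : ∀ᵐ t ∂optMeasure lam, p t :=
  (withDensity_absolutelyContinuous _ _).ae_le
    ((ae_restrict_iff' measurableSet_Ioi).2 (Eventually.of_forall h))

lemma optParam_mem (t : ℝ) (ht : 0 < t) : 0 ≤ optParam t ∧ optParam t ≤ 1 := by
  have h := Real.exp_pos (-t)
  have h1 : Real.exp (-t) < 1 := by rw [Real.exp_lt_one_iff]; linarith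
  rw [optParam]
  exact ⟨div_nonneg (by linarith) (by linarith), (div_le_one (by linarith)).2 (by linarith)⟩

include hlam in
lemma optDensity_nonneg (t : ℝ) (ht : 0 < t) :
    0 ≤ lam / Real.sqrt (2 * Real.pi) * (t ^ (-(1 / 2) : ℝ) / (Real.exp t - 1)) := by
  have : 0 < Real.exp t - 1 := by linarith [Real.add_one_lt_exp ht.ne']
  positivity

include hlam in
lemma integral_optMeasure (g : ℝ → ℝ) : ∫ t, g t ∂optMeasure lam =
    ∫ t in Set.Ioi 0, lam / Real.sqrt (2 * Real.pi) *
      (t ^ (-(1 / 2) : ℝ) / (Real.exp t - 1)) * g t := by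
  rw [optMeasure, integral_withDensity_eq_integral_toReal_smul (by fun_prop) (by simp)]
  refine setIntegral_congr_fun measurableSet_Ioi fun t ht => ?_
  rw [ENNReal.toReal_ofReal (optDensity_nonneg hlam t ht), smul_eq_mul]

include hlam in
lemma integrable_optMeasure_iff (g : ℝ → ℝ) : Integrable g (optMeasure lam) ↔
    IntegrableOn (fun t => lam / Real.sqrt (2 * Real.pi) *
      (t ^ (-(1 / 2) : ℝ) / (Real.exp t - 1)) * g t) (Set.Ioi 0) := by
  rw [optMeasure, integrable_withDensity_iff_integrable_smul' (by fun_prop) (by simp)]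
  refine integrableOn_congr_fun (fun t ht => ?_) measurableSet_Ioi
  rw [ENNReal.toReal_ofReal (optDensity_nonneg hlam t ht), smul_eq_mul]

lemma integrableOn_rpow_mul_exp (m : ℕ) :
    IntegrableOn (fun t : ℝ => t ^ (-(1 / 2) : ℝ) * Real.exp (-((m + 1) * t))) (Set.Ioi 0) := by
  have h := Real.GammaIntegral_convergent (s := 1 / 2) (by norm_num)
  refine h.mono' (by fun_prop) ((ae_restrict_iff' measurableSet_Ioi).2
    (Eventually.of_forall fun t ht => ?_))
  have ht' : 0 < t := ht
  rw [Real.norm_of_nonneg (by positivity), mul_comm, show (1 / 2 - 1 : ℝ) = -(1 / 2) by norm_num]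
  gcongr
  nlinarith [(Nat.cast_nonneg m : (0 : ℝ) ≤ m)]

include hlam in
/-- The parameter vanishes to first order at `t = 0`, where the density behaves like `t^(-3/2)`. -/
lemma integrable_optParam : Integrable optParam (optMeasure lam) := by
  rw [integrable_optMeasure_iff hlam]
  refine ((integrableOn_rpow_mul_exp 0).const_mul (lam / Real.sqrt (2 * Real.pi))).mono'
    (Measurable.aestronglyMeasurable (by have := measurable_optParam; fun_prop))
    ((ae_restrict_iff' measurableSet_Ioi).2 (Eventually.of_forall fun t ht => ?_))
  have ht' : 0 < t := ht
  have h0 : 0 < Real.exp t - 1 := by linarith [Real.add_one_lt_exp ht'.ne']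
  have h1 := Real.exp_pos (-t)
  have e : 1 - Real.exp (-t) = Real.exp (-t) * (Real.exp t - 1) := by
    rw [mul_sub, ← Real.exp_add]; simp
  rw [Real.norm_of_nonneg (mul_nonneg (optDensity_nonneg hlam t ht) (optParam_mem t ht).1),
    optParam, e, mul_assoc]
  refine mul_le_mul_of_nonneg_left ?_ (by positivity)
  have h2 : Real.exp (-((((0 : ℕ) : ℝ) + 1) * t)) = Real.exp (-t) := by congr 1; simp
  rw [h2]
  have h3 : t ^ (-(1 / 2) : ℝ) / (Real.exp t - 1) *
      (Real.exp (-t) * (Real.exp t - 1) / (1 + Real.exp (-t))) =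
      t ^ (-(1 / 2) : ℝ) * Real.exp (-t) / (1 + Real.exp (-t)) := by field_simp
  rw [h3]
  exact div_le_self (by positivity) (by linarith)

/-- The eigenvalues `∫ (1 - exp(-m t)) dμ(t)` of the optimal element. -/
def optVal (lam : ℝ) (m : ℕ) : ℝ := ∫ t, (1 - Real.exp (-t) ^ m) ∂optMeasure lam

lemma optVal_zero : optVal lam 0 = 0 := by simp [optVal]

include hlam in
lemma integrable_one_sub_exp (m : ℕ) :
    Integrable (fun t => 1 - Real.exp (-t) ^ m) (optMeasure lam) := by
  refine ((integrable_optParam hlam).const_mul (2 * m)).mono'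
    (Measurable.aestronglyMeasurable (by fun_prop)) (ae_optMeasure fun t ht => ?_)
  have h := Real.exp_pos (-t)
  have h1 : Real.exp (-t) < 1 := by rw [Real.exp_lt_one_iff]; linarith
  have h2 := one_add_mul_le_pow (show (-2 : ℝ) ≤ Real.exp (-t) - 1 by linarith) m
  rw [add_sub_cancel] at h2
  have h3 : Real.exp (-t) ^ m ≤ 1 := pow_le_one₀ h.le h1.le
  rw [Real.norm_of_nonneg (by linarith)]
  have h4 : 1 - Real.exp (-t) ≤ 2 * optParam t := by
    rw [optParam, mul_div_assoc', le_div_iff₀ (by linarith)]; nlinarith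
  calc 1 - Real.exp (-t) ^ m ≤ m * (1 - Real.exp (-t)) := by linarith
    _ ≤ m * (2 * optParam t) := by gcongr
    _ = _ := by ring

include hlam in
/-- The increments of the eigenvalues are those of the distance, by `Γ(1/2) = √π`. -/
lemma optVal_succ_sub (m : ℕ) :
    optVal lam (m + 1) - optVal lam m = lam / Real.sqrt (2 * (m + 1)) := by
  rw [optVal, optVal, ← integral_sub (integrable_one_sub_exp hlam _) (integrable_one_sub_exp hlam _),
    integral_optMeasure hlam]
  have e : ∀ t ∈ Set.Ioi (0 : ℝ), lam / Real.sqrt (2 * Real.pi) *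
      (t ^ (-(1 / 2) : ℝ) / (Real.exp t - 1)) *
      (1 - Real.exp (-t) ^ (m + 1) - (1 - Real.exp (-t) ^ m)) =
      lam / Real.sqrt (2 * Real.pi) * (t ^ ((1 / 2 : ℝ) - 1) * Real.exp (-(((m : ℝ) + 1) * t))) := by
    intro t ht
    have ht' : 0 < t := ht
    have h0 : Real.exp t - 1 ≠ 0 := by linarith [Real.add_one_lt_exp ht'.ne']
    have h1 : Real.exp (-t) * Real.exp t = 1 := by rw [← Real.exp_add]; simp
    have h2 : Real.exp (-(((m : ℝ) + 1) * t)) = Real.exp (-t) ^ (m + 1) := by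
      rw [← Real.exp_nat_mul]; congr 1; push_cast; ring
    rw [h2, show (1 / 2 - 1 : ℝ) = -(1 / 2) by norm_num]
    have h3 : 1 - Real.exp (-t) ^ (m + 1) - (1 - Real.exp (-t) ^ m) =
        Real.exp (-t) ^ (m + 1) * (Real.exp t - 1) := by
      rw [pow_succ]; linear_combination (-Real.exp (-t) ^ m) * h1
    rw [h3]; field_simp
  rw [setIntegral_congr_fun measurableSet_Ioi e, integral_const_mul,
    Real.integral_rpow_mul_exp_neg_mul_Ioi (by norm_num) (by positivity), Real.Gamma_one_half_eq,
    ← Real.sqrt_eq_rpow, Real.sqrt_mul (by norm_num), Real.sqrt_mul (by norm_num),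
    Real.sqrt_div zero_le_one, Real.sqrt_one]
  have hpi := Real.sqrt_pos.2 Real.pi_pos
  field_simp

include hlam in
theorem isMultiplier_optSym : IsMultiplier lam (optSym lam) :=
  (isSymbol_mixSym hlam measurable_optParam (ae_optMeasure optParam_mem)
    (integrable_optParam hlam)).isMultiplier hlam.ne'

theorem isDiag_optSym : IsDiag hlam (optSym lam) fun m => (optVal lam m : ℂ) := by
  intro m n
  refine (isDiag_mixSym hlam measurable_optParam (ae_optMeasure optParam_mem)
    (integrable_optParam hlam) m n).trans ?_
  dsimp only
  congr 1
  rw [optVal, ← integral_complex_ofReal]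
  congr 1; ext t
  rw [← optParam_ratio]; push_cast; rfl

end

/-! ### The spectral distance between eigenstates -/

section

variable {lam : ℝ} (hlam : 0 < lam)

include hlam in
lemma optVal_strictMono : StrictMono (optVal lam) := strictMono_nat_of_lt_succ fun m => by
  have h := optVal_succ_sub hlam m
  have : 0 < lam / Real.sqrt (2 * (m + 1)) := by positivity
  linarith

include hlam in
lemma optVal_nonneg (m : ℕ) : 0 ≤ optVal lam m :=
  (optVal_zero (lam := lam)).symm.le.trans ((optVal_strictMono hlam).monotone (Nat.zero_le m))

include hlam in
/-- The eigenvalues are unbounded: the series of `k^(-1/2)` diverges. -/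
lemma le_optVal (m : ℕ) : lam / Real.sqrt 2 * Real.sqrt m ≤ optVal lam m := by
  induction m with
  | zero => simp [optVal_zero]
  | succ m ih =>
    have h := optVal_succ_sub hlam m
    have h1 : 0 < Real.sqrt ((m : ℝ) + 1) := Real.sqrt_pos.2 (by positivity)
    have h2 : Real.sqrt m ≤ Real.sqrt ((m : ℝ) + 1) := Real.sqrt_le_sqrt (by linarith)
    have h3 : Real.sqrt ((m : ℝ) + 1) - Real.sqrt m ≤ 1 / Real.sqrt ((m : ℝ) + 1) := by
      rw [le_div_iff₀ h1]
      nlinarith [Real.mul_self_sqrt (by positivity : (0 : ℝ) ≤ m + 1),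
        Real.mul_self_sqrt (by positivity : (0 : ℝ) ≤ m), Real.sqrt_nonneg (m : ℝ)]
    have h4 : lam / Real.sqrt (2 * (m + 1)) = lam / Real.sqrt 2 * (1 / Real.sqrt ((m : ℝ) + 1)) := by
      rw [Real.sqrt_mul (by norm_num)]; field_simp
    have h5 := mul_le_mul_of_nonneg_left h3 (by positivity : 0 ≤ lam / Real.sqrt 2)
    push_cast
    linarith

include hlam in
lemma exists_le_optVal (y : ℝ) : ∃ K, y ≤ optVal lam K := by
  obtain ⟨K, hK⟩ := exists_nat_ge ((y / (lam / Real.sqrt 2)) ^ 2)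
  refine ⟨K, le_trans ?_ (le_optVal hlam K)⟩
  rw [← div_le_iff₀' (by positivity)]
  exact Real.le_sqrt_of_sq_le hK

/-- The eigenvalues of the optimal element, reflected at the `k`-th one and truncated when they
reach `0`. -/
def optCut (lam : ℝ) (k m : ℕ) : ℝ := max 0 (min (optVal lam m) (2 * optVal lam k - optVal lam m))

include hlam in
lemma optCut_of_le {k m : ℕ} (h : m ≤ k) : optCut lam k m = optVal lam m := by
  have h1 := optVal_nonneg hlam m
  have h2 := (optVal_strictMono hlam).monotone h
  rw [optCut, min_eq_left (by linarith), max_eq_right h1]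

include hlam in
lemma abs_optCut_sub_le (k m : ℕ) : |optCut lam k m - optVal lam m| ≤ |optVal lam m| := by
  have h1 := optVal_nonneg hlam m
  have h2 : optCut lam k m ≤ optVal lam m := max_le h1 (min_le_left _ _)
  have h3 : 0 ≤ optCut lam k m := le_max_left _ _
  rw [abs_of_nonneg h1, abs_le]
  constructor <;> linarith

/-- Reflection and truncation do not increase the increments. -/
lemma abs_optCut_succ_sub_le (k m : ℕ) :
    |optCut lam k (m + 1) - optCut lam k m| ≤ |optVal lam (m + 1) - optVal lam m| := by
  refine (abs_max_sub_max_le_max _ _ _ _).trans (max_le (by simp) ?_)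
  refine (abs_min_sub_min_le_max _ _ _ _).trans (max_le le_rfl ?_)
  rw [sub_sub_sub_cancel_left, abs_sub_comm]

include hlam in
lemma norm_optVal_succ_sub (m : ℕ) :
    ‖(optVal lam (m + 1) : ℂ) - optVal lam m‖ = lam / Real.sqrt (2 * (m + 1)) := by
  rw [← Complex.ofReal_sub, Complex.norm_real, optVal_succ_sub hlam,
    Real.norm_of_nonneg (by positivity)]

include hlam in
lemma exists_optCut_eq_zero (k : ℕ) : ∃ K, k ≤ K ∧ ∀ m, K ≤ m → optCut lam k m = 0 := by
  obtain ⟨K, hK⟩ := exists_le_optVal hlam (2 * optVal lam k)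
  refine ⟨max k K, le_max_left _ _, fun m hm => ?_⟩
  have := (optVal_strictMono hlam).monotone ((le_max_right k K).trans hm)
  exact max_eq_left ((min_le_right _ _).trans (by linarith))

include hlam in
/-- The optimal sequence: elements of the algebra whose left multiplications have the cut-off
eigenvalues. -/
lemma exists_optSeq : ∃ a : ℕ → Sch, (∀ k, IsDiag hlam (a k) fun m => (optCut lam k m : ℂ)) ∧
    ∀ k, commNorm (leftOp lam (a k)) ≤ 1 := by
  choose K hK using exists_optCut_eq_zero hlam
  have hd : ∀ k, IsDiag hlam (diagSch hlam (fun m => (optCut lam k m : ℂ)) (K k))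
      fun m => (optCut lam k m : ℂ) := fun k m n => by
    rw [isDiag_diagSch]
    dsimp only
    split_ifs with h
    · rfl
    · rw [(hK k).2 m (by omega)]; simp
  refine ⟨_, hd, fun k => (hd k).commNorm_le_one (isMultiplier_sch hlam _) fun m => ?_⟩
  rw [← norm_optVal_succ_sub hlam, ← Complex.ofReal_sub, ← Complex.ofReal_sub, Complex.norm_real,
    Complex.norm_real]
  exact abs_optCut_succ_sub_le k m

lemma omega_of_isDiag {f : Sch} {c : ℕ → ℂ} (h : IsDiag hlam f c) (m : ℕ) : omega lam m f = c m := by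
  rw [omega_eq hlam, h, emb_smul, inner_smul_right, Ladder.inner_h]; simp

include hlam in
/-- The upper bound for the distance, by telescoping. -/
lemma norm_omega_sub_le {f : Sch} (h1 : commNorm (leftOp lam f) ≤ 1) (m k : ℕ) :
    ‖omega lam (m + k) f - omega lam m f‖ ≤ optVal lam (m + k) - optVal lam m := by
  induction k with
  | zero => simp
  | succ k ih =>
    have h2 : ‖omega lam (m + k + 1) f - omega lam (m + k) f‖ ≤
        optVal lam (m + k + 1) - optVal lam (m + k) := by
      rw [omega_eq hlam, omega_eq hlam, optVal_succ_sub hlam]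
      exact norm_inner_h_sub_le (hlam := hlam) (isMultiplier_sch hlam f) h1 (m + k)
    have h3 := norm_add_le (omega lam (m + k + 1) f - omega lam (m + k) f)
      (omega lam (m + k) f - omega lam m f)
    rw [sub_add_sub_cancel] at h3
    rw [← add_assoc]
    linarith

include hlam in
lemma norm_omega_sub_le_abs {f : Sch} (h1 : commNorm (leftOp lam f) ≤ 1) (m n : ℕ) :
    ‖omega lam m f - omega lam n f‖ ≤ |optVal lam m - optVal lam n| := by
  rcases le_total n m with h | h <;> obtain ⟨k, rfl⟩ := Nat.exists_eq_add_of_le h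
  · exact (norm_omega_sub_le hlam h1 n k).trans (le_abs_self _)
  · rw [norm_sub_rev, abs_sub_comm]
    exact (norm_omega_sub_le hlam h1 m k).trans (le_abs_self _)

include hlam in
/-- The spectral distance between `ω_m` and `ω_n` is `λ/√2 ∑ k^(-1/2)`, summed over the `k` between
`m` and `n`. -/
theorem spectralDist_omega (m n : ℕ) : spectralDist lam (omega lam m) (omega lam n) =
    ‖(optVal lam m : ℂ) - optVal lam n‖ₑ := by
  refine le_antisymm (iSup₂_le fun f h1 => ?_) ?_
  · rw [enorm_le_iff_norm_le, ← Complex.ofReal_sub, Complex.norm_real]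
    exact norm_omega_sub_le_abs hlam h1 m n
  · obtain ⟨a, ha, h1⟩ := exists_optSeq hlam
    refine le_trans (le_of_eq ?_) (le_iSup₂ (f := fun (f : Sch) (_ : commNorm (leftOp lam f) ≤ 1) =>
      ‖omega lam m f - omega lam n f‖ₑ) (a (max m n)) (h1 _))
    rw [omega_of_isDiag hlam (ha _), omega_of_isDiag hlam (ha _),
      optCut_of_le hlam (le_max_left m n), optCut_of_le hlam (le_max_right m n)]

lemma omegaOp_leftOp (l : ℝ × ℝ → ℂ) (m : ℕ) : omegaOp lam m (leftOp lam l) =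
    ⟪emb ((moyalLadder lam hlam).h m 0), emb (leftMul lam l ((moyalLadder lam hlam).h m 0))⟫_ℂ := by
  rw [omegaOp, wigner_eq hlam, leftOp]

include hlam in
theorem isOptimal_optSym (m n : ℕ) : IsOptimal lam (leftOp lam (optSym lam)) m n := by
  have hm := isMultiplier_optSym hlam
  have hd := isDiag_optSym hlam
  refine ⟨?_, le_antisymm (hd.commNorm_le_one hm fun m => (norm_optVal_succ_sub hlam m).le)
    (hd.one_le_commNorm hm ?_)⟩
  · rw [omegaOp_leftOp hlam, omegaOp_leftOp hlam, hd, hd, emb_smul, emb_smul, inner_smul_right,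
      inner_smul_right, Ladder.inner_h, Ladder.inner_h, spectralDist_omega hlam]
    simp
  · rw [← Complex.ofReal_sub, optVal_succ_sub hlam]; simp

include hlam in
theorem hasRegularization_optSym (m n : ℕ) :
    HasRegularization lam (leftOp lam (optSym lam)) m n := by
  obtain ⟨a, ha, h1⟩ := exists_optSeq hlam
  refine ⟨a, h1, tendsto_leftOp_of_isDiag (isMultiplier_optSym hlam) (isDiag_optSym hlam) ha
    (fun k m => ?_) fun m => ?_, ?_⟩
  · rw [← Complex.ofReal_sub, Complex.norm_real, Complex.norm_real]
    exact abs_optCut_sub_le hlam k m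
  · refine tendsto_const_nhds.congr' ((eventually_ge_atTop m).mono fun k hk => ?_)
    dsimp only
    rw [optCut_of_le hlam hk]
  · refine tendsto_const_nhds.congr' ((eventually_ge_atTop (max m n)).mono fun k hk => ?_)
    dsimp only
    rw [omega_of_isDiag hlam (ha _), omega_of_isDiag hlam (ha _), spectralDist_omega hlam,
      optCut_of_le hlam ((le_max_left m n).trans hk), optCut_of_le hlam ((le_max_right m n).trans hk)]

include hlam in
/-- An element that is optimal between all neighbouring eigenstates solves the equation. -/
theorem isSolution_of_isOptimal {l : ℝ × ℝ → ℂ} (hl : IsMultiplier lam l)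
    (h : ∀ m n : ℕ, IsOptimal lam (leftOp lam l) m n) : IsSolution lam l := by
  obtain ⟨g, hg, hs⟩ := dz_h_of_saturated (hlam := hlam) hl (h 0 0).norm_eq.le fun m => by
    have e := (h (m + 1) m).value
    rw [spectralDist_omega hlam, omegaOp_leftOp hlam, omegaOp_leftOp hlam] at e
    rw [← norm_optVal_succ_sub hlam, ← toReal_enorm, e, toReal_enorm]
  exact isSolution_of_shift (hlam := hlam) hl hg hs

end

/-! ### The operators `l₁(a)`, `l₂(a)`, `l₃(a)` -/

section

variable {lam : ℝ} (hlam : 0 < lam)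

/-- The ratios `c` of the additive constants of `lᵢ(a)² = 2θ (N + c)`, where `N` is the number
operator. -/
def lRatio (i : Fin 3) : ℝ :=
  match i with
  | 0 => 1 / 2
  | 1 => 0
  | 2 => 1

lemma lRatio_nonneg (i : Fin 3) : 0 ≤ lRatio i := by fin_cases i <;> norm_num [lRatio]

lemma lConst_eq (lam : ℝ) (i : Fin 3) : lConst lam (2 * lam ^ 2) i = 2 * lam ^ 2 * lRatio i := by
  fin_cases i <;> simp only [lConst, lRatio] <;> ring

lemma isPosSqrt_lSq_iff (i : Fin 3) (A : L2 →ₗ.[ℂ] L2) :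
    IsPosSqrt (lSq lam i (leftMul lam z) (leftMul lam zbar)) A ↔
      A = diagOp (moyalLadder lam hlam).basis fun p =>
        Real.sqrt (2 * lam ^ 2 * p.1 + 2 * lam ^ 2 * lRatio i) := by
  have := lRatio_nonneg i
  refine (moyalLadder lam hlam).isPosSqrt_number_iff (by positivity) (by positivity) (fun ψ => ?_) A
  rw [lSq_eq (moyalLadder lam hlam) (leftMul_z hlam) (leftMul_zbar hlam), lConst_eq]

lemma IsPosSqrt.emb_mem_domain {P : Sch → Sch} {A : L2 →ₗ.[ℂ] L2} (h : IsPosSqrt P A) (ψ : Sch) :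
    emb ψ ∈ A.domain := by
  obtain ⟨w, hw, -⟩ := (h.sq_eq (emb ψ) (emb (P ψ))).2 (subset_closure ⟨ψ, rfl⟩)
  exact LinearPMap.mem_domain_of_mem_graph hw

lemma diagOp_apply_emb_h (μ : ℕ × ℕ → ℝ) (m n : ℕ)
    (hm : emb ((moyalLadder lam hlam).h m n) ∈ (diagOp (moyalLadder lam hlam).basis μ).domain) :
    diagOp (moyalLadder lam hlam).basis μ ⟨emb ((moyalLadder lam hlam).h m n), hm⟩ =
      (μ (m, n) : ℂ) • emb ((moyalLadder lam hlam).h m n) := by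
  have h := basis_mem_graph_diagOp (moyalLadder lam hlam).basis μ (m, n)
  rw [Ladder.basis_apply] at h
  obtain ⟨e, he, he'⟩ := (LinearPMap.mem_graph_iff _).1 h
  exact (congrArg _ (Subtype.ext he.symm)).trans he'

include hlam in
/-- Between neighbouring eigenstates, `lᵢ(a)` misses the distance, by an amount whose sign does not
depend on the pair. -/
lemma lRatio_step (i : Fin 3) :
    StrictMono (fun m : ℕ => Real.sqrt (2 * lam ^ 2 * m + 2 * lam ^ 2 * lRatio i) - optVal lam m) ∨
    StrictAnti fun m : ℕ => Real.sqrt (2 * lam ^ 2 * m + 2 * lam ^ 2 * lRatio i) - optVal lam m := by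
  have h2 : 0 < Real.sqrt 2 := by positivity
  have h22 : Real.sqrt 2 * Real.sqrt 2 = 2 := Real.mul_self_sqrt (by norm_num)
  have hg : ∀ y : ℝ, Real.sqrt (2 * lam ^ 2 * y + 2 * lam ^ 2 * lRatio i) =
      lam * Real.sqrt 2 * Real.sqrt (y + lRatio i) := fun y => by
    rw [← mul_add, Real.sqrt_mul (by positivity), Real.sqrt_mul (by norm_num), Real.sqrt_sq hlam.le]
    ring
  -- with `u = √(m+c)`, `v = √(m+1+c)`, `w = √(m+1)`, the step is `λ√2 (v - u - 1/(2w))`, and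
  -- `(v - u) (v + u) = 1`, so that its sign is that of `2w - (u + v)`
  have key : ∀ m : ℕ, ∃ u v w : ℝ, 0 ≤ u ∧ 0 < v ∧ 0 < w ∧ u ^ 2 = m + lRatio i ∧
      v ^ 2 = m + 1 + lRatio i ∧ w ^ 2 = m + 1 ∧
      (Real.sqrt (2 * lam ^ 2 * (m + 1 : ℕ) + 2 * lam ^ 2 * lRatio i) - optVal lam (m + 1)) -
      (Real.sqrt (2 * lam ^ 2 * m + 2 * lam ^ 2 * lRatio i) - optVal lam m) =
        lam * Real.sqrt 2 / (2 * w * (u + v)) * (2 * w - (u + v)) := by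
    intro m
    have hr := lRatio_nonneg i
    refine ⟨Real.sqrt (m + lRatio i), Real.sqrt (m + 1 + lRatio i), Real.sqrt (m + 1),
      Real.sqrt_nonneg _, Real.sqrt_pos.2 (by positivity), Real.sqrt_pos.2 (by positivity),
      Real.sq_sqrt (by positivity), Real.sq_sqrt (by positivity), Real.sq_sqrt (by positivity), ?_⟩
    have hv : 0 < Real.sqrt (m + 1 + lRatio i) := Real.sqrt_pos.2 (by positivity)
    have hw : 0 < Real.sqrt ((m : ℝ) + 1) := Real.sqrt_pos.2 (by positivity)
    have hu := Real.sqrt_nonneg (m + lRatio i)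
    have eu : Real.sqrt (m + lRatio i) ^ 2 = m + lRatio i := Real.sq_sqrt (by positivity)
    have ev : Real.sqrt (m + 1 + lRatio i) ^ 2 = m + 1 + lRatio i := Real.sq_sqrt (by positivity)
    have hs := optVal_succ_sub hlam m
    rw [Real.sqrt_mul (by norm_num)] at hs
    rw [hg, hg, sub_sub_sub_comm, hs]
    push_cast
    have huv : 0 < Real.sqrt (m + lRatio i) + Real.sqrt (m + 1 + lRatio i) := by linarith
    have e1 : lam / (Real.sqrt 2 * Real.sqrt (m + 1)) =
        lam * Real.sqrt 2 / (2 * Real.sqrt (m + 1)) := by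
      rw [div_eq_div_iff (by positivity) (by positivity)]
      linear_combination (-lam * Real.sqrt (m + 1)) * h22
    rw [e1]
    field_simp
    linear_combination (2 * Real.sqrt ((m : ℝ) + 1)) * (ev - eu)
  fin_cases i
  -- `c = 1/2`: here `u² + v² = 2 w²`, so `u + v < 2 w`
  · refine Or.inl (strictMono_nat_of_lt_succ fun m => ?_)
    obtain ⟨u, v, w, hu, hv, hw, e1, e2, e3, e⟩ := key m
    simp only [lRatio] at e1 e2
    have huv : v - u ≠ 0 := fun h => by rw [sub_eq_zero.1 h] at e2; linarith
    have : u + v < 2 * w := lt_of_pow_lt_pow_left₀ 2 (by positivity) (by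
      nlinarith [sq_pos_of_ne_zero huv])
    have : 0 < lam * Real.sqrt 2 / (2 * w * (u + v)) * (2 * w - (u + v)) :=
      mul_pos (by positivity) (by linarith)
    linarith
  · refine Or.inl (strictMono_nat_of_lt_succ fun m => ?_)
    obtain ⟨u, v, w, hu, hv, hw, e1, e2, e3, e⟩ := key m
    simp only [lRatio] at e1 e2
    have huv : u < v := lt_of_pow_lt_pow_left₀ 2 hv.le (by linarith)
    have hvw : v = w := (sq_eq_sq₀ hv.le hw.le).1 (by linarith)
    have : u + v < 2 * w := by linarith
    have : 0 < lam * Real.sqrt 2 / (2 * w * (u + v)) * (2 * w - (u + v)) :=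
      mul_pos (by positivity) (by linarith)
    linarith
  · refine Or.inr (strictAnti_nat_of_succ_lt fun m => ?_)
    obtain ⟨u, v, w, hu, hv, hw, e1, e2, e3, e⟩ := key m
    simp only [lRatio] at e1 e2
    have huv : u < v := lt_of_pow_lt_pow_left₀ 2 hv.le (by linarith)
    have huw : u = w := (sq_eq_sq₀ hu hw.le).1 (by linarith)
    have : 2 * w < u + v := by linarith
    have : lam * Real.sqrt 2 / (2 * w * (u + v)) * (2 * w - (u + v)) < 0 :=
      mul_neg_of_pos_of_neg (by positivity) (by linarith)
    linarith

include hlam in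
/-- `lᵢ(a)` does not realize the distance between different eigenstates. -/
lemma enorm_sqrt_sub_ne (i : Fin 3) {m n : ℕ} (hmn : m ≠ n) :
    ‖((Real.sqrt (2 * lam ^ 2 * m + 2 * lam ^ 2 * lRatio i) : ℝ) : ℂ) -
      ((Real.sqrt (2 * lam ^ 2 * n + 2 * lam ^ 2 * lRatio i) : ℝ) : ℂ)‖ₑ ≠
      spectralDist lam (omega lam m) (omega lam n) := by
  obtain ⟨g, hg⟩ : ∃ g : ℕ → ℝ, ∀ m, g m =
    Real.sqrt (2 * lam ^ 2 * m + 2 * lam ^ 2 * lRatio i) := ⟨_, fun _ => rfl⟩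
  -- `g` and the eigenvalues of the optimal element increase, so equality of the distances means
  -- equality of the differences
  have hinj : Function.Injective fun m => g m - optVal lam m := by
    simp only [hg]
    rcases lRatio_step hlam i with h | h
    exacts [h.injective, h.injective]
  have hmono : Monotone g := fun m n h => by
    rw [hg, hg]
    refine Real.sqrt_le_sqrt ?_
    have : (m : ℝ) ≤ n := by exact_mod_cast h
    gcongr
  rw [spectralDist_omega hlam, ← hg, ← hg]
  intro h
  have h' : |g m - g n| = |optVal lam m - optVal lam n| := by
    rw [← Real.norm_eq_abs, ← Real.norm_eq_abs, ← Complex.norm_real, ← Complex.norm_real,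
      Complex.ofReal_sub, Complex.ofReal_sub, ← toReal_enorm, h, toReal_enorm]
  apply hmn
  apply hinj
  rcases le_total m n with hle | hle
  · have h1 := hmono hle
    have h2 := (optVal_strictMono hlam).monotone hle
    rw [abs_of_nonpos (by linarith), abs_of_nonpos (by linarith)] at h'
    simp only; linarith
  · have h1 := hmono hle
    have h2 := (optVal_strictMono hlam).monotone hle
    rw [abs_of_nonneg (by linarith), abs_of_nonneg (by linarith)] at h'
    simp only; linarith

include hlam in
/-- The values of a regularizable element realize the distance. -/
lemma HasRegularization.enorm_sub_eq {T : Sch → L2} {m n : ℕ} (h : HasRegularization lam T m n) :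
    ‖omegaOp lam m T - omegaOp lam n T‖ₑ = spectralDist lam (omega lam m) (omega lam n) := by
  obtain ⟨a, -, h2, h3⟩ := h
  refine tendsto_nhds_unique ?_ h3
  have h4 : ∀ m, Tendsto (fun k => omega lam m (a k)) atTop (𝓝 (omegaOp lam m T)) := fun m => by
    refine (tendsto_const_nhds.inner (h2 (wigner lam m))).congr fun k => ?_
    rw [omega_eq hlam, wigner_eq hlam, leftOp]
  exact ((h4 m).sub (h4 n)).enorm

include hlam in
theorem lSq_not_optimal (i : Fin 3) :
    (∃! A : L2 →ₗ.[ℂ] L2, IsPosSqrt (lSq lam i (leftMul lam z) (leftMul lam zbar)) A) ∧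
    ∀ A : L2 →ₗ.[ℂ] L2, IsPosSqrt (lSq lam i (leftMul lam z) (leftMul lam zbar)) A →
      ∃ hA : ∀ ψ : Sch, emb ψ ∈ A.domain, ∀ m n : ℕ, m ≠ n →
        ¬ IsOptimal lam (fun ψ => A ⟨emb ψ, hA ψ⟩) m n ∧
        ¬ HasRegularization lam (fun ψ => A ⟨emb ψ, hA ψ⟩) m n := by
  refine ⟨⟨_, (isPosSqrt_lSq_iff hlam i _).2 rfl, fun A hA => (isPosSqrt_lSq_iff hlam i A).1 hA⟩,
    fun A hA => ⟨hA.emb_mem_domain, fun m n hmn => ?_⟩⟩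
  have hv : ∀ m, omegaOp lam m (fun ψ => A ⟨emb ψ, hA.emb_mem_domain ψ⟩) =
      ((Real.sqrt (2 * lam ^ 2 * m + 2 * lam ^ 2 * lRatio i) : ℝ) : ℂ) := by
    have hd := hA.emb_mem_domain
    obtain rfl := (isPosSqrt_lSq_iff hlam i A).1 hA
    intro m
    rw [omegaOp]
    simp only [wigner_eq hlam]
    rw [diagOp_apply_emb_h hlam, inner_smul_right, Ladder.inner_h]
    simp
  have hne := enorm_sqrt_sub_ne hlam i hmn
  rw [← hv, ← hv] at hne
  exact ⟨fun h => hne h.value, fun h => hne (h.enorm_sub_eq hlam)⟩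

end

end Moyal

end

theorem mainTheorem6 (lam : ℝ) (hlam : 0 < lam) :
    -- the length operator `L` exists, is unique, and equals each of the `l_i(da)`
    (∃ L : Moyal.L2 →ₗ.[ℂ] Moyal.L2, ∀ A : Moyal.L2 →ₗ.[ℂ] Moyal.L2,
      (Moyal.IsPosSqrt (Moyal.lengthSq lam) A ↔ A = L) ∧
      ∀ i : Fin 3,
        (Moyal.IsPosSqrt (Moyal.lSq lam i (Moyal.da lam) (Moyal.daStar lam)) A ↔ A = L)) ∧
    -- some solution `l₀` is optimal, up to regularization, between any two eigenstates
    (∃ l₀ : ℝ × ℝ → ℂ, Moyal.IsMultiplier lam l₀ ∧ Moyal.IsSolution lam l₀ ∧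
      ∀ m n : ℕ, Moyal.IsOptimal lam (Moyal.leftOp lam l₀) m n ∧
        Moyal.HasRegularization lam (Moyal.leftOp lam l₀) m n) ∧
    -- and whatever is optimal between any two eigenstates is a solution
    (∀ l : ℝ × ℝ → ℂ, Moyal.IsMultiplier lam l →
      (∀ m n : ℕ, Moyal.IsOptimal lam (Moyal.leftOp lam l) m n) → Moyal.IsSolution lam l) ∧
    -- the operators `l_i(a)`, with `a` represented by `𝓛(z)`, are not optimal
    (∀ i : Fin 3,
      (∃! A : Moyal.L2 →ₗ.[ℂ] Moyal.L2, Moyal.IsPosSqrt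
        (Moyal.lSq lam i (Moyal.leftMul lam Moyal.z) (Moyal.leftMul lam Moyal.zbar)) A) ∧
      ∀ A : Moyal.L2 →ₗ.[ℂ] Moyal.L2, Moyal.IsPosSqrt
        (Moyal.lSq lam i (Moyal.leftMul lam Moyal.z) (Moyal.leftMul lam Moyal.zbar)) A →
        ∃ hA : ∀ ψ : Moyal.Sch, Moyal.emb ψ ∈ A.domain,
          ∀ m n : ℕ, m ≠ n →
            ¬ Moyal.IsOptimal lam (fun ψ => A ⟨Moyal.emb ψ, hA ψ⟩) m n ∧
            ¬ Moyal.HasRegularization lam (fun ψ => A ⟨Moyal.emb ψ, hA ψ⟩) m n) := by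
  refine ⟨Moyal.existsUnique_length lam hlam,
    ⟨Moyal.optSym lam, Moyal.isMultiplier_optSym hlam,
      Moyal.isSolution_of_isOptimal hlam (Moyal.isMultiplier_optSym hlam)
        (Moyal.isOptimal_optSym hlam),
      fun m n => ⟨Moyal.isOptimal_optSym hlam m n, Moyal.hasRegularization_optSym hlam m n⟩⟩,
    fun l hl h => Moyal.isSolution_of_isOptimal hlam hl h, Moyal.lSq_not_optimal hlam⟩
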